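/- Let $F$ be a field of characteristic $0$ containing elements $q,t$ algebraically independent over $\mathbb Q$ and a square root $\sqrt q$ of $q$ (for instance $F=\mathbb Q(\sqrt q,t)$), and let $n\ge 0$. Let $BC_n$ act on Laurent polynomials in $x_1,\dots,x_n$ by permuting the variables and by $x_i\mapsto 1/x_i$. For a partition $\lambda=(\lambda_1\ge\dots\ge\lambda_n\ge 0)$ with at most $n$ parts let $m_\lambda$ be the sum over the $BC_n$-orbit of $\prod_i x_i^{\lambda_i}$; the elements $s^km_\lambda$ ($k\in\mathbb Z$) form a basis of $F[s,1/s][x_i^{\pm1}]^{BC_n}$. Write $\mu\le\lambda$ if $\mu_1+\dots+\mu_j\le\lambda_1+\dots+\lambda_j$ for all $j\le n$ (the sizes $|\lambda|=\sum_i\lambda_i$ and $|\mu|$ may differ), and say that $s^lm_\mu$ is dominated by $s^km_\lambda$ if $\mu\le\lambda$ and $|l-k|\le|\lambda|-|\mu|$. Write $\lambda\subset\mu$ if $\lambda_i\le\mu_i$ for all $i$. For $u\in F$ define $$(D^{(n)}_s(u;q,t)f)(x_1,\dots,x_n;s)=\sum_{\sigma\in\{\pm1\}^n}\prod_{1\le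 i\le n}\frac{(1-s x_i^{\sigma_i})(1-u x_i^{\sigma_i}/s)}{1-x_i^{2\sigma_i}}\prod_{1\le i<j\le n}\frac{1-t x_i^{\sigma_i}x_j^{\sigma_j}}{1-x_i^{\sigma_i}x_j^{\sigma_j}}\,f(x_1q^{\sigma_1/2},\dots,x_nq^{\sigma_n/2};s\sqrt q).$$ For $p\in F(s)[x_i^{\pm1}]^{BC_n}$ put $p(\mu;s)=p(q^{\mu_1}t^{n-1}s,q^{\mu_2}t^{n-2}s,\dots,q^{\mu_n}s;s)$. All partitions below have at most $n$ parts. Theorem. (a) For all $u$, $k$, $\lambda$, the operator $D^{(n)}_s(u;q,t)$ preserves the $F$-span of the monomials dominated by $s^km_\lambda$, and $D^{(n)}_s(u;q,t)$ and $D^{(n)}_s(v;q,t)$ commute on $F[s,1/s][x_i^{\pm1}]^{BC_n}$ for all $u,v\in F$. There are elements $\bar P^{*(n)}_\lambda(x;q,t,s)\in\mathbb Q(q,t)[s,1/s][x_i^{\pm1}]^{BC_n}$, one for each partition $\lambda$, of the form $m_\lambda$ plus an $F$-linear combination of monomials $s^lm_\mu$ strictly dominated by $m_\lambda$, such that for all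 $u\in F$ and $k\in\mathbb Z$ $$D^{(n)}_s(u;q,t)\,s^k\bar P^{*(n)}_\lambda=q^{k/2}q^{-|\lambda|/2}\prod_{1\le i\le n}(1-q^{\lambda_i}t^{n-i}u)\;s^k\bar P^{*(n)}_\lambda .$$ Moreover, for all but finitely many $u\in F$ (depending on $\lambda$), $\bar P^{*(n)}_\lambda$ is the only eigenfunction of $D^{(n)}_s(u;q,t)$ of the form $m_\lambda$ plus strictly dominated monomials. (b) $\bar P^{*(n)}_\lambda(\mu;s)=0$ for every partition $\mu$ with $\lambda\not\subset\mu$. (c) $\bar P^{*(n)}_\lambda(\lambda;s)\ne 0$. Consequently the $\bar P^{*(n)}_\lambda$ are Okounkov's $BC_n$ interpolation polynomials up to normalization: a Laurent polynomial $g\in F(s)[x_i^{\pm1}]$ is of the form $c\,\bar P^{*(n)}_\lambda(t^{n-1}s x_1,t^{n-2}s x_2,\dots,s x_n;q,t,s)$ with $c\in F(s)$, $c\neq0$, if and only if $g(x)=f(t^{n-1}s x_1,\dots,s x_n)$ for some $f\in F(s)[x_i^{\pm1}]^{BC_n}$, every monomial $\prod_i x_i^{a_i}$ occurring in $g$ has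 $\sum_i|a_i|\le|\lambda|$, $g(q^{\lambda_1},\dots,q^{\lambda_n})\ne0$, and $g(q^{\mu_1},\dots,q^{\mu_n})=0$ for every partition $\mu\ne\lambda$ with $|\mu|\le|\lambda|$. -/

import Mathlib

open scoped BigOperators LaurentPolynomial

noncomputable section

namespace BCInterp

/-! ### Partitions with at most `n` parts -/

/-- Partitions with at most `n` parts, written `lam 0 ≥ lam 1 ≥ ... ≥ lam (n-1) ≥ 0`. -/
abbrev Par (n : ℕ) : Type := {lam : Fin n → ℕ // Antitone lam}

variable {n : ℕ}

/-- The size `|lam|`, as an integer. -/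
def Par.size (lam : Par n) : ℤ := ∑ i, (lam.1 i : ℤ)

/-- Containment of diagrams. -/
def Par.Contained (lam mu : Par n) : Prop := ∀ i, lam.1 i ≤ mu.1 i

/-- Dominance order, also for partitions of different sizes: `DomLE mu lam` means that each
partial sum of `mu` is at most the corresponding partial sum of `lam`. -/
def Par.DomLE (mu lam : Par n) : Prop :=
  ∀ j : Fin n, ∑ i ∈ Finset.Iic j, mu.1 i ≤ ∑ i ∈ Finset.Iic j, lam.1 i

/-- The dominance order on the pairs `(k, lam)` indexing the monomials `s ^ k * m_lam`:
`MonLE l mu k lam` means `(l, mu) ≤ (k, lam)`. -/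
def MonLE (l : ℤ) (mu : Par n) (k : ℤ) (lam : Par n) : Prop :=
  mu.DomLE lam ∧ |l - k| ≤ lam.size - mu.size

/-! ### Laurent polynomials in `x_1, ..., x_n` over a commutative ring `R` -/

/-- The ring `R[x_1^{±1}, ..., x_n^{±1}]`; `single a c` is the monomial `c * ∏ i, x_i ^ (a i)`. -/
abbrev Laurent (R : Type*) [CommRing R] (n : ℕ) : Type _ := AddMonoidAlgebra R (Fin n → ℤ)

/-- Invariance under permutations of the variables and under `x_i ↦ 1 / x_i`. -/
def IsBCSymm {R : Type*} [CommRing R] (f : Laurent R n) : Prop :=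
  ∀ (π : Equiv.Perm (Fin n)) (σ : Fin n → ℤˣ) (a : Fin n → ℤ),
    f.coeff (fun i => (σ i : ℤ) * a (π i)) = f.coeff a

/-- The orbit of the exponent vector `lam` under signed permutations. -/
def orbit (lam : Par n) : Finset (Fin n → ℤ) :=
  Finset.univ.image fun g : Equiv.Perm (Fin n) × (Fin n → ℤˣ) =>
    fun i => (g.2 i : ℤ) * (lam.1 (g.1 i) : ℤ)

/-- The orbit sum `m_lam`. -/
def orbitSum (R : Type*) [CommRing R] (lam : Par n) : Laurent R n :=
  ∑ a ∈ orbit lam, AddMonoidAlgebra.single a 1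

/-- The value of the monomial with exponent vector `a` at the point `z`. -/
def monoChar {R : Type*} [CommRing R] (z : Fin n → Rˣ) :
    Multiplicative (Fin n → ℤ) →* Rˣ where
  toFun a := ∏ i, z i ^ (a.toAdd i)
  map_one' := by simp
  map_mul' a b := by simp [zpow_add, Finset.prod_mul_distrib]

/-- Evaluation `f(z_1, ..., z_n)` of a Laurent polynomial at a point with unit coordinates. -/
def evalAt {R : Type*} [CommRing R] (z : Fin n → Rˣ) : Laurent R n →ₐ[R] R :=
  AddMonoidAlgebra.lift R R (Fin n → ℤ) ((Units.coeHom R).comp (monoChar z))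

/-- For a character `χ` of `G`, the endomorphism `single g c ↦ single g (χ g * c)` of `R[G]`. -/
def twistHom {R G : Type*} [CommRing R] [AddCommGroup G] (χ : Multiplicative G →* Rˣ) :
    AddMonoidAlgebra R G →ₐ[R] AddMonoidAlgebra R G :=
  AddMonoidAlgebra.lift R (AddMonoidAlgebra R G) G
    { toFun := fun g => AddMonoidAlgebra.single g.toAdd (χ g : R)
      map_one' := by simp [AddMonoidAlgebra.one_def]
      map_mul' := fun a b => by simp [AddMonoidAlgebra.single_mul_single] }

theorem twistHom_single {R G : Type*} [CommRing R] [AddCommGroup G]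
    (χ : Multiplicative G →* Rˣ) (g : G) (c : R) :
    twistHom χ (AddMonoidAlgebra.single g c) =
      AddMonoidAlgebra.single g (c * (χ (Multiplicative.ofAdd g) : R)) := by
  simp [twistHom]

/-- `twistHom` as an automorphism; its inverse is the twist by the inverse character. -/
def twist {R G : Type*} [CommRing R] [AddCommGroup G] (χ : Multiplicative G →* Rˣ) :
    AddMonoidAlgebra R G ≃ₐ[R] AddMonoidAlgebra R G :=
  AlgEquiv.ofAlgHom (twistHom χ) (twistHom χ⁻¹)
    (by ext g; simp [twistHom_single]) (by ext g; simp [twistHom_single])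

/-- The substitution `f(x_1, ..., x_n) ↦ f(z_1 x_1, ..., z_n x_n)`. -/
def rescale {R : Type*} [CommRing R] (z : Fin n → Rˣ) : Laurent R n ≃ₐ[R] Laurent R n :=
  twist (monoChar z)

/-! ### The rings `F[s, 1/s][x^{±1}]`, `F(s)[x^{±1}]` and the field `F(s, x_1, ..., x_n)` -/

variable {F : Type*} [Field F]

/-- `F[s, 1/s][x_1^{±1}, ..., x_n^{±1}]`; the variable `s` is `T 1` in `F[T;T⁻¹]`. -/
abbrev SLaurent (F : Type*) [Field F] (n : ℕ) : Type _ := Laurent F[T;T⁻¹] n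

/-- The field `F(s, x_1, ..., x_n)`. -/
abbrev RatFn (F : Type*) [Field F] (n : ℕ) : Type _ := FractionRing (SLaurent F n)

/-- The field `F(s)`. -/
abbrev SField (F : Type*) [Field F] : Type _ := FractionRing F[T;T⁻¹]

/-- The basis element `s ^ k * m_lam` of the ring of `BC_n`-symmetric elements. -/
def sMon (F : Type*) [Field F] (k : ℤ) (lam : Par n) : SLaurent F n :=
  (LaurentPolynomial.T k : F[T;T⁻¹]) • orbitSum F[T;T⁻¹] lam

/-- The span of the monomials dominated by `s ^ k * m_lam`. -/
def domSpan (F : Type*) [Field F] (k : ℤ) (lam : Par n) : Submodule F (SLaurent F n) :=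
  Submodule.span F {f | ∃ l mu, MonLE l mu k lam ∧ f = sMon F l mu}

/-- The span of the monomials strictly dominated by `s ^ k * m_lam`. -/
def strictDomSpan (F : Type*) [Field F] (k : ℤ) (lam : Par n) : Submodule F (SLaurent F n) :=
  Submodule.span F {f | ∃ l mu, MonLE l mu k lam ∧ (l, mu) ≠ (k, lam) ∧ f = sMon F l mu}

/-- Inclusion of `F[s, 1/s][x^{±1}]` into `F(s, x_1, ..., x_n)`. -/
def toRat (f : SLaurent F n) : RatFn F n := algebraMap (SLaurent F n) (RatFn F n) f

/-- Inclusion of `F[s, 1/s][x^{±1}]` into `F(s)[x^{±1}]`. -/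
def toSField (f : SLaurent F n) : Laurent (SField F) n :=
  AddMonoidAlgebra.mapRingHom (Fin n → ℤ) (algebraMap F[T;T⁻¹] (SField F)) f

/-- A constant as an element of `F(s, x_1, ..., x_n)`. -/
def constR (n : ℕ) (c : F) : RatFn F n :=
  toRat (AddMonoidAlgebra.single 0 (LaurentPolynomial.C c))

/-- The variable `s` as an element of `F(s, x_1, ..., x_n)`. -/
def sR (F : Type*) [Field F] (n : ℕ) : RatFn F n :=
  toRat (AddMonoidAlgebra.single 0 (LaurentPolynomial.T 1))

/-- The element `x_i ^ e` of `F(s, x_1, ..., x_n)`, for a sign `e`. -/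
def xR (F : Type*) [Field F] (i : Fin n) (e : ℤˣ) : RatFn F n :=
  toRat (AddMonoidAlgebra.single (Pi.single i (e : ℤ)) 1)

/-- The substitution `f(x_1, ..., x_n; s) ↦ f(x_1 r^{σ_1}, ..., x_n r^{σ_n}; s)` on
`F(s, x_1, ..., x_n)`. -/
def shiftX (r : Fˣ) (σ : Fin n → ℤˣ) : RatFn F n ≃+* RatFn F n :=
  IsFractionRing.ringEquivOfRingEquiv
    (rescale fun i => Units.map (LaurentPolynomial.C (R := F)).toMonoidHom
      (r ^ (σ i : ℤ))).toRingEquiv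

/-- The substitution `f(s) ↦ f(r s)` on `F[s, 1/s]`. -/
def scaleS (r : Fˣ) : F[T;T⁻¹] ≃ₐ[F] F[T;T⁻¹] := twist (zpowersHom Fˣ r)

/-- The substitution `f(x_1, ..., x_n; s) ↦ f(x_1, ..., x_n; r s)` on `F[s, 1/s][x^{±1}]`. -/
def scaleSPoly (n : ℕ) (r : Fˣ) : SLaurent F n ≃+* SLaurent F n :=
  RingEquiv.ofRingHom
    (AddMonoidAlgebra.mapRingHom (Fin n → ℤ) ((scaleS r : F[T;T⁻¹] →+* F[T;T⁻¹])))
    (AddMonoidAlgebra.mapRingHom (Fin n → ℤ) ((scaleS r).symm : F[T;T⁻¹] →+* F[T;T⁻¹]))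
    (by refine RingHom.ext fun f => ?_; ext a; simp)
    (by refine RingHom.ext fun f => ?_; ext a; simp)

/-- The substitution `f(x_1, ..., x_n; s) ↦ f(x_1, ..., x_n; r s)` on `F(s, x_1, ..., x_n)`. -/
def shiftS (r : Fˣ) : RatFn F n ≃+* RatFn F n :=
  IsFractionRing.ringEquivOfRingEquiv (scaleSPoly n r)

/-! ### The difference operators -/

/-- The operator `D^{(n)}(u₁, u₂; q, t)`, acting on rational functions; `r` is the chosen square
root of `q`, and `u₁`, `u₂` may be rational functions (they are not shifted). -/
def diffOp (r t : Fˣ) (u₁ u₂ : RatFn F n) (f : RatFn F n) : RatFn F n :=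
  ∑ σ : Fin n → ℤˣ,
    (∏ i, (1 - u₁ * xR F i (σ i)) * (1 - u₂ * xR F i (σ i)) / (1 - xR F i (σ i) ^ 2)) *
    (∏ i, ∏ j ∈ Finset.Ioi i,
      (1 - constR n (t : F) * xR F i (σ i) * xR F j (σ j)) /
        (1 - xR F i (σ i) * xR F j (σ j))) *
    shiftX r σ f

/-- The `s`-shifting operator `D^{(n)}_s(u; q, t)`:
`(D_s(u) f)(x; s) = D^{(n)}(s, u/s; q, t) f(x; s √q)`. -/
def diffOpS (r t : Fˣ) (u : F) (f : RatFn F n) : RatFn F n :=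
  diffOp r t (sR F n) (constR n u / sR F n) (shiftS r f)

/-- `E^{(n)}_lam(u; q, t) = q^{-|lam|/2} ∏ i, (1 - q^{lam_i} t^{n-i} u)`, with `i` running from
`1` to `n`, where `q = r ^ 2`. -/
def eigenE (r t : Fˣ) (lam : Par n) (u : F) : F :=
  (r : F) ^ (-lam.size) *
    ∏ i : Fin n, (1 - ((r : F) ^ 2) ^ lam.1 i * (t : F) ^ (n - 1 - (i : ℕ)) * u)

/-! ### Evaluation at partitions, and Okounkov's polynomials -/

/-- A nonzero constant as a unit of `F(s)`. -/
def constS (c : Fˣ) : (SField F)ˣ :=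
  Units.map ((algebraMap F[T;T⁻¹] (SField F)).comp (LaurentPolynomial.C (R := F))).toMonoidHom c

/-- The variable `s` as a unit of `F(s)`. -/
def sS (F : Type*) [Field F] : (SField F)ˣ :=
  Units.map (algebraMap F[T;T⁻¹] (SField F)).toMonoidHom
    (LaurentPolynomial.isUnit_T (R := F) 1).unit

/-- `p(mu; s) = p(q^{mu_1} t^{n-1} s, q^{mu_2} t^{n-2} s, ..., q^{mu_n} s; s)`. -/
def evalPar (q t : Fˣ) (p : Laurent (SField F) n) (mu : Par n) : SField F :=
  evalAt (fun i => constS (q ^ mu.1 i * t ^ (n - 1 - (i : ℕ))) * sS F) p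

/-- The substitution `p(x_1, ..., x_n) ↦ p(t^{n-1} s x_1, t^{n-2} s x_2, ..., s x_n)`. -/
def okShift (t : Fˣ) (p : Laurent (SField F) n) : Laurent (SField F) n :=
  rescale (fun i => constS (t ^ (n - 1 - (i : ℕ))) * sS F) p

/-- `g` is an Okounkov `BC_n` interpolation polynomial of index `lam` (in any normalization):
a Laurent polynomial over `F(s)`, invariant under permutations and inversions of the variables
after `x_i` is replaced by `x_i / (t^{n-i} s)`, of degree at most `|lam|`, nonzero at
`(q^{lam_1}, ..., q^{lam_n})` and zero at `(q^{mu_1}, ..., q^{mu_n})` for all other partitions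
`mu` with `|mu| ≤ |lam|`. -/
structure IsOkounkov (q t : Fˣ) (lam : Par n) (g : Laurent (SField F) n) : Prop where
  symm : ∃ f : Laurent (SField F) n, IsBCSymm f ∧ g = okShift t f
  degree : ∀ a, g.coeff a ≠ 0 → ∑ i, |a i| ≤ lam.size
  vanish : ∀ mu : Par n, mu.size ≤ lam.size → mu ≠ lam →
    evalAt (fun i => constS (q ^ mu.1 i)) g = 0
  ne_zero : evalAt (fun i => constS (q ^ lam.1 i)) g ≠ 0

/-- `f` has the form `m_lam + (combination of strictly dominated monomials)`. -/
def IsMonicTriangular (lam : Par n) (f : SLaurent F n) : Prop :=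
  f - sMon F 0 lam ∈ strictDomSpan F 0 lam

end BCInterp

end

open BCInterp

/-! Multiply `D_s(u)` by the Weyl denominator of type C. The resulting operator `opA` has no
denominators, sends symmetric elements to antisymmetric ones, and sends `s^k m_λ` to an element with
leading exponent `(ρ + λ, k)`, whose coefficient is the claimed eigenvalue. An antisymmetric element
supported below `ρ + λ` is the Weyl denominator times a symmetric element supported below `λ`
(`IsAntisymm.exists_eq_mul`), so `D_s(u)` is triangular on the `s^k m_λ`.

At the special value `u = -t` the eigenvalues belonging to different partitions stay different even
after multiplication by powers of `√q` (`par_eq_of_prod_eq`). Triangularity then gives a monic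
eigenfunction `P_λ` of this single operator.

Vanishing comes from evaluating the eigenvalue equation at `x_i = q^{μ_i} t^{n-i} s`. Because `s` is
shifted along with `x`, a sign `+1` leaves `μ_i` alone and a sign `-1` lowers it by one. The
coefficient of a choice of signs is zero whenever the lowered sequence is not a partition. If `f`
already vanishes at all partitions strictly inside `μ`, only the term with all signs `+1` survives,
and the equation relates `f(μ; s)` to `f(μ; s√q)`. Comparing lowest terms in `s` shows that either
`f(μ; s) = 0` or the eigenvalue is that of `μ` up to a power of `√q` (`ev_eq_zero_or`). At `u = -t`
the second case forces `μ = λ`, and induction on the size yields the vanishing. Were `P_λ(λ; s)`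
also zero, the induction would run through every partition, and `P_λ` would be zero by linear
independence of characters (`eq_zero_of_ev_eq_zero`).

The rest follows from interpolation. The matrix `P_λ(μ; s)` is triangular for containment with
nonzero diagonal, so a combination of strictly dominated monomials that vanishes at every `μ` not
containing `λ` is zero (`IsInterpolating.eq_zero_of_mem_strictDomSpan`). Applied to `D_s(u) P_λ - E
P_λ`, this gives the eigenvalue equation for all `u`, hence commutativity. Applied to the difference
of `P_λ` and its image under a `ℚ(q,t)`-linear projection of the coefficients, it gives rationality.
The same triangularity, now for bounded degree, gives the comparison with Okounkov's polynomials. -/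

noncomputable section

namespace BCInterp

variable {n : ℕ} {F : Type*} [Field F]

/-! ### Leading terms -/

section LeadingTerms

variable {G B A : Type*} [AddCommMonoid G] [AddCommMonoid B] [CommRing A] [Algebra F A]

/-- The span of the monomials with exponents in `S`. -/
def monSpan (F : Type*) [Field F] [Algebra F A] (mon : Multiplicative G →* A) (S : Set G) :
    Submodule F A :=
  Submodule.span F ((fun x => mon (Multiplicative.ofAdd x)) '' S)

theorem mon_mem_monSpan (mon : Multiplicative G →* A) {S : Set G} {x : G} (hx : x ∈ S) :
    mon (Multiplicative.ofAdd x) ∈ monSpan F mon S :=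
  Submodule.subset_span ⟨x, hx, rfl⟩

theorem monSpan_mono (mon : Multiplicative G →* A) {S S' : Set G} (h : S ⊆ S') :
    monSpan F mon S ≤ monSpan F mon S' :=
  Submodule.span_mono (Set.image_mono h)

theorem mul_mem_monSpan (mon : Multiplicative G →* A) {S S' U : Set G} {f g : A}
    (hf : f ∈ monSpan F mon S) (hg : g ∈ monSpan F mon S')
    (h : ∀ x ∈ S, ∀ y ∈ S', x + y ∈ U) : f * g ∈ monSpan F mon U := by
  have hfg := Submodule.mul_mem_mul hf hg
  rw [monSpan, monSpan, Submodule.span_mul_span] at hfg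
  refine Submodule.span_le.2 ?_ hfg
  rintro _ ⟨_, ⟨x, hx, rfl⟩, _, ⟨y, hy, rfl⟩, rfl⟩
  simp only [SetLike.mem_coe, ← map_mul, ← ofAdd_add]
  exact mon_mem_monSpan mon (h x hx y hy)

/-- A family of sets of exponents `S b`, each with a distinguished extremal exponent, which is
compatible with addition. -/
structure IsLeading (lead : B →+ G) (S : B → Set G) : Prop where
  lead_mem : ∀ b, lead b ∈ S b
  add_mem : ∀ {b b' x y}, x ∈ S b → y ∈ S b' → x + y ∈ S (b + b')
  unique : ∀ {b b' x y}, x ∈ S b → y ∈ S b' → x + y = lead (b + b') → x = lead b ∧ y = lead b'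

/-- `f` is a combination of monomials with exponents in `S b`, with coefficient `c` at the
extremal exponent. -/
def HasLead (mon : Multiplicative G →* A) (lead : B →+ G) (S : B → Set G) (b : B) (c : F)
    (f : A) : Prop :=
  f - c • mon (Multiplicative.ofAdd (lead b)) ∈ monSpan F mon (S b \ {lead b})

variable {mon : Multiplicative G →* A} {lead : B →+ G} {S : B → Set G}

theorem HasLead.mem (hS : IsLeading lead S) {b : B} {c : F} {f : A}
    (h : HasLead mon lead S b c f) : f ∈ monSpan F mon (S b) := by
  have := add_mem (monSpan_mono mon Set.sdiff_subset h)
    (Submodule.smul_mem _ c (mon_mem_monSpan (F := F) mon (hS.lead_mem b)))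
  simpa using this

/-- The remainder is (remainder of `f`) times `f'` plus (leading term of `f`) times (remainder of
`f'`). By the uniqueness clause of `IsLeading`, neither product can reach the extremal exponent. -/
theorem HasLead.mul (hS : IsLeading lead S) {b b' : B} {c c' : F} {f f' : A}
    (h : HasLead mon lead S b c f) (h' : HasLead mon lead S b' c' f') :
    HasLead mon lead S (b + b') (c * c') (f * f') := by
  have e : f * f' - (c * c') • mon (Multiplicative.ofAdd (lead (b + b'))) =
      (f - c • mon (Multiplicative.ofAdd (lead b))) * f' +
        c • (mon (Multiplicative.ofAdd (lead b)) *
          (f' - c' • mon (Multiplicative.ofAdd (lead b')))) := by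
    rw [map_add, ofAdd_add, map_mul]
    simp only [Algebra.smul_def, map_mul]
    ring
  unfold HasLead
  rw [e]
  refine add_mem (mul_mem_monSpan mon h (h'.mem hS) ?_) (Submodule.smul_mem _ _
    (mul_mem_monSpan mon (mon_mem_monSpan mon (hS.lead_mem b)) h' ?_))
  · intro x hx y hy
    exact ⟨hS.add_mem hx.1 hy, fun hxy => hx.2 (hS.unique hx.1 hy hxy).1⟩
  · intro x hx y hy
    exact ⟨hS.add_mem hx hy.1, fun hxy => hy.2 (hS.unique hx hy.1 hxy).2⟩

theorem HasLead.sum {ι : Type*} {b : B} (s : Finset ι) {c : ι → F} {f : ι → A}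
    (h : ∀ i ∈ s, HasLead mon lead S b (c i) (f i)) :
    HasLead mon lead S b (∑ i ∈ s, c i) (∑ i ∈ s, f i) := by
  unfold HasLead
  rw [Finset.sum_smul, ← Finset.sum_sub_distrib]
  exact Submodule.sum_mem _ h

theorem HasLead.one : HasLead mon lead S 0 (1 : F) (1 : A) := by
  simp [HasLead]

theorem HasLead.prod (hS : IsLeading lead S) {ι : Type*} (s : Finset ι) {b : ι → B} {c : ι → F}
    {f : ι → A} (h : ∀ i ∈ s, HasLead mon lead S (b i) (c i) (f i)) :
    HasLead mon lead S (∑ i ∈ s, b i) (∏ i ∈ s, c i) (∏ i ∈ s, f i) := by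
  classical
  induction s using Finset.induction_on with
  | empty => simpa using HasLead.one
  | insert i s hi ih =>
    rw [Finset.sum_insert hi, Finset.prod_insert hi, Finset.prod_insert hi]
    exact (h i (by simp)).mul hS (ih fun j hj => h j (by simp [hj]))

theorem hasLead_of_eq {b : B} {c : F} {f g : A}
    (h : f = c • mon (Multiplicative.ofAdd (lead b)) + g)
    (hg : g ∈ monSpan F mon (S b \ {lead b})) : HasLead mon lead S b c f := by
  simpa [HasLead, h] using hg

end LeadingTerms

/-! ### The dominance order -/

theorem Par.DomLE.sum_le {mu lam : Par n} (h : mu.DomLE lam) (j : Fin n) :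
    ∑ i ∈ Finset.Iic j, (mu.1 i : ℤ) ≤ ∑ i ∈ Finset.Iic j, (lam.1 i : ℤ) := by
  exact_mod_cast h j

theorem eq_of_sum_Iic_eq {M : Type*} [AddCommGroup M] {a b : Fin n → M}
    (h : ∀ j, ∑ i ∈ Finset.Iic j, a i = ∑ i ∈ Finset.Iic j, b i) : a = b := by
  have key : ∀ m : ℕ, ∀ j : Fin n, (j : ℕ) = m → a j = b j := by
    intro m
    induction m using Nat.strong_induction_on with
    | _ m ih =>
      intro j hj
      have hI : Finset.Iic j = insert j (Finset.Iio j) := by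
        ext i; simp [le_iff_eq_or_lt]
      have hlt : ∀ i ∈ Finset.Iio j, a i = b i := fun i hi =>
        ih i (by have := Finset.mem_Iio.1 hi; omega) i rfl
      have := h j
      rw [hI, Finset.sum_insert (by simp), Finset.sum_insert (by simp),
        Finset.sum_congr rfl hlt] at this
      exact add_right_cancel this
  exact funext fun j => key j j rfl

theorem sum_univ_eq_sum_Iic (hn : 0 < n) {M : Type*} [AddCommMonoid M] (a : Fin n → M) :
    ∑ i, a i = ∑ i ∈ Finset.Iic (⟨n - 1, by omega⟩ : Fin n), a i := by
  congr 1
  ext i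
  simp [Fin.le_def]
  omega

theorem sum_univ_le_of_sum_Iic_le {a b : Fin n → ℤ}
    (h : ∀ j, ∑ i ∈ Finset.Iic j, a i ≤ ∑ i ∈ Finset.Iic j, b i) : ∑ i, a i ≤ ∑ i, b i := by
  rcases Nat.eq_zero_or_pos n with rfl | hn
  · simp
  · rw [sum_univ_eq_sum_Iic hn, sum_univ_eq_sum_Iic hn]
    exact h _

theorem Par.DomLE.size_le {mu lam : Par n} (h : mu.DomLE lam) : mu.size ≤ lam.size :=
  sum_univ_le_of_sum_Iic_le h.sum_le

theorem Par.DomLE.refl (lam : Par n) : lam.DomLE lam := fun _ => le_rfl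

theorem Par.DomLE.trans {lam mu nu : Par n} (h : lam.DomLE mu) (h' : mu.DomLE nu) :
    lam.DomLE nu := fun j => (h j).trans (h' j)

theorem Par.DomLE.antisymm {mu lam : Par n} (h : mu.DomLE lam) (h' : lam.DomLE mu) :
    mu = lam := by
  have := eq_of_sum_Iic_eq (a := fun i => (mu.1 i : ℤ)) (b := fun i => (lam.1 i : ℤ))
    fun j => le_antisymm (h.sum_le j) (h'.sum_le j)
  exact Subtype.ext (funext fun i => by exact_mod_cast congrFun this i)

theorem Par.eq_of_contained {lam mu : Par n} (h : lam.Contained mu) (h' : mu.size ≤ lam.size) :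
    lam = mu := by
  have h1 : ∀ i ∈ Finset.univ, (lam.1 i : ℤ) ≤ mu.1 i := fun i _ => by exact_mod_cast h i
  have := (Finset.sum_eq_sum_iff_of_le h1).1 (le_antisymm (Finset.sum_le_sum h1) h')
  exact Subtype.ext (funext fun i => by exact_mod_cast this i (Finset.mem_univ i))

theorem MonLE.refl (k : ℤ) (lam : Par n) : MonLE k lam k lam := ⟨.refl _, by simp⟩

theorem MonLE.trans {k l m : ℤ} {lam mu nu : Par n} (h : MonLE k lam l mu)
    (h' : MonLE l mu m nu) : MonLE k lam m nu :=
  ⟨h.1.trans h'.1, by have := abs_sub_le k l m; have := h.2; have := h'.2; linarith⟩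

theorem MonLE.eq_of_eq {k l : ℤ} {lam : Par n} (h : MonLE l lam k lam) : l = k := by
  have := h.2
  rw [sub_self] at this
  exact sub_eq_zero.1 (abs_eq_zero.1 (le_antisymm this (abs_nonneg _)))

/-- The sum of all partial sums of `lam`. -/
def Par.height (lam : Par n) : ℕ := ∑ j, ∑ i ∈ Finset.Iic j, lam.1 i

theorem Par.DomLE.height_lt {mu lam : Par n} (h : mu.DomLE lam) (hne : mu ≠ lam) :
    mu.height < lam.height := by
  refine lt_of_le_of_ne (Finset.sum_le_sum fun j _ => h j) fun he => hne ?_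
  refine h.antisymm fun j => ?_
  exact ((Finset.sum_eq_sum_iff_of_le fun j _ => h j).1 he j (Finset.mem_univ j)).ge

/-- Equal partitions leave no room for different powers of `s`, so strict domination always moves
the partition strictly down. Induction on the height is therefore available although the exponent of
`s` runs over all integers. -/
theorem MonLE.height_lt {k l : ℤ} {mu lam : Par n} (h : MonLE l mu k lam)
    (hne : (l, mu) ≠ (k, lam)) : mu.height < lam.height := by
  refine h.1.height_lt ?_
  rintro rfl
  exact hne (by rw [h.eq_of_eq])

theorem MonLE.lt_trans {k l m : ℤ} {lam mu nu : Par n} (h : MonLE k lam l mu)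
    (h' : MonLE l mu m nu) (hne : (l, mu) ≠ (m, nu)) : (k, lam) ≠ (m, nu) := by
  intro he
  have h2 := h'.height_lt hne
  obtain ⟨rfl, rfl⟩ := Prod.mk.inj he
  by_cases hx : (k, lam) = (l, mu)
  · exact hne (hx ▸ rfl)
  · exact absurd (h.height_lt hx) (by omega)

theorem finite_size_le (n : ℕ) (d : ℤ) : {mu : Par n | mu.size ≤ d}.Finite := by
  have : ((fun mu : Par n => mu.1) '' {mu : Par n | mu.size ≤ d}).Finite := by
    refine (Set.finite_Iic (fun _ : Fin n => d.toNat)).subset ?_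
    rintro _ ⟨mu, hmu, rfl⟩ i
    have h1 : (mu.1 i : ℤ) ≤ mu.size :=
      Finset.single_le_sum (f := fun i => (mu.1 i : ℤ)) (fun _ _ => by positivity)
        (Finset.mem_univ i)
    have h2 : mu.size ≤ d := hmu
    show mu.1 i ≤ d.toNat
    omega
  exact this.of_finite_image Subtype.val_injective.injOn

theorem Par.size_nonneg (lam : Par n) : 0 ≤ lam.size := Finset.sum_nonneg fun _ _ => by positivity

/-- The pairs `(l, mu)` dominated by `(k, lam)`. -/
def below (k : ℤ) (lam : Par n) : Set (ℤ × Par n) := {p | MonLE p.1 p.2 k lam}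

theorem finite_below (k : ℤ) (lam : Par n) : (below k lam).Finite := by
  refine ((Set.finite_Icc (k - lam.size) (k + lam.size)).prod (finite_size_le n lam.size)).subset ?_
  rintro ⟨l, mu⟩ h
  have h1 := h.2
  have h2 := h.1.size_le
  have h3 := mu.size_nonneg
  have := abs_le.1 h1
  simp only at this
  exact ⟨⟨by linarith, by linarith⟩, h2⟩

/-! ### Monomials and coefficients -/

/-- The monomials `x ^ a * s ^ l`. -/
def smon (F : Type*) [Field F] (n : ℕ) : Multiplicative ((Fin n → ℤ) × ℤ) →* SLaurent F n where
  toFun x := AddMonoidAlgebra.single x.toAdd.1 (LaurentPolynomial.T x.toAdd.2)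
  map_one' := rfl
  map_mul' a b := by
    rw [AddMonoidAlgebra.single_mul_single, ← LaurentPolynomial.T_add]
    rfl

theorem smon_ofAdd (a : Fin n → ℤ) (l : ℤ) :
    smon F n (Multiplicative.ofAdd (a, l)) =
      AddMonoidAlgebra.single a (LaurentPolynomial.T l) := rfl

/-- The coefficient of `x ^ a * s ^ l`. -/
def cf (x : (Fin n → ℤ) × ℤ) : SLaurent F n →ₗ[F] F where
  toFun f := (f.coeff x.1).coeff x.2
  map_add' f g := by simp
  map_smul' c f := by simp

theorem cf_apply (x : (Fin n → ℤ) × ℤ) (f : SLaurent F n) : cf x f = (f.coeff x.1).coeff x.2 := rfl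

theorem cf_smon (x y : (Fin n → ℤ) × ℤ) :
    cf y (smon F n (Multiplicative.ofAdd x)) = if x = y then 1 else 0 := by
  obtain ⟨a, l⟩ := x
  obtain ⟨b, m⟩ := y
  rw [smon_ofAdd, cf_apply, AddMonoidAlgebra.coeff_single, Finsupp.single_apply]
  by_cases h : a = b <;> by_cases h' : l = m <;> simp [h, h']

theorem cf_eq_zero_of_mem {S : Set ((Fin n → ℤ) × ℤ)} {f : SLaurent F n}
    (hf : f ∈ monSpan F (smon F n) S) {x : (Fin n → ℤ) × ℤ} (hx : x ∉ S) : cf x f = 0 := by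
  refine (Submodule.span_le.2 ?_ hf : f ∈ LinearMap.ker (cf x))
  rintro _ ⟨y, hy, rfl⟩
  simp only [SetLike.mem_coe, LinearMap.mem_ker, cf_smon]
  exact if_neg fun h : y = x => hx (h ▸ hy)

theorem HasLead.cf_eq {B : Type*} [AddCommMonoid B] {lead : B →+ (Fin n → ℤ) × ℤ}
    {S : B → Set ((Fin n → ℤ) × ℤ)} {b : B} {c : F} {f : SLaurent F n}
    (h : HasLead (smon F n) lead S b c f) : cf (lead b) f = c := by
  have := cf_eq_zero_of_mem h (x := lead b) (by simp)
  rw [map_sub, map_smul, cf_smon, if_pos rfl, sub_eq_zero] at this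
  simpa using this

/-- The extremal exponent of the region `sdom`. -/
def slead (n : ℕ) : (Fin n → ℕ) × ℤ →+ (Fin n → ℤ) × ℤ where
  toFun p := (fun i => (p.1 i : ℤ), p.2)
  map_zero' := by ext <;> simp
  map_add' p q := by ext <;> simp

/-- The exponents `(a, l)` of monomials dominated by `x ^ b * s ^ k`, where `p = (b, k)`. -/
def sdom (p : (Fin n → ℕ) × ℤ) : Set ((Fin n → ℤ) × ℤ) :=
  {x | (∀ j, ∑ i ∈ Finset.Iic j, |x.1 i| ≤ ∑ i ∈ Finset.Iic j, (p.1 i : ℤ)) ∧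
    |x.2 - p.2| ≤ ∑ i, (p.1 i : ℤ) - ∑ i, |x.1 i|}

/-- Additivity is the triangle inequality. If a sum is extremal, every partial-sum bound is attained
by both summands, which fixes their `x`-exponents; the bound on the power of `s` is then zero. -/
theorem isLeading_sdom : IsLeading (slead n) sdom where
  lead_mem b := by simp [slead, sdom]
  add_mem := by
    rintro ⟨b, k⟩ ⟨b', k'⟩ ⟨a, l⟩ ⟨a', l'⟩ ⟨h1, h2⟩ ⟨h1', h2'⟩
    have hs : ∀ s : Finset (Fin n), ∑ i ∈ s, |a i + a' i| ≤ ∑ i ∈ s, |a i| + ∑ i ∈ s, |a' i| :=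
      fun s => by
        rw [← Finset.sum_add_distrib]; exact Finset.sum_le_sum fun i _ => abs_add_le _ _
    refine ⟨fun j => ?_, ?_⟩
    · have := h1 j
      have := h1' j
      have := hs (Finset.Iic j)
      simp only [Prod.fst_add, Pi.add_apply, Nat.cast_add, Finset.sum_add_distrib] at *
      linarith
    · have := hs Finset.univ
      have h3 : l + l' - (k + k') = (l - k) + (l' - k') := by ring
      have h4 := abs_add_le (l - k) (l' - k')
      simp only [Prod.fst_add, Prod.snd_add, Pi.add_apply, Nat.cast_add, Finset.sum_add_distrib,
        h3] at *
      linarith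
  unique := by
    rintro ⟨b, k⟩ ⟨b', k'⟩ ⟨a, l⟩ ⟨a', l'⟩ ⟨h1, h2⟩ ⟨h1', h2'⟩ h
    simp only [slead, AddMonoidHom.coe_mk, ZeroHom.coe_mk, Prod.mk_add_mk, Prod.mk.injEq] at h ⊢
    simp only at h1 h2 h1' h2'
    obtain ⟨h, hl⟩ := h
    have le1 : ∀ s : Finset (Fin n), ∑ i ∈ s, a i ≤ ∑ i ∈ s, |a i| :=
      fun s => Finset.sum_le_sum fun i _ => le_abs_self _
    have le2 : ∀ s : Finset (Fin n), ∑ i ∈ s, a' i ≤ ∑ i ∈ s, |a' i| :=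
      fun s => Finset.sum_le_sum fun i _ => le_abs_self _
    have hsum : ∀ s : Finset (Fin n), ∑ i ∈ s, a i + ∑ i ∈ s, a' i =
        ∑ i ∈ s, (b i : ℤ) + ∑ i ∈ s, (b' i : ℤ) := fun s => by
      rw [← Finset.sum_add_distrib, ← Finset.sum_add_distrib]
      refine Finset.sum_congr rfl fun i _ => ?_
      have := congrFun h i
      simpa using this
    have ea : a = fun i => (b i : ℤ) := eq_of_sum_Iic_eq fun j => by
      linarith [h1 j, h1' j, le1 (Finset.Iic j), le2 (Finset.Iic j), hsum (Finset.Iic j)]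
    have ea' : a' = fun i => (b' i : ℤ) := eq_of_sum_Iic_eq fun j => by
      linarith [h1 j, h1' j, le1 (Finset.Iic j), le2 (Finset.Iic j), hsum (Finset.Iic j)]
    refine ⟨⟨ea, ?_⟩, ⟨ea', ?_⟩⟩
    · have : |l - k| ≤ 0 := by linarith [le1 Finset.univ, congrArg (fun a => ∑ i, a i) ea]
      exact sub_eq_zero.1 (abs_nonpos_iff.1 this)
    · have : |l' - k'| ≤ 0 := by linarith [le2 Finset.univ, congrArg (fun a => ∑ i, a i) ea']
      exact sub_eq_zero.1 (abs_nonpos_iff.1 this)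

theorem mem_sdom_par {l k : ℤ} {mu lam : Par n} :
    ((fun i => (mu.1 i : ℤ)), l) ∈ sdom (lam.1, k) ↔ MonLE l mu k lam := by
  simp only [sdom, Set.mem_ofPred_eq, Nat.abs_cast, MonLE, Par.DomLE, Par.size]
  norm_cast

/-! ### Signed permutations -/

/-- The action of a signed permutation on exponents. -/
def wact (π : Equiv.Perm (Fin n)) (σ : Fin n → ℤˣ) : (Fin n → ℤ) ≃+ (Fin n → ℤ) where
  toFun a i := σ i * a (π i)
  invFun b i := σ (π.symm i) * b (π.symm i)
  left_inv a := by ext i; simp [← mul_assoc, ← Units.val_mul]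
  right_inv b := by ext i; simp [← mul_assoc, ← Units.val_mul]
  map_add' a b := by ext i; simp [mul_add]

theorem wact_apply (π : Equiv.Perm (Fin n)) (σ : Fin n → ℤˣ) (a : Fin n → ℤ) (i : Fin n) :
    wact π σ a i = σ i * a (π i) := rfl

theorem abs_wact (π : Equiv.Perm (Fin n)) (σ : Fin n → ℤˣ) (a : Fin n → ℤ) (i : Fin n) :
    |wact π σ a i| = |a (π i)| := by
  rw [wact_apply, abs_mul, Int.isUnit_iff_abs_eq.1 (σ i).isUnit, one_mul]

/-- A partition as an exponent vector. -/
def Par.exp (lam : Par n) : Fin n → ℤ := fun i => lam.1 i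

theorem exists_wact_antitone (a : Fin n → ℤ) :
    ∃ (π : Equiv.Perm (Fin n)) (σ : Fin n → ℤˣ) (mu : Par n), wact π σ a = mu.exp := by
  refine ⟨Tuple.sort fun i => -|a i|,
    fun i => if 0 ≤ a (Tuple.sort (fun i => -|a i|) i) then 1 else -1,
    ⟨fun i => (a (Tuple.sort (fun i => -|a i|) i)).natAbs, ?_⟩, ?_⟩
  · intro i j hij
    have := Tuple.monotone_sort (fun i => -|a i|) hij
    simp only [Function.comp, Int.abs_eq_natAbs] at this ⊢
    omega
  · ext i
    simp only [wact_apply, Par.exp, Int.natCast_natAbs]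
    split_ifs with h
    · simp [abs_of_nonneg h]
    · simp [abs_of_neg (not_le.1 h)]

theorem IsBCSymm.coeff_wact {R : Type*} [CommRing R] {f : Laurent R n} (hf : IsBCSymm f)
    (π : Equiv.Perm (Fin n)) (σ : Fin n → ℤˣ) (a : Fin n → ℤ) :
    f.coeff (wact π σ a) = f.coeff a := hf π σ a

/-- The submodule of symmetric Laurent polynomials. -/
def symSub (R : Type*) [CommRing R] (n : ℕ) : Submodule R (Laurent R n) where
  carrier := {f | IsBCSymm f}
  add_mem' {f g} hf hg π σ a := by simp [hf π σ a, hg π σ a]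
  zero_mem' π σ a := by simp
  smul_mem' c f hf π σ a := by simp [hf π σ a]

theorem mem_symSub {R : Type*} [CommRing R] {f : Laurent R n} : f ∈ symSub R n ↔ IsBCSymm f :=
  Iff.rfl

theorem mem_orbit {lam : Par n} {a : Fin n → ℤ} :
    a ∈ orbit lam ↔ ∃ π σ, wact π σ lam.exp = a := by
  simp only [orbit, Finset.mem_image, Finset.mem_univ, true_and, Prod.exists]
  rfl

theorem wact_wact (π π' : Equiv.Perm (Fin n)) (σ σ' : Fin n → ℤˣ) (a : Fin n → ℤ) :
    wact π σ (wact π' σ' a) = wact (π.trans π') (fun i => σ i * σ' (π i)) a := by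
  ext i
  simp [wact_apply, mul_assoc]

theorem wact_symm (π : Equiv.Perm (Fin n)) (σ : Fin n → ℤˣ) (a : Fin n → ℤ) :
    (wact π σ).symm a = wact π.symm (fun i => σ (π.symm i)) a := rfl

theorem wact_mem_orbit {lam : Par n} {a : Fin n → ℤ} (π : Equiv.Perm (Fin n)) (σ : Fin n → ℤˣ) :
    wact π σ a ∈ orbit lam ↔ a ∈ orbit lam := by
  simp only [mem_orbit]
  constructor
  · rintro ⟨π', σ', h⟩
    rw [← AddEquiv.eq_symm_apply] at h
    exact ⟨π'.symm.trans π |>.symm, _, by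
      rw [← (wact π σ).symm_apply_apply a, ← (AddEquiv.eq_symm_apply _).1 h, wact_symm, wact_wact]
      rfl⟩
  · rintro ⟨π', σ', rfl⟩
    exact ⟨_, _, (wact_wact _ _ _ _ _).symm⟩

theorem coeff_orbitSum {R : Type*} [CommRing R] (lam : Par n) (a : Fin n → ℤ) :
    (orbitSum R lam).coeff a = if a ∈ orbit lam then 1 else 0 := by
  simp [orbitSum, AddMonoidAlgebra.coeff_sum, Finsupp.single_apply]

theorem isBCSymm_orbitSum {R : Type*} [CommRing R] (lam : Par n) :
    IsBCSymm (orbitSum R lam) := by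
  intro π σ a
  rw [coeff_orbitSum, coeff_orbitSum]
  exact if_congr (wact_mem_orbit π σ) rfl rfl

/-- The rearrangement inequality against the indicator function of `{i ≤ j}`. -/
theorem sum_Iic_comp_perm_le (lam : Par n) (π : Equiv.Perm (Fin n)) (j : Fin n) :
    ∑ i ∈ Finset.Iic j, (lam.1 (π i) : ℤ) ≤ ∑ i ∈ Finset.Iic j, (lam.1 i : ℤ) := by
  have hf : Antitone fun i : Fin n => if i ≤ j then (1 : ℤ) else 0 := by
    intro a b hab
    simp only
    split_ifs with h1 h2
    · rfl
    · exact absurd (hab.trans h1) h2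
    · norm_num
    · rfl
  have hg : Antitone fun i : Fin n => (lam.1 i : ℤ) := fun a b hab =>
    Nat.cast_le.2 (lam.2 hab)
  have := (hf.monovary hg).sum_mul_comp_perm_le_sum_mul (σ := π)
  have hI : Finset.Iic j = Finset.univ.filter (· ≤ j) := by ext; simp
  simpa [hI, Finset.sum_filter] using this

theorem sum_Iic_abs_orbit_le {lam : Par n} {a : Fin n → ℤ} (ha : a ∈ orbit lam) (j : Fin n) :
    ∑ i ∈ Finset.Iic j, |a i| ≤ ∑ i ∈ Finset.Iic j, (lam.1 i : ℤ) := by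
  obtain ⟨π, σ, rfl⟩ := mem_orbit.1 ha
  simp only [abs_wact, Par.exp, Nat.abs_cast]
  exact sum_Iic_comp_perm_le lam π j

theorem sum_abs_orbit {lam : Par n} {a : Fin n → ℤ} (ha : a ∈ orbit lam) :
    ∑ i, |a i| = lam.size := by
  obtain ⟨π, σ, rfl⟩ := mem_orbit.1 ha
  simp only [abs_wact, Par.exp, Nat.abs_cast]
  exact Equiv.sum_comp π fun i => (lam.1 i : ℤ)

theorem exp_mem_orbit_self (lam : Par n) : lam.exp ∈ orbit lam :=
  mem_orbit.2 ⟨1, 1, by ext; simp [wact_apply]⟩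

theorem exp_mem_orbit {lam mu : Par n} : mu.exp ∈ orbit lam ↔ mu = lam := by
  refine ⟨fun h => ?_, fun h => h ▸ exp_mem_orbit_self _⟩
  have key : ∀ {lam mu : Par n}, mu.exp ∈ orbit lam → mu.DomLE lam := fun h j => by
    have := sum_Iic_abs_orbit_le h j
    simp only [Par.exp, Nat.abs_cast] at this
    exact_mod_cast this
  refine (key h).antisymm (key ?_)
  obtain ⟨π, σ, h⟩ := mem_orbit.1 h
  rw [← AddEquiv.eq_symm_apply] at h
  exact mem_orbit.2 ⟨_, _, by rw [h, wact_symm]⟩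

theorem Par.exp_injective : Function.Injective (Par.exp : Par n → Fin n → ℤ) := fun _ _ h =>
  Subtype.ext (funext fun i => Nat.cast_injective (R := ℤ) (congrFun h i))

theorem IsBCSymm.ext {R : Type*} [CommRing R] {f g : Laurent R n} (hf : IsBCSymm f)
    (hg : IsBCSymm g) (h : ∀ mu : Par n, f.coeff mu.exp = g.coeff mu.exp) : f = g := by
  ext a : 2
  obtain ⟨π, σ, mu, hmu⟩ := exists_wact_antitone a
  rw [← hf.coeff_wact π σ a, ← hg.coeff_wact π σ a, hmu, h]

theorem IsBCSymm.eq_sum {R : Type*} [CommRing R] {f : Laurent R n} (hf : IsBCSymm f) :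
    f = ∑ mu ∈ f.coeff.support.preimage Par.exp Par.exp_injective.injOn,
      f.coeff mu.exp • orbitSum R mu := by
  refine hf.ext ?_ fun nu => ?_
  · exact mem_symSub.1 (Submodule.sum_mem _ fun mu _ =>
      Submodule.smul_mem _ _ (mem_symSub.2 (isBCSymm_orbitSum mu)))
  · simp only [AddMonoidAlgebra.coeff_sum, AddMonoidAlgebra.coeff_smul, Finsupp.coe_finsetSum,
      Finset.sum_apply, Finsupp.smul_apply, coeff_orbitSum, exp_mem_orbit, smul_eq_mul]
    simp

/-! ### Spans of the elements `s ^ l * m_mu` -/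

/-- The span of the elements `s ^ l * m_mu` with `(l, mu)` in `Q`. -/
def sSpan (F : Type*) [Field F] (Q : Set (ℤ × Par n)) : Submodule F (SLaurent F n) :=
  Submodule.span F ((fun p => sMon F p.1 p.2) '' Q)

theorem sMon_mem_sSpan {Q : Set (ℤ × Par n)} {l : ℤ} {mu : Par n} (h : (l, mu) ∈ Q) :
    sMon F l mu ∈ sSpan F Q := Submodule.subset_span ⟨(l, mu), h, rfl⟩

theorem sSpan_mono {Q Q' : Set (ℤ × Par n)} (h : Q ⊆ Q') : sSpan F Q ≤ sSpan F Q' :=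
  Submodule.span_mono (Set.image_mono h)

theorem domSpan_eq (k : ℤ) (lam : Par n) : domSpan F k lam = sSpan F (below k lam) := by
  rw [domSpan, sSpan]
  congr 1
  ext f
  simp [below, eq_comm]

theorem strictDomSpan_eq (k : ℤ) (lam : Par n) :
    strictDomSpan F k lam = sSpan F (below k lam \ {(k, lam)}) := by
  rw [strictDomSpan, sSpan]
  congr 1
  ext f
  simp only [below, Set.mem_image, Set.mem_ofPred_eq, Set.mem_sdiff, Set.mem_singleton_iff,
    Prod.exists, and_assoc]
  simp only [eq_comm (a := f), ne_eq]

theorem isBCSymm_sMon (k : ℤ) (lam : Par n) : IsBCSymm (sMon F k lam) :=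
  Submodule.smul_mem (symSub _ n) _ (isBCSymm_orbitSum lam)

theorem sMon_eq_sum (k : ℤ) (lam : Par n) :
    sMon F k lam = ∑ a ∈ orbit lam, smon F n (Multiplicative.ofAdd (a, k)) := by
  simp [sMon, orbitSum, Finset.smul_sum, smon_ofAdd]

theorem hasLead_sMon (k : ℤ) (lam : Par n) :
    HasLead (smon F n) (slead n) sdom (lam.1, k) (1 : F) (sMon F k lam) := by
  refine hasLead_of_eq (g := ∑ a ∈ (orbit lam).erase lam.exp,
    smon F n (Multiplicative.ofAdd (a, k))) ?_ (Submodule.sum_mem _ fun a ha => ?_)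
  · rw [sMon_eq_sum, ← Finset.add_sum_erase _ _ (exp_mem_orbit_self lam), one_smul]
    rfl
  · obtain ⟨h1, h2⟩ := Finset.mem_erase.1 ha
    refine mon_mem_monSpan _ ⟨⟨sum_Iic_abs_orbit_le h2, ?_⟩, fun h => h1 (congrArg Prod.fst h)⟩
    simp only [sum_abs_orbit h2]
    simp [Par.size]

theorem cf_sMon (l k : ℤ) (mu lam : Par n) :
    cf (mu.exp, l) (sMon F k lam) = if (l, mu) = (k, lam) then 1 else 0 := by
  rw [cf_apply, sMon, AddMonoidAlgebra.coeff_smul, Finsupp.smul_apply, coeff_orbitSum]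
  simp only [exp_mem_orbit, Prod.mk.injEq]
  by_cases h : mu = lam <;> by_cases h' : l = k <;> simp [h, h', eq_comm]

theorem isBCSymm_of_mem_sSpan {Q : Set (ℤ × Par n)} {f : SLaurent F n} (hf : f ∈ sSpan F Q) :
    IsBCSymm f := by
  refine mem_symSub.1 ((Submodule.span_le.2 ?_ hf :
    f ∈ (symSub F[T;T⁻¹] n).restrictScalars F))
  rintro _ ⟨p, _, rfl⟩
  exact isBCSymm_sMon _ _

theorem cf_eq_zero_of_mem_sSpan {Q : Set (ℤ × Par n)} {f : SLaurent F n} (hf : f ∈ sSpan F Q)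
    {l : ℤ} {mu : Par n} (h : (l, mu) ∉ Q) : cf (mu.exp, l) f = 0 := by
  refine (Submodule.span_le.2 ?_ hf : f ∈ LinearMap.ker (cf (mu.exp, l)))
  rintro _ ⟨p, hp, rfl⟩
  simp only [SetLike.mem_coe, LinearMap.mem_ker, cf_sMon]
  exact if_neg fun h' : (l, mu) = p => h (h' ▸ hp)

theorem laurent_eq_sum (c : F[T;T⁻¹]) :
    c = ∑ l ∈ c.coeff.support, c.coeff l • LaurentPolynomial.T l := by
  conv_lhs => rw [← AddMonoidAlgebra.sum_coeff_single c, Finsupp.sum]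
  simp [LaurentPolynomial.smul_eq_C_mul, LaurentPolynomial.single_eq_C_mul_T]

theorem mem_sSpan_of_cf {Q : Set (ℤ × Par n)} {f : SLaurent F n} (hf : IsBCSymm f)
    (h : ∀ l mu, cf (mu.exp, l) f ≠ 0 → (l, mu) ∈ Q) : f ∈ sSpan F Q := by
  rw [hf.eq_sum]
  refine Submodule.sum_mem _ fun mu _ => ?_
  rw [laurent_eq_sum (f.coeff mu.exp), Finset.sum_smul]
  refine Submodule.sum_mem _ fun l hl => ?_
  rw [smul_assoc]
  exact Submodule.smul_mem _ _ (sMon_mem_sSpan (h l mu (by simpa [cf_apply] using hl)))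

theorem mem_sSpan_iff {Q : Set (ℤ × Par n)} {f : SLaurent F n} :
    f ∈ sSpan F Q ↔ IsBCSymm f ∧ ∀ l mu, cf (mu.exp, l) f ≠ 0 → (l, mu) ∈ Q :=
  ⟨fun h => ⟨isBCSymm_of_mem_sSpan h, fun _ _ h' => by_contra fun hn =>
    h' (cf_eq_zero_of_mem_sSpan h hn)⟩, fun h => mem_sSpan_of_cf h.1 h.2⟩

theorem isMonicTriangular_iff {lam : Par n} {f : SLaurent F n} :
    IsMonicTriangular lam f ↔ f ∈ domSpan F 0 lam ∧ cf (lam.exp, 0) f = 1 := by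
  have h0 : sMon F 0 lam ∈ sSpan F (below 0 lam) := sMon_mem_sSpan (MonLE.refl 0 lam)
  rw [IsMonicTriangular, strictDomSpan_eq, domSpan_eq]
  constructor
  · intro h
    refine ⟨by simpa using add_mem (sSpan_mono Set.sdiff_subset h) h0, ?_⟩
    have := cf_eq_zero_of_mem_sSpan h (l := 0) (mu := lam) (by simp)
    rwa [map_sub, cf_sMon, if_pos rfl, sub_eq_zero] at this
  · rintro ⟨h, h1⟩
    obtain ⟨hs, hc⟩ := mem_sSpan_iff.1 (sub_mem h h0)
    refine mem_sSpan_of_cf hs fun l mu hne => ⟨hc l mu hne, fun he => hne ?_⟩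
    obtain ⟨rfl, rfl⟩ := Prod.mk.inj he
    rw [map_sub, cf_sMon, if_pos rfl, h1, sub_self]

/-! ### The difference operators without denominators -/

/-- The monomial `x_i ^ e`. -/
def xPow (F : Type*) [Field F] (i : Fin n) (e : ℤ) : SLaurent F n :=
  AddMonoidAlgebra.single (Pi.single i e) 1

theorem xPow_mul (i : Fin n) (e e' : ℤ) : xPow F i e * xPow F i e' = xPow F i (e + e') := by
  simp [xPow, AddMonoidAlgebra.single_mul_single, Pi.single_add]

theorem xPow_zero (i : Fin n) : xPow F i 0 = 1 := by
  rw [xPow, Pi.single_zero]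
  rfl

theorem zpow_sum_eq_prod {G ι : Type*} [CommGroup G] (r : G) (s : Finset ι) (f : ι → ℤ) :
    r ^ (∑ i ∈ s, f i) = ∏ i ∈ s, r ^ f i := by
  classical
  induction s using Finset.induction_on with
  | empty => simp
  | insert i s hi ih => rw [Finset.sum_insert hi, Finset.prod_insert hi, zpow_add, ih]

theorem unit_zpow_sum_eq_prod {ι : Type*} (r : Fˣ) (s : Finset ι) (f : ι → ℤ) :
    (r : F) ^ (∑ i ∈ s, f i) = ∏ i ∈ s, (r : F) ^ f i := by
  have := congrArg (Units.val) (zpow_sum_eq_prod r s f)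
  simpa only [Units.coe_prod, Units.val_zpow_eq_zpow_val] using this

/-- A constant from `F[s, 1/s]`. -/
def sConst (n : ℕ) (c : F[T;T⁻¹]) : SLaurent F n := algebraMap F[T;T⁻¹] (SLaurent F n) c

theorem sConst_eq_single (c : F[T;T⁻¹]) : sConst n c = AddMonoidAlgebra.single 0 c := rfl

theorem sConst_C_mul (c : F) (f : SLaurent F n) : sConst n (LaurentPolynomial.C c) * f = c • f := by
  rw [sConst, ← Algebra.smul_def, LaurentPolynomial.C_eq_algebraMap, algebraMap_smul]

/-- The numerator attached to the variable `x_i` and the sign `e`. -/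
def fac (u : F) (i : Fin n) (e : ℤˣ) : SLaurent F n :=
  (-(e : ℤ)) • (xPow F i (-e) - sConst n (LaurentPolynomial.T 1) -
    u • sConst n (LaurentPolynomial.T (-1)) + u • xPow F i e)

/-- The numerator attached to the variables `x_i`, `x_j` and the signs `σ`. -/
def pairFac (t : F) (σ : Fin n → ℤˣ) (i j : Fin n) : SLaurent F n :=
  (1 - t • (xPow F i (σ i) * xPow F j (σ j))) * (xPow F i (-(σ i)) - xPow F j (-(σ j)))

/-- The substitution `f(x; s) ↦ f(x r^σ; r s)`. -/
def shiftXS (r : Fˣ) (σ : Fin n → ℤˣ) : SLaurent F n →+* SLaurent F n :=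
  (rescale fun i => Units.map (LaurentPolynomial.C (R := F)).toMonoidHom
    (r ^ (σ i : ℤ))).toRingEquiv.toRingHom.comp (scaleSPoly n r).toRingHom

/-- The Weyl denominator of type `C`. -/
def weylDen (F : Type*) [Field F] (n : ℕ) : SLaurent F n :=
  (∏ i, (xPow F i 1 - xPow F i (-1))) *
    ∏ i, ∏ j ∈ Finset.Ioi i, (xPow F i 1 + xPow F i (-1) - (xPow F j 1 + xPow F j (-1)))

theorem scaleS_T (r : Fˣ) (l : ℤ) :
    scaleS r (LaurentPolynomial.T l) =
      LaurentPolynomial.C ((r ^ l : Fˣ) : F) * LaurentPolynomial.T l := by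
  have : scaleS r (LaurentPolynomial.T l) = AddMonoidAlgebra.single l (1 * ((r ^ l : Fˣ) : F)) :=
    twistHom_single _ _ _
  rw [this, one_mul, LaurentPolynomial.single_eq_C_mul_T]

theorem scaleS_C (r : Fˣ) (c : F) :
    scaleS r (LaurentPolynomial.C c) = LaurentPolynomial.C c := by
  rw [LaurentPolynomial.C_eq_algebraMap, AlgEquiv.commutes]

theorem coeff_scaleS (r : Fˣ) (c : F[T;T⁻¹]) (l : ℤ) :
    (scaleS r c).coeff l = (r : F) ^ l * c.coeff l := by
  induction c using LaurentPolynomial.induction_on' with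
  | add p q hp hq => simp [mul_add, hp, hq]
  | C_mul_T m a =>
    rw [map_mul, scaleS_C, scaleS_T, ← mul_assoc, ← map_mul,
      ← LaurentPolynomial.single_eq_C_mul_T, ← LaurentPolynomial.single_eq_C_mul_T]
    rw [AddMonoidAlgebra.coeff_single, AddMonoidAlgebra.coeff_single, Finsupp.single_apply,
      Finsupp.single_apply]
    by_cases h : m = l
    · subst h; simp [mul_comm]
    · rw [if_neg h, if_neg h, mul_zero]

theorem shiftXS_single (r : Fˣ) (σ : Fin n → ℤˣ) (a : Fin n → ℤ) (c : F[T;T⁻¹]) :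
    shiftXS r σ (AddMonoidAlgebra.single a c) =
      AddMonoidAlgebra.single a (scaleS r c *
        LaurentPolynomial.C ((r ^ (∑ i, (σ i : ℤ) * a i) : Fˣ) : F)) := by
  have h1 : scaleSPoly n r (AddMonoidAlgebra.single a c) =
      AddMonoidAlgebra.single a (scaleS r c) := AddMonoidAlgebra.mapRingHom_single _ _ _
  have h2 : ∀ z : Fin n → F[T;T⁻¹]ˣ, ∀ c : F[T;T⁻¹], rescale z (AddMonoidAlgebra.single a c) =
      AddMonoidAlgebra.single a (c * (∏ i, z i ^ a i : F[T;T⁻¹]ˣ)) :=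
    fun z c => twistHom_single _ _ _
  show rescale _ (scaleSPoly n r _) = _
  rw [h1, h2]
  congr 2
  have h3 : r ^ (∑ i, (σ i : ℤ) * a i) = ∏ i, (r ^ (σ i : ℤ)) ^ a i := by
    rw [zpow_sum_eq_prod]
    exact Finset.prod_congr rfl fun i _ => zpow_mul _ _ _
  rw [h3]
  simp only [← map_zpow, ← map_prod]
  rfl

theorem shiftXS_smul (r : Fˣ) (σ : Fin n → ℤˣ) (c : F[T;T⁻¹]) (f : SLaurent F n) :
    shiftXS r σ (c • f) = scaleS r c • shiftXS r σ f := by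
  have : shiftXS r σ (sConst n c) = sConst n (scaleS r c) := by
    rw [sConst_eq_single, shiftXS_single]
    simp [sConst_eq_single]
  rw [Algebra.smul_def, Algebra.smul_def, map_mul]
  exact congrArg (· * _) this

/-- `D_s(u)` multiplied by the Weyl denominator. -/
def opA (r t : Fˣ) (u : F) : SLaurent F n →ₛₗ[(scaleS r : F[T;T⁻¹] →+* F[T;T⁻¹])] SLaurent F n where
  toFun f := ∑ σ : Fin n → ℤˣ, (∏ i, fac u i (σ i)) *
    (∏ i, ∏ j ∈ Finset.Ioi i, pairFac (t : F) σ i j) * shiftXS r σ f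
  map_add' f g := by simp [mul_add, Finset.sum_add_distrib]
  map_smul' c f := by
    simp only [shiftXS_smul, Finset.smul_sum, mul_smul_comm]
    rfl

theorem opA_apply (r t : Fˣ) (u : F) (f : SLaurent F n) :
    opA r t u f = ∑ σ : Fin n → ℤˣ, (∏ i, fac u i (σ i)) *
      (∏ i, ∏ j ∈ Finset.Ioi i, pairFac (t : F) σ i j) * shiftXS r σ f := rfl

theorem opA_smul (r t : Fˣ) (u : F) (c : F[T;T⁻¹]) (f : SLaurent F n) :
    opA r t u (c • f) = scaleS r c • opA r t u f := map_smulₛₗ _ _ _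

theorem opA_fsmul (r t : Fˣ) (u c : F) (f : SLaurent F n) :
    opA r t u (c • f) = c • opA r t u f := by
  rw [← algebraMap_smul F[T;T⁻¹] c f, opA_smul, AlgEquiv.commutes, algebraMap_smul]

/-- `opA` as an `F`-linear map. -/
def opAF (r t : Fˣ) (u : F) : SLaurent F n →ₗ[F] SLaurent F n where
  toFun := opA r t u
  map_add' := map_add _
  map_smul' := opA_fsmul r t u

/-! ### Leading terms of the operators -/

/-- The half sum of the positive roots of type `C`. -/
def rho (n : ℕ) : Fin n → ℕ := fun i => n - i

/-- Every factor attached to `x_i`, or to a pair `i < j`, has leading exponent the `i`-th unit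
vector. The `i`-th entry of `ρ` is thus one plus the number of `j > i`. -/
theorem sum_single_add (n : ℕ) :
    (∑ i : Fin n, ((Pi.single i 1, 0) : (Fin n → ℕ) × ℤ)) +
      ∑ i : Fin n, ∑ _j ∈ Finset.Ioi i, ((Pi.single i 1, 0) : (Fin n → ℕ) × ℤ) = (rho n, 0) := by
  rw [← Finset.sum_add_distrib]
  ext i
  · simp [Prod.fst_sum, Pi.single_apply, Finset.sum_apply, rho, Finset.sum_add_distrib]
    omega
  · simp [Prod.snd_sum]

theorem sum_abs_single (s : Finset (Fin n)) (i : Fin n) (e : ℤ) :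
    ∑ j ∈ s, |(Pi.single i e : Fin n → ℤ) j| = if i ∈ s then |e| else 0 := by
  simp [Pi.single_apply, apply_ite abs]

theorem sum_cast_single (s : Finset (Fin n)) (i : Fin n) :
    ∑ j ∈ s, (((Pi.single i 1 : Fin n → ℕ) j : ℕ) : ℤ) = if i ∈ s then 1 else 0 := by
  simp [Pi.single_apply]

theorem single_mem_sdom {i j : Fin n} (hij : i ≤ j) {e : ℤ} (he : |e| ≤ 1) :
    ((Pi.single j e : Fin n → ℤ), (0 : ℤ)) ∈ sdom ((Pi.single i 1 : Fin n → ℕ), 0) := by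
  refine ⟨fun m => ?_, ?_⟩
  · simp only [sum_abs_single, sum_cast_single, Finset.mem_Iic]
    split_ifs with h1 h2 h2
    · exact he
    · exact absurd (hij.trans h1) h2
    · norm_num
    · rfl
  · simp only [sum_abs_single, sum_cast_single, Finset.mem_univ, if_true]
    simpa using he

theorem const_mem_sdom (i : Fin n) {l : ℤ} (hl : |l| ≤ 1) :
    ((0 : Fin n → ℤ), l) ∈ sdom ((Pi.single i 1 : Fin n → ℕ), 0) := by
  refine ⟨fun m => ?_, ?_⟩
  · simp only [sum_cast_single]
    split_ifs <;> simp
  · simp only [sum_cast_single, Finset.mem_univ, if_true]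
    simpa using hl

theorem slead_single (i : Fin n) :
    slead n ((Pi.single i 1 : Fin n → ℕ), (0 : ℤ)) = (Pi.single i 1, 0) := by
  ext j
  · by_cases h : j = i
    · subst h; simp [slead]
    · simp [slead, h]
  · rfl

/-- The span of non-leading monomials allowed in a factor attached to `x_i`. -/
abbrev lowerSpan (F : Type*) [Field F] (i : Fin n) : Submodule F (SLaurent F n) :=
  monSpan F (smon F n) (sdom (Pi.single i 1, 0) \ {slead n (Pi.single i 1, 0)})

theorem xPow_mem_lowerSpan {i j : Fin n} (hij : i ≤ j) {e : ℤ} (he : |e| ≤ 1)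
    (hne : j ≠ i ∨ e ≠ 1) : xPow F j e ∈ lowerSpan F i := by
  refine mon_mem_monSpan (S := _ \ _) (smon F n) ⟨single_mem_sdom hij he, ?_⟩
  rw [slead_single, Set.mem_singleton_iff, Prod.mk.injEq]
  rintro ⟨h, -⟩
  by_cases hj : j = i
  · subst hj
    exact hne.elim (fun h' => h' rfl) fun h' => h' (by simpa using congrFun h j)
  · simpa [Ne.symm hj] using congrFun h i

theorem sConst_T_mem_lowerSpan (i : Fin n) {l : ℤ} (hl : |l| ≤ 1) :
    sConst n (LaurentPolynomial.T l) ∈ lowerSpan F i := by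
  refine mon_mem_monSpan (S := _ \ _) (smon F n) ⟨const_mem_sdom i hl, ?_⟩
  rw [slead_single, Set.mem_singleton_iff, Prod.mk.injEq]
  rintro ⟨h, -⟩
  simpa using congrFun h i

theorem hasLead_of_eq_xPow {i : Fin n} {c : F} {f g : SLaurent F n}
    (h : f = c • xPow F i 1 + g) (hg : g ∈ lowerSpan F i) :
    HasLead (smon F n) (slead n) sdom (Pi.single i 1, 0) c f := by
  refine hasLead_of_eq ?_ hg
  rw [h, slead_single]
  rfl

theorem hasLead_fac (u : F) (i : Fin n) (e : ℤˣ) :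
    HasLead (smon F n) (slead n) sdom (Pi.single i 1, 0) (if e = 1 then -u else 1) (fac u i e) := by
  have h1 := xPow_mem_lowerSpan (F := F) (le_refl i) (e := -1) (by simp) (.inr (by norm_num))
  have h2 := sConst_T_mem_lowerSpan (F := F) i (l := 1) (by simp)
  have h3 := Submodule.smul_mem _ u (sConst_T_mem_lowerSpan (F := F) i (l := -1) (by simp))
  rcases Int.units_eq_one_or e with rfl | rfl
  · refine hasLead_of_eq_xPow (g := -xPow F i (-1) + sConst n (LaurentPolynomial.T 1) +
      u • sConst n (LaurentPolynomial.T (-1))) ?_ (add_mem (add_mem (neg_mem h1) h2) h3)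
    simp only [fac, if_pos, Units.val_one, neg_smul, one_smul]
    abel
  · refine hasLead_of_eq_xPow (g := u • xPow F i (-1) - sConst n (LaurentPolynomial.T 1) -
      u • sConst n (LaurentPolynomial.T (-1))) ?_
      (sub_mem (sub_mem (Submodule.smul_mem _ u h1) h2) h3)
    rw [if_neg (by decide)]
    simp only [fac, Units.val_neg, Units.val_one, neg_neg, one_smul]
    abel

theorem pairFac_eq (t : F) (σ : Fin n → ℤˣ) (i j : Fin n) :
    pairFac t σ i j = xPow F i (-(σ i)) - xPow F j (-(σ j)) - t • xPow F j (σ j) +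
      t • xPow F i (σ i) := by
  have h : ∀ (i : Fin n) (e : ℤ), xPow F i e * xPow F i (-e) = 1 := fun i e => by
    rw [xPow_mul, add_neg_cancel, xPow_zero]
  simp only [pairFac, Algebra.smul_def]
  linear_combination (algebraMap F (SLaurent F n) t * xPow F i (σ i)) * h j (σ j) -
    (algebraMap F (SLaurent F n) t * xPow F j (σ j)) * h i (σ i)

theorem abs_unit (e : ℤˣ) : |(e : ℤ)| = 1 := Int.isUnit_iff_abs_eq.1 e.isUnit

theorem hasLead_pairFac (t : F) (σ : Fin n → ℤˣ) {i j : Fin n} (hij : i < j) :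
    HasLead (smon F n) (slead n) sdom (Pi.single i 1, 0) (if σ i = 1 then t else 1)
      (pairFac t σ i j) := by
  have h1 := xPow_mem_lowerSpan (F := F) (le_refl i) (e := -1) (by simp) (.inr (by norm_num))
  have h2 := xPow_mem_lowerSpan (F := F) hij.le (e := -(σ j)) (by rw [abs_neg, abs_unit])
    (.inl hij.ne')
  have h3 := Submodule.smul_mem _ t
    (xPow_mem_lowerSpan (F := F) hij.le (e := σ j) (by rw [abs_unit]) (.inl hij.ne'))
  rw [pairFac_eq]
  rcases Int.units_eq_one_or (σ i) with h | h
  · refine hasLead_of_eq_xPow (g := xPow F i (-1) - xPow F j (-(σ j)) - t • xPow F j (σ j)) ?_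
      (sub_mem (sub_mem h1 h2) h3)
    simp only [h, if_pos, Units.val_one]
    abel
  · refine hasLead_of_eq_xPow (g := t • xPow F i (-1) - xPow F j (-(σ j)) - t • xPow F j (σ j)) ?_
      (sub_mem (sub_mem (Submodule.smul_mem _ t h1) h2) h3)
    rw [h, if_neg (by decide)]
    simp only [Units.val_neg, Units.val_one, neg_neg, one_smul]
    abel

theorem hasLead_weylDen :
    HasLead (smon F n) (slead n) sdom (rho n, 0) (1 : F) (weylDen F n) := by
  have h1 : ∀ i : Fin n, HasLead (smon F n) (slead n) sdom (Pi.single i 1, 0) (1 : F)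
      (xPow F i 1 - xPow F i (-1)) := fun i =>
    hasLead_of_eq_xPow (g := -xPow F i (-1)) (by rw [one_smul, sub_eq_add_neg])
      (neg_mem (xPow_mem_lowerSpan le_rfl (by simp) (.inr (by norm_num))))
  have h2 : ∀ i, ∀ j ∈ Finset.Ioi i, HasLead (smon F n) (slead n) sdom (Pi.single i 1, 0) (1 : F)
      (xPow F i 1 + xPow F i (-1) - (xPow F j 1 + xPow F j (-1))) := fun i j hj => by
    have hij := Finset.mem_Ioi.1 hj
    exact hasLead_of_eq_xPow (g := xPow F i (-1) - (xPow F j 1 + xPow F j (-1)))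
      (by rw [one_smul]; abel)
      (sub_mem (xPow_mem_lowerSpan le_rfl (by simp) (.inr (by norm_num)))
        (add_mem (xPow_mem_lowerSpan hij.le (by simp) (.inl hij.ne'))
          (xPow_mem_lowerSpan hij.le (by simp) (.inl hij.ne'))))
  have := (HasLead.prod isLeading_sdom Finset.univ fun i _ => h1 i).mul isLeading_sdom
    (HasLead.prod isLeading_sdom Finset.univ fun i _ => HasLead.prod isLeading_sdom _ (h2 i))
  rw [sum_single_add] at this
  simpa [weylDen] using this

theorem shiftXS_smon (r : Fˣ) (σ : Fin n → ℤˣ) (x : (Fin n → ℤ) × ℤ) :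
    shiftXS r σ (smon F n (Multiplicative.ofAdd x)) =
      ((r : F) ^ (∑ i, (σ i : ℤ) * x.1 i + x.2)) • smon F n (Multiplicative.ofAdd x) := by
  obtain ⟨a, l⟩ := x
  rw [smon_ofAdd, shiftXS_single, scaleS_T, AddMonoidAlgebra.smul_single,
    LaurentPolynomial.smul_eq_C_mul]
  congr 1
  rw [mul_right_comm, ← map_mul, ← Units.val_mul, ← zpow_add, add_comm]
  simp

theorem shiftXS_fsmul (r : Fˣ) (σ : Fin n → ℤˣ) (c : F) (f : SLaurent F n) :
    shiftXS r σ (c • f) = c • shiftXS r σ f := by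
  rw [← algebraMap_smul F[T;T⁻¹] c f, shiftXS_smul, AlgEquiv.commutes, algebraMap_smul]

theorem shiftXS_mem_monSpan (r : Fˣ) (σ : Fin n → ℤˣ) {S : Set ((Fin n → ℤ) × ℤ)}
    {f : SLaurent F n} (hf : f ∈ monSpan F (smon F n) S) :
    shiftXS r σ f ∈ monSpan F (smon F n) S := by
  induction hf using Submodule.span_induction with
  | mem f h =>
    obtain ⟨x, hx, rfl⟩ := h
    simp only [shiftXS_smon]
    exact Submodule.smul_mem _ _ (mon_mem_monSpan _ hx)
  | zero => simp
  | add f g _ _ hf hg => rw [map_add]; exact add_mem hf hg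
  | smul c f _ hf => rw [shiftXS_fsmul]; exact Submodule.smul_mem _ _ hf

theorem hasLead_shiftXS_sMon (r : Fˣ) (σ : Fin n → ℤˣ) (k : ℤ) (lam : Par n) :
    HasLead (smon F n) (slead n) sdom (lam.1, k) ((r : F) ^ (∑ i, (σ i : ℤ) * lam.1 i + k))
      (shiftXS r σ (sMon F k lam)) := by
  have h := shiftXS_mem_monSpan r σ (hasLead_sMon (F := F) k lam)
  rw [map_sub, one_smul, shiftXS_smon] at h
  exact h

/-- The summand is a product over `i` of terms depending only on `σ i`, so the sum over signs is a
product of two-term sums `r^{-λ_i} - u t^{n-1-i} r^{λ_i}`, with `i` counted from zero. -/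
theorem eigenE_eq_sum (r t : Fˣ) (lam : Par n) (k : ℤ) (u : F) :
    ∑ σ : Fin n → ℤˣ, (∏ i, if σ i = 1 then -u else 1) *
      (∏ i, ∏ _j ∈ Finset.Ioi i, if σ i = 1 then (t : F) else 1) *
        (r : F) ^ (∑ i, (σ i : ℤ) * lam.1 i + k) = (r : F) ^ k * eigenE r t lam u := by
  have hr : (r : F) ≠ 0 := r.ne_zero
  have h : ∀ σ : Fin n → ℤˣ, (∏ i, if σ i = 1 then -u else 1) *
      (∏ i, ∏ _j ∈ Finset.Ioi i, if σ i = 1 then (t : F) else 1) *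
        (r : F) ^ (∑ i, (σ i : ℤ) * lam.1 i + k) = (r : F) ^ k * ∏ i : Fin n,
          if σ i = 1 then -u * (t : F) ^ (n - 1 - (i : ℕ)) * (r : F) ^ (lam.1 i : ℤ)
            else (r : F) ^ (-(lam.1 i : ℤ)) := fun σ => by
    rw [zpow_add₀ hr, unit_zpow_sum_eq_prod, ← Finset.prod_mul_distrib, ← mul_assoc,
      ← Finset.prod_mul_distrib, mul_comm]
    congr 1
    refine Finset.prod_congr rfl fun i _ => ?_
    rw [Finset.prod_const, Fin.card_Ioi]
    rcases Int.units_eq_one_or (σ i) with h | h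
    · simp [h]
    · simp [h, show (-1 : ℤˣ) ≠ 1 by decide]
  simp only [h, ← Finset.mul_sum]
  congr 1
  have := Finset.prod_univ_sum (fun _ : Fin n => (Finset.univ : Finset ℤˣ)) fun i e =>
    if e = 1 then -u * (t : F) ^ (n - 1 - (i : ℕ)) * (r : F) ^ (lam.1 i : ℤ)
            else (r : F) ^ (-(lam.1 i : ℤ))
  rw [Fintype.piFinset_univ] at this
  rw [← this, eigenE, Par.size, ← Finset.sum_neg_distrib, unit_zpow_sum_eq_prod,
    ← Finset.prod_mul_distrib]
  refine Finset.prod_congr rfl fun i _ => ?_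
  rw [show (Finset.univ : Finset ℤˣ) = {1, -1} from rfl, Finset.sum_pair (by decide), if_pos rfl,
    if_neg (by decide)]
  have h2 : ((r : F) ^ 2) ^ lam.1 i = (r : F) ^ (lam.1 i : ℤ) * (r : F) ^ (lam.1 i : ℤ) := by
    rw [zpow_natCast, ← pow_mul, two_mul, pow_add]
  rw [h2, zpow_neg]
  field_simp
  ring

/-- All summands share the leading exponent `(ρ + λ, k)`, so the eigenvalue is the sum of their
leading coefficients. -/
theorem hasLead_opA_sMon (r t : Fˣ) (u : F) (k : ℤ) (lam : Par n) :
    HasLead (smon F n) (slead n) sdom (rho n + lam.1, k) ((r : F) ^ k * eigenE r t lam u)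
      (opA r t u (sMon F k lam)) := by
  rw [← eigenE_eq_sum, opA_apply]
  refine HasLead.sum _ fun σ _ => ?_
  have := ((HasLead.prod isLeading_sdom Finset.univ fun i _ =>
    hasLead_fac u i (σ i)).mul isLeading_sdom (HasLead.prod isLeading_sdom Finset.univ fun i _ =>
      HasLead.prod isLeading_sdom _ fun j hj =>
        hasLead_pairFac (t : F) σ (i := i) (Finset.mem_Ioi.1 hj))).mul isLeading_sdom
          (hasLead_shiftXS_sMon r σ k lam)
  rw [sum_single_add] at this
  simpa using this

/-! ### Antisymmetry and division by the Weyl denominator -/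

/-- The action of a signed permutation on Laurent polynomials. -/
def act (π : Equiv.Perm (Fin n)) (τ : Fin n → ℤˣ) : SLaurent F n ≃ₐ[F[T;T⁻¹]] SLaurent F n :=
  AddMonoidAlgebra.domCongr _ _ (wact π τ)

theorem act_single (π : Equiv.Perm (Fin n)) (τ : Fin n → ℤˣ) (a : Fin n → ℤ) (c : F[T;T⁻¹]) :
    act π τ (AddMonoidAlgebra.single a c) = AddMonoidAlgebra.single (wact π τ a) c :=
  AddMonoidAlgebra.domCongr_single ..

theorem coeff_act (π : Equiv.Perm (Fin n)) (τ : Fin n → ℤˣ) (f : SLaurent F n) (a : Fin n → ℤ) :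
    (act π τ f).coeff (wact π τ a) = f.coeff a := by
  have : (act π τ f).coeff (wact π τ a) = f.coeff ((wact π τ).symm (wact π τ a)) :=
    AddMonoidAlgebra.coeff_domCongr ..
  rw [this, AddEquiv.symm_apply_apply]

theorem IsBCSymm.act_eq {f : SLaurent F n} (hf : IsBCSymm f) (π : Equiv.Perm (Fin n))
    (τ : Fin n → ℤˣ) : act π τ f = f := by
  ext a : 2
  obtain ⟨b, rfl⟩ := (wact π τ).surjective a
  rw [coeff_act, hf.coeff_wact]

theorem act_xPow (π : Equiv.Perm (Fin n)) (τ : Fin n → ℤˣ) (i : Fin n) (e : ℤ) :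
    act π τ (xPow F (π i) e) = xPow F i (τ i * e) := by
  rw [xPow, act_single, xPow]
  congr 1
  ext j
  by_cases h : j = i
  · subst h; simp [wact_apply]
  · simp [wact_apply, h]

theorem act_sConst (π : Equiv.Perm (Fin n)) (τ : Fin n → ℤˣ) (c : F[T;T⁻¹]) :
    act π τ (sConst n c) = sConst n c := AlgEquiv.commutes _ _

theorem act_fsmul (π : Equiv.Perm (Fin n)) (τ : Fin n → ℤˣ) (c : F) (f : SLaurent F n) :
    act π τ (c • f) = c • act π τ f := by
  rw [← algebraMap_smul F[T;T⁻¹] c f, map_smul, algebraMap_smul]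

/-- The sign character of the signed permutation `(π, τ)`. -/
def wsign (π : Equiv.Perm (Fin n)) (τ : Fin n → ℤˣ) : ℤˣ := Equiv.Perm.sign π * ∏ i, τ i

/-- Antisymmetry under signed permutations. -/
def IsAntisymm (H : SLaurent F n) : Prop :=
  ∀ π τ, act π τ H = (wsign π τ : ℤ) • H

theorem act_fac (π : Equiv.Perm (Fin n)) (τ : Fin n → ℤˣ) (u : F) (i : Fin n) (e : ℤˣ) :
    act π τ (fac u (π i) e) = ((τ i : ℤˣ) : ℤ) • fac u i (τ i * e) := by
  simp only [fac, map_zsmul, map_add, map_sub, act_fsmul, act_xPow, act_sConst, smul_smul]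
  rcases Int.units_eq_one_or (τ i) with h | h <;> simp [h]

theorem act_pairFac (π : Equiv.Perm (Fin n)) (τ : Fin n → ℤˣ) (t : F) (σ : Fin n → ℤˣ)
    (i j : Fin n) : act π τ (pairFac t σ (π i) (π j)) =
      pairFac t (fun i => τ i * σ (π i)) i j := by
  simp only [pairFac, map_mul, map_sub, map_one, act_fsmul, act_xPow, Units.val_mul, mul_neg]

theorem act_shiftXS (π : Equiv.Perm (Fin n)) (τ : Fin n → ℤˣ) (r : Fˣ) (σ : Fin n → ℤˣ)
    (f : SLaurent F n) : act π τ (shiftXS r σ f) =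
      shiftXS r (fun i => τ i * σ (π i)) (act π τ f) := by
  induction f using AddMonoidAlgebra.induction_linear with
  | zero => simp
  | add f g hf hg => simp only [map_add, hf, hg]
  | single a c =>
    rw [shiftXS_single, act_single, act_single, shiftXS_single]
    have : ∑ i, ((τ i * σ (π i) : ℤˣ) : ℤ) * wact π τ a i = ∑ i, (σ i : ℤ) * a i := by
      rw [← Equiv.sum_comp π fun i => (σ i : ℤ) * a i]
      refine Finset.sum_congr rfl fun i _ => ?_
      rw [wact_apply, Units.val_mul]
      rcases Int.units_eq_one_or (τ i) with h | h <;> simp [h]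
    rw [this]

theorem prod_act_pair (π : Equiv.Perm (Fin n)) (τ : Fin n → ℤˣ) {f g : Fin n → Fin n → SLaurent F n}
    (hf : ∀ i j, f i j = -f j i) (h : ∀ i j, act π τ (f (π i) (π j)) = g i j) :
    act π τ (∏ i, ∏ j ∈ Finset.Ioi i, f i j) =
      (Equiv.Perm.sign π : ℤ) • ∏ i, ∏ j ∈ Finset.Ioi i, g i j := by
  have h1 := π.prod_Ioi_comp_eq_sign_mul_prod hf
  have h2 := congrArg (act π τ) h1
  simp only [map_prod, map_mul, h, map_intCast] at h2 ⊢
  rw [h2, zsmul_eq_mul, ← mul_assoc, ← Int.cast_mul, ← Units.val_mul]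
  simp

theorem isAntisymm_weylDen : IsAntisymm (weylDen F n) := by
  intro π τ
  rw [weylDen, map_mul, prod_act_pair π τ
    (g := fun i j => xPow F i 1 + xPow F i (-1) - (xPow F j 1 + xPow F j (-1)))
    (fun i j => by ring), map_prod, ← Equiv.prod_comp π]
  · have : ∀ i, act π τ (xPow F (π i) 1 - xPow F (π i) (-1)) =
        ((τ i : ℤˣ) : ℤ) • (xPow F i 1 - xPow F i (-1)) := fun i => by
      rw [map_sub, act_xPow, act_xPow]
      rcases Int.units_eq_one_or (τ i) with h | h <;> simp [h]
    simp only [this, zsmul_eq_mul, Finset.prod_mul_distrib, wsign, Units.val_mul, Int.cast_mul,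
      Units.coe_prod, Int.cast_prod]
    ring
  · intro i j
    simp only [map_add, map_sub, act_xPow]
    rcases Int.units_eq_one_or (τ i) with h | h <;> rcases Int.units_eq_one_or (τ j) with h' | h' <;>
      simp [h, h', add_comm]

/-- The action of a signed permutation on signs. -/
def signEquiv (π : Equiv.Perm (Fin n)) (τ : Fin n → ℤˣ) : (Fin n → ℤˣ) ≃ (Fin n → ℤˣ) where
  toFun σ i := τ i * σ (π i)
  invFun σ i := τ (π.symm i) * σ (π.symm i)
  left_inv σ := by ext i; simp [← mul_assoc]
  right_inv σ := by ext i; simp [← mul_assoc]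

theorem act_prod_fac (π : Equiv.Perm (Fin n)) (τ : Fin n → ℤˣ) (u : F) (σ : Fin n → ℤˣ) :
    act π τ (∏ i, fac u i (σ i)) =
      (∏ i, ((τ i : ℤˣ) : ℤ)) • ∏ i, fac u i (signEquiv π τ σ i) := by
  rw [← Equiv.prod_comp π, map_prod, zsmul_eq_mul, Int.cast_prod, ← Finset.prod_mul_distrib]
  refine Finset.prod_congr rfl fun i _ => ?_
  rw [act_fac, zsmul_eq_mul]
  rfl

theorem act_prod_pairFac (π : Equiv.Perm (Fin n)) (τ : Fin n → ℤˣ) (t : F) (σ : Fin n → ℤˣ) :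
    act π τ (∏ i, ∏ j ∈ Finset.Ioi i, pairFac t σ i j) =
      (Equiv.Perm.sign π : ℤ) • ∏ i, ∏ j ∈ Finset.Ioi i, pairFac t (signEquiv π τ σ) i j := by
  refine prod_act_pair π τ (fun i j => ?_) fun i j => act_pairFac π τ t σ i j
  rw [pairFac, pairFac, mul_comm (xPow F i (σ i : ℤ)), ← mul_neg, neg_sub]

/-- A signed permutation permutes the summands. The one-variable factors contribute the product of
the signs, the pair factors the sign of the permutation. -/
theorem isAntisymm_opA (r t : Fˣ) (u : F) {f : SLaurent F n} (hf : IsBCSymm f) :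
    IsAntisymm (opA r t u f) := by
  intro π τ
  rw [opA_apply, map_sum, Finset.smul_sum]
  refine Fintype.sum_equiv (signEquiv π τ) _ _ fun σ => ?_
  have h3 : act π τ (shiftXS r σ f) = shiftXS r (signEquiv π τ σ) f := by
    rw [act_shiftXS, hf.act_eq]
    rfl
  rw [map_mul, map_mul, act_prod_fac, act_prod_pairFac, h3, wsign, Units.val_mul, Units.coe_prod,
    smul_mul_smul_comm, smul_mul_assoc, mul_comm (∏ i, ((τ i : ℤˣ) : ℤ))]

theorem IsAntisymm.coeff_wact {H : SLaurent F n} (hH : IsAntisymm H) (π : Equiv.Perm (Fin n))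
    (τ : Fin n → ℤˣ) (a : Fin n → ℤ) : H.coeff a = (wsign π τ : ℤ) • H.coeff (wact π τ a) := by
  rw [← coeff_act π τ H a, hH π τ]
  rfl

theorem IsAntisymm.sub {H H' : SLaurent F n} (h : IsAntisymm H) (h' : IsAntisymm H') :
    IsAntisymm (H - H') := fun π τ => by rw [map_sub, h, h', smul_sub]

theorem IsAntisymm.mul_symm {H f : SLaurent F n} (h : IsAntisymm H) (hf : IsBCSymm f) :
    IsAntisymm (H * f) := fun π τ => by rw [map_mul, h, hf.act_eq, smul_mul_assoc]

theorem IsAntisymm.coeff_eq_zero [CharZero F] {H : SLaurent F n} (hH : IsAntisymm H)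
    {π : Equiv.Perm (Fin n)} {τ : Fin n → ℤˣ} {a : Fin n → ℤ} (ha : wact π τ a = a)
    (hs : wsign π τ = -1) : H.coeff a = 0 := by
  have h := hH.coeff_wact π τ a
  rw [ha, hs] at h
  have h2 : (2 : F) • H.coeff a = 0 := by
    rw [two_smul]
    nth_rewrite 1 [h]
    simp
  exact (smul_eq_zero.1 h2).resolve_left two_ne_zero

/-- A zero entry would make the exponent fixed by the reflection `x_i ↦ 1/x_i`, which has sign `-1`.
-/
theorem IsAntisymm.ne_zero_of_coeff [CharZero F] {H : SLaurent F n} (hH : IsAntisymm H)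
    {mu : Par n} (h : H.coeff mu.exp ≠ 0) (i : Fin n) : 0 < mu.1 i := by
  by_contra h0
  refine h (hH.coeff_eq_zero (π := 1) (τ := Function.update 1 i (-1)) ?_ ?_)
  · ext j
    by_cases hj : j = i
    · subst hj
      have : mu.1 j = 0 := by omega
      simp [wact_apply, Par.exp, this]
    · simp [wact_apply, hj]
  · simp [wsign, Finset.prod_update_of_mem]

/-- Two equal entries would make the exponent fixed by an odd transposition. -/
theorem IsAntisymm.strictAnti_of_coeff [CharZero F] {H : SLaurent F n} (hH : IsAntisymm H)
    {mu : Par n} (h : H.coeff mu.exp ≠ 0) : StrictAnti mu.1 := by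
  refine mu.2.strictAnti_of_injective fun i j hij => ?_
  by_contra hne
  refine h (hH.coeff_eq_zero (π := Equiv.swap i j) (τ := 1) ?_ ?_)
  · ext m
    simp only [wact_apply, Par.exp, Pi.one_apply, Units.val_one, one_mul, Equiv.swap_apply_def]
    split_ifs with h1 h2
    · rw [h1, hij]
    · rw [h2, hij]
    · rfl
  · simp [wsign, Equiv.Perm.sign_swap hne]

theorem strictAnti_add_sub_le {f : Fin n → ℕ} (hf : StrictAnti f) :
    ∀ (d : ℕ) (i j : Fin n), (j : ℕ) = i + d → f j + d ≤ f i := by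
  intro d
  induction d with
  | zero => intro i j h; rw [Fin.ext (a := j) (b := i) (by simpa using h), add_zero]
  | succ d ih =>
    intro i j h
    have h1 := ih i ⟨i + d, by have := j.2; omega⟩ rfl
    have h2 := hf (a := ⟨i + d, by have := j.2; omega⟩) (b := j) (Fin.lt_def.2 (by simp only; omega))
    omega

theorem exists_par_add_rho {nu : Par n} (h : StrictAnti nu.1) (h0 : ∀ i, 0 < nu.1 i) :
    ∃ mu : Par n, ∀ i, nu.1 i = rho n i + mu.1 i := by
  have hge : ∀ i, rho n i ≤ nu.1 i := fun i => by
    have h1 := strictAnti_add_sub_le h (n - 1 - i) i ⟨n - 1, by have := i.2; omega⟩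
      (by have := i.2; simp only; omega)
    have h2 := h0 ⟨n - 1, by have := i.2; omega⟩
    have := i.2
    simp only [rho]
    omega
  refine ⟨⟨fun i => nu.1 i - rho n i, fun i j hij => ?_⟩, fun i => ?_⟩
  · have h1 := strictAnti_add_sub_le h (j - i) i j (by have := Fin.le_def.1 hij; omega)
    have := hge i
    have := hge j
    have := i.2
    have := j.2
    have := Fin.le_def.1 hij
    simp only [rho] at *
    omega
  · have := hge i
    simp only
    omega

theorem mem_sdom_rho_add {l k : ℤ} {mu lam : Par n} :
    slead n (rho n + mu.1, l) ∈ sdom (rho n + lam.1, k) ↔ MonLE l mu k lam := by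
  rw [← mem_sdom_par]
  have h : ∀ i, |((rho n i : ℤ) + (mu.1 i : ℤ))| = rho n i + mu.1 i := fun i =>
    abs_of_nonneg (by positivity)
  simp only [sdom, slead, Set.mem_ofPred_eq, Pi.add_apply, Nat.abs_cast, AddMonoidHom.coe_mk,
    ZeroHom.coe_mk, Nat.cast_add, Finset.sum_add_distrib, add_le_add_iff_left,
    add_sub_add_left_eq_sub, h]

/-- Up to sign, each coefficient equals one at a decreasing exponent. If it is nonzero, that
exponent is strictly decreasing and positive, hence `ρ + μ`, and the support bound places `(l, μ)`
below `(k, λ)`. -/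
theorem IsAntisymm.eq_zero [CharZero F] {H : SLaurent F n} (hH : IsAntisymm H) {k : ℤ}
    {lam : Par n} (hm : H ∈ monSpan F (smon F n) (sdom (rho n + lam.1, k)))
    (h : ∀ p ∈ below k lam, cf (slead n (rho n + p.2.1, p.1)) H = 0) : H = 0 := by
  ext a : 2
  obtain ⟨π, τ, nu, hnu⟩ := exists_wact_antitone a
  rw [hH.coeff_wact π τ a, hnu]
  by_contra h0
  have h1 : H.coeff nu.exp ≠ 0 := fun h1 => h0 (by rw [h1]; simp)
  obtain ⟨mu, hmu⟩ := exists_par_add_rho (hH.strictAnti_of_coeff h1) (hH.ne_zero_of_coeff h1)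
  obtain ⟨l, hl⟩ : ∃ l, (H.coeff nu.exp).coeff l ≠ 0 := by
    by_contra! hl
    exact h1 (LaurentPolynomial.ext hl)
  have he : slead n (rho n + mu.1, l) = (nu.exp, l) := by
    ext i
    · simp [slead, Par.exp, hmu]
    · rfl
  have hcf : cf (slead n (rho n + mu.1, l)) H ≠ 0 := by rwa [he]
  refine hcf (h (l, mu) (mem_sdom_rho_add.1 ?_))
  by_contra hn
  exact hcf (cf_eq_zero_of_mem hm hn)

theorem weylDen_ne_zero : weylDen F n ≠ 0 := by
  intro h
  have := (hasLead_weylDen (F := F) (n := n)).cf_eq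
  rw [h, map_zero] at this
  exact zero_ne_one this

theorem sMon_mem_monSpan {l k : ℤ} {mu lam : Par n} (h : MonLE l mu k lam) :
    sMon F l mu ∈ monSpan F (smon F n) (sdom (lam.1, k)) := by
  rw [sMon_eq_sum]
  refine Submodule.sum_mem _ fun a ha => mon_mem_monSpan _ ⟨fun j => ?_, ?_⟩
  · exact (sum_Iic_abs_orbit_le ha j).trans (h.1.sum_le j)
  · rw [sum_abs_orbit ha]
    exact h.2

theorem domSpan_le_monSpan (k : ℤ) (lam : Par n) :
    domSpan F k lam ≤ monSpan F (smon F n) (sdom (lam.1, k)) := by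
  rw [domSpan_eq, sSpan, Submodule.span_le]
  rintro _ ⟨p, hp, rfl⟩
  exact sMon_mem_monSpan hp

theorem weylDen_mul_mem {f : SLaurent F n} {k : ℤ} {lam : Par n} (hf : f ∈ domSpan F k lam) :
    weylDen F n * f ∈ monSpan F (smon F n) (sdom (rho n + lam.1, k)) := by
  refine mul_mem_monSpan _ (hasLead_weylDen.mem isLeading_sdom) (domSpan_le_monSpan k lam hf)
    fun x hx y hy => ?_
  have := isLeading_sdom.add_mem hx hy
  rwa [Prod.mk_add_mk, zero_add] at this

/-- Divisibility by a dimension count instead of division. Take a combination of the finitely many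
dominated monomials, multiply by the Weyl denominator, and read off the coefficients at the `ρ + μ`.
This is a map between spaces of equal dimension, injective by `IsAntisymm.eq_zero`, so some multiple
of the denominator has the same coefficients as `H`; by the same lemma it equals `H`. -/
theorem IsAntisymm.exists_eq_mul [CharZero F] {H : SLaurent F n} (hH : IsAntisymm H) {k : ℤ}
    {lam : Par n} (hm : H ∈ monSpan F (smon F n) (sdom (rho n + lam.1, k))) :
    ∃ g ∈ domSpan F k lam, H = weylDen F n * g := by
  have := (finite_below k lam).fintype
  let comb : (below k lam → F) →ₗ[F] SLaurent F n :=
    Fintype.linearCombination F fun p : below k lam => sMon F p.1.1 p.1.2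
  have hcomb : ∀ c, comb c ∈ domSpan F k lam := fun c => by
    rw [domSpan_eq]
    simp only [comb, Fintype.linearCombination_apply]
    exact Submodule.sum_mem _ fun p _ => Submodule.smul_mem _ _ (sMon_mem_sSpan p.2)
  let Φ : (below k lam → F) →ₗ[F] (below k lam → F) :=
    LinearMap.pi fun p => (cf (slead n (rho n + p.1.2.1, p.1.1))) ∘ₗ
      (LinearMap.mulLeft F (weylDen F n)) ∘ₗ comb
  have hΦ : ∀ c p, Φ c p = cf (slead n (rho n + p.1.2.1, p.1.1)) (weylDen F n * comb c) :=
    fun _ _ => rfl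
  have hanti : ∀ c, IsAntisymm (weylDen F n * comb c) := fun c =>
    isAntisymm_weylDen.mul_symm (by
      have := hcomb c
      rw [domSpan_eq] at this
      exact isBCSymm_of_mem_sSpan this)
  have hinj : Function.Injective Φ := by
    rw [injective_iff_map_eq_zero]
    intro c hc
    have h0 := (hanti c).eq_zero (weylDen_mul_mem (hcomb c)) fun p hp => by
      rw [← hΦ c ⟨p, hp⟩, hc]
      rfl
    have h1 : comb c = 0 := (mul_eq_zero.1 h0).resolve_left weylDen_ne_zero
    ext p
    have h2 := congrArg (cf (p.1.2.exp, p.1.1)) h1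
    simp only [comb, Fintype.linearCombination_apply, map_sum, map_smul, cf_sMon, map_zero] at h2
    rw [Finset.sum_eq_single p] at h2
    · simpa using h2
    · intro q _ hq
      rw [if_neg (fun h => hq (Subtype.ext h.symm)), smul_zero]
    · simp
  obtain ⟨c, hc⟩ := LinearMap.injective_iff_surjective.1 hinj
    fun p => cf (slead n (rho n + p.1.2.1, p.1.1)) H
  refine ⟨comb c, hcomb c, sub_eq_zero.1 ?_⟩
  refine (hH.sub (hanti c)).eq_zero (sub_mem hm (weylDen_mul_mem (hcomb c))) fun p hp => ?_
  rw [map_sub, ← hΦ c ⟨p, hp⟩, hc, sub_self]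

theorem hasLead_cf {S : Set ((Fin n → ℤ) × ℤ)} {f : SLaurent F n}
    (hf : f ∈ monSpan F (smon F n) S) (x : (Fin n → ℤ) × ℤ) :
    f - cf x f • smon F n (Multiplicative.ofAdd x) ∈ monSpan F (smon F n) (S \ {x}) := by
  induction hf using Submodule.span_induction with
  | mem f h =>
    obtain ⟨y, hy, rfl⟩ := h
    simp only [cf_smon]
    by_cases hxy : y = x
    · simp [hxy]
    · rw [if_neg hxy, zero_smul, sub_zero]
      exact mon_mem_monSpan (S := S \ {x}) _ ⟨hy, hxy⟩
  | zero => simp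
  | add f g _ _ hf hg =>
    rw [map_add, add_smul, add_sub_add_comm]
    exact add_mem hf hg
  | smul c f _ hf =>
    rw [map_smul, smul_assoc, ← smul_sub]
    exact Submodule.smul_mem _ _ hf

/-- Leading coefficients multiply, and that of the Weyl denominator is one. This reads the diagonal
entries of `D_s(u)` off `opA`. -/
theorem cf_weylDen_mul {f : SLaurent F n} {k : ℤ} {lam : Par n} (hf : f ∈ domSpan F k lam) :
    cf (slead n (rho n + lam.1, k)) (weylDen F n * f) = cf (lam.exp, k) f := by
  have h : HasLead (smon F n) (slead n) sdom (lam.1, k) (cf (lam.exp, k) f) f :=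
    hasLead_cf (domSpan_le_monSpan k lam hf) (lam.exp, k)
  have := (hasLead_weylDen.mul isLeading_sdom h).cf_eq
  rwa [Prod.mk_add_mk, zero_add, one_mul] at this

/-- `D_s(u)` acts triangularly on the elements `s ^ k * m_lam`. -/
theorem exists_opA_sMon [CharZero F] (r t : Fˣ) (u : F) (k : ℤ) (lam : Par n) :
    ∃ g ∈ domSpan F k lam, opA r t u (sMon F k lam) = weylDen F n * g ∧
      cf (lam.exp, k) g = (r : F) ^ k * eigenE r t lam u := by
  have h := hasLead_opA_sMon r t u k lam
  obtain ⟨g, hg, he⟩ := (isAntisymm_opA r t u (isBCSymm_sMon k lam)).exists_eq_mul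
    (h.mem isLeading_sdom)
  refine ⟨g, hg, he, ?_⟩
  rw [← cf_weylDen_mul hg, ← he, h.cf_eq]

/-! ### Comparison with the operators on rational functions -/

theorem toRat_injective : Function.Injective (toRat : SLaurent F n → RatFn F n) :=
  IsFractionRing.injective _ _

/-- `toRat` as a ring homomorphism. -/
def toRatHom (F : Type*) [Field F] (n : ℕ) : SLaurent F n →+* RatFn F n :=
  algebraMap (SLaurent F n) (RatFn F n)

theorem toRat_eq (f : SLaurent F n) : toRat f = toRatHom F n f := rfl

theorem toRatHom_ne_zero {f : SLaurent F n} (h : f ≠ 0) : toRatHom F n f ≠ 0 :=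
  fun h' => h (toRat_injective (h'.trans (map_zero (toRatHom F n)).symm))

theorem xR_eq (i : Fin n) (e : ℤˣ) : xR F i e = toRatHom F n (xPow F i e) := rfl

theorem sR_eq : sR F n = toRatHom F n (sConst n (LaurentPolynomial.T 1)) := rfl

theorem constR_eq (c : F) : constR n c = toRatHom F n (sConst n (LaurentPolynomial.C c)) := rfl

theorem toRatHom_smul (c : F) (f : SLaurent F n) :
    toRatHom F n (c • f) = constR n c * toRatHom F n f := by
  rw [constR_eq, ← map_mul, sConst_C_mul]

theorem xPow_ne_zero (i : Fin n) (e : ℤ) : xPow F i e ≠ 0 := fun h => by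
  have := xPow_mul (F := F) i e (-e)
  rw [h, zero_mul, add_neg_cancel, xPow_zero] at this
  exact zero_ne_one this

theorem toRatHom_xPow_neg (i : Fin n) (e : ℤ) :
    toRatHom F n (xPow F i (-e)) = (toRatHom F n (xPow F i e))⁻¹ := by
  refine eq_inv_of_mul_eq_one_left ?_
  rw [← map_mul, xPow_mul, neg_add_cancel, xPow_zero, map_one]

theorem single_one_ne_one {a : Fin n → ℤ} (ha : a ≠ 0) :
    (AddMonoidAlgebra.single a 1 : SLaurent F n) ≠ 1 := fun h => by
  have h1 := congrArg (cf (F := F) ((0 : Fin n → ℤ), (0 : ℤ))) h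
  have e1 : (AddMonoidAlgebra.single a 1 : SLaurent F n) =
    smon F n (Multiplicative.ofAdd (a, 0)) := rfl
  have e2 : (1 : SLaurent F n) = smon F n (Multiplicative.ofAdd (0, 0)) := rfl
  rw [e1, e2, cf_smon, cf_smon, if_neg (fun h => ha (congrArg Prod.fst h)), if_pos rfl] at h1
  exact zero_ne_one h1

theorem one_sub_xR_sq_ne_zero (i : Fin n) (e : ℤˣ) : 1 - xR F i e ^ 2 ≠ 0 := by
  rw [xR_eq, ← map_pow, ← map_one (toRatHom F n), ← map_sub]
  refine toRatHom_ne_zero (sub_ne_zero.2 (Ne.symm ?_))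
  rw [pow_two, xPow_mul, xPow]
  refine single_one_ne_one fun h => ?_
  have := congrFun h i
  rcases Int.units_eq_one_or e with rfl | rfl <;> simp at this

theorem one_sub_xR_mul_ne_zero {i j : Fin n} (hij : i ≠ j) (e e' : ℤˣ) :
    1 - xR F i e * xR F j e' ≠ 0 := by
  rw [xR_eq, xR_eq, ← map_mul, ← map_one (toRatHom F n), ← map_sub]
  refine toRatHom_ne_zero (sub_ne_zero.2 (Ne.symm ?_))
  rw [xPow, xPow, AddMonoidAlgebra.single_mul_single, one_mul]
  refine single_one_ne_one fun h => ?_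
  have := congrFun h i
  rcases Int.units_eq_one_or e with rfl | rfl <;> simp [hij] at this

theorem shiftX_shiftS_toRat (r : Fˣ) (σ : Fin n → ℤˣ) (f : SLaurent F n) :
    shiftX r σ (shiftS r (toRat f)) = toRatHom F n (shiftXS r σ f) := by
  have h1 : shiftS r (toRat f) = toRat (scaleSPoly n r f) :=
    IsFractionRing.ringEquivOfRingEquiv_algebraMap _ _
  rw [h1]
  exact IsFractionRing.ringEquivOfRingEquiv_algebraMap _ _

theorem sConst_T_neg_mul :
    sConst n (LaurentPolynomial.T (-1) : F[T;T⁻¹]) * sConst n (LaurentPolynomial.T 1) = 1 := by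
  rw [sConst, sConst, ← map_mul, ← LaurentPolynomial.T_add, neg_add_cancel,
    LaurentPolynomial.T_zero, map_one]

/-- With `X = x_i^e` one has `x_i - 1/x_i = e (X - 1/X)`, and `(X - 1/X)/(1 - X²) = -1/X`. -/
theorem toRat_fac (u : F) (i : Fin n) (e : ℤˣ) :
    toRatHom F n (xPow F i 1 - xPow F i (-1)) * ((1 - sR F n * xR F i e) *
      (1 - constR n u / sR F n * xR F i e) / (1 - xR F i e ^ 2)) = toRatHom F n (fac u i e) := by
  have hs : sR F n ≠ 0 := toRatHom_ne_zero fun h => by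
    have h2 := sConst_T_neg_mul (F := F) (n := n)
    rw [show sConst n (LaurentPolynomial.T 1 : F[T;T⁻¹]) = 0 from h, mul_zero] at h2
    exact zero_ne_one h2
  have hs' : toRatHom F n (sConst n (LaurentPolynomial.T (-1))) = (sR F n)⁻¹ := by
    refine eq_inv_of_mul_eq_one_left ?_
    rw [sR_eq, ← map_mul, sConst_T_neg_mul, map_one]
  have hx : xR F i e ≠ 0 := toRatHom_ne_zero (xPow_ne_zero i e)
  have h1 := one_sub_xR_sq_ne_zero (F := F) i e
  have h2 : toRatHom F n (xPow F i 1 - xPow F i (-1)) = (e : ℤ) • (xR F i e - (xR F i e)⁻¹) := by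
    rw [map_sub, xR_eq, ← toRatHom_xPow_neg]
    rcases Int.units_eq_one_or e with rfl | rfl <;> simp
  have h3 : toRatHom F n (fac u i e) = (-(e : ℤ)) • ((xR F i e)⁻¹ - sR F n -
      constR n u * (sR F n)⁻¹ + constR n u * xR F i e) := by
    rw [fac, map_zsmul, map_add, map_sub, map_sub, toRatHom_smul, toRatHom_smul, hs', xR_eq,
      toRatHom_xPow_neg, sR_eq]
  rw [h2, h3, zsmul_eq_mul, zsmul_eq_mul, Int.cast_neg]
  field_simp
  ring

/-- With `X = x_i^{σ_i}` and `Y = x_j^{σ_j}`, the denominator factor is `X + 1/X - Y - 1/Y = (1 -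
XY)(1/X - 1/Y)` for any signs. -/
theorem toRat_pairFac (t : F) (σ : Fin n → ℤˣ) {i j : Fin n} (hij : i ≠ j) :
    toRatHom F n (xPow F i 1 + xPow F i (-1) - (xPow F j 1 + xPow F j (-1))) *
      ((1 - constR n t * xR F i (σ i) * xR F j (σ j)) / (1 - xR F i (σ i) * xR F j (σ j))) =
      toRatHom F n (pairFac t σ i j) := by
  have hx : ∀ i (e : ℤˣ), xR F i e ≠ 0 := fun i e => toRatHom_ne_zero (xPow_ne_zero (n := n) i e)
  have h1 := one_sub_xR_mul_ne_zero (F := F) hij (σ i) (σ j)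
  have h2 : ∀ i (e : ℤˣ), toRatHom F n (xPow F i 1 + xPow F i (-1)) = xR F i e + (xR F i e)⁻¹ := by
    intro i e
    rw [map_add, xR_eq, ← toRatHom_xPow_neg]
    rcases Int.units_eq_one_or e with rfl | rfl
    · simp
    · simp [add_comm]
  have h3 : toRatHom F n (pairFac t σ i j) = (1 - constR n t * (xR F i (σ i) * xR F j (σ j))) *
      ((xR F i (σ i))⁻¹ - (xR F j (σ j))⁻¹) := by
    rw [pairFac, map_mul, map_sub, map_sub, map_one, toRatHom_smul, map_mul, toRatHom_xPow_neg,
      toRatHom_xPow_neg]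
    rfl
  have := hx i (σ i)
  have := hx j (σ j)
  rw [map_sub, h2 i (σ i), h2 j (σ j), h3]
  field_simp
  ring

theorem weylDen_mul_diffOpS (r t : Fˣ) (u : F) (f : SLaurent F n) :
    toRatHom F n (weylDen F n) * diffOpS r t u (toRat f) = toRatHom F n (opA r t u f) := by
  rw [diffOpS, diffOp, Finset.mul_sum, opA_apply, map_sum]
  refine Finset.sum_congr rfl fun σ _ => ?_
  rw [shiftX_shiftS_toRat, map_mul, map_mul, weylDen, map_mul, ← mul_assoc, mul_mul_mul_comm]
  congr 2
  · rw [map_prod, map_prod, ← Finset.prod_mul_distrib]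
    exact Finset.prod_congr rfl fun i _ => toRat_fac u i (σ i)
  · simp only [map_prod, ← Finset.prod_mul_distrib]
    exact Finset.prod_congr rfl fun i _ => Finset.prod_congr rfl fun j hj =>
      toRat_pairFac (t : F) σ (Finset.mem_Ioi.1 hj).ne

theorem diffOpS_toRat_iff {r t : Fˣ} {u : F} {f g : SLaurent F n} :
    diffOpS r t u (toRat f) = toRat g ↔ opA r t u f = weylDen F n * g := by
  have h0 := toRatHom_ne_zero (weylDen_ne_zero (F := F) (n := n))
  rw [← mul_right_inj' h0, weylDen_mul_diffOpS, toRat_eq, ← map_mul]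
  exact toRat_injective.eq_iff

/-! ### Triangularity and eigenfunctions -/

theorem domSpan_le_strict {k l : ℤ} {mu lam : Par n} (h : MonLE l mu k lam)
    (hne : (l, mu) ≠ (k, lam)) : domSpan F l mu ≤ strictDomSpan F k lam := by
  rw [domSpan_eq, strictDomSpan_eq]
  exact sSpan_mono fun p hp => ⟨MonLE.trans hp h, MonLE.lt_trans hp h hne⟩

theorem strictDomSpan_le (k : ℤ) (lam : Par n) : strictDomSpan F k lam ≤ domSpan F k lam := by
  rw [domSpan_eq, strictDomSpan_eq]
  exact sSpan_mono Set.sdiff_subset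

theorem sub_mem_strictDomSpan {k : ℤ} {lam : Par n} {g : SLaurent F n} (hg : g ∈ domSpan F k lam) :
    g - cf (lam.exp, k) g • sMon F k lam ∈ strictDomSpan F k lam := by
  rw [domSpan_eq] at hg
  rw [strictDomSpan_eq]
  have h0 : sMon F k lam ∈ sSpan F (below k lam) := sMon_mem_sSpan (MonLE.refl k lam)
  obtain ⟨hs, hc⟩ := mem_sSpan_iff.1 (sub_mem hg (Submodule.smul_mem _ (cf (lam.exp, k) g) h0))
  refine mem_sSpan_of_cf hs fun l mu hne => ⟨hc l mu hne, fun he => hne ?_⟩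
  obtain ⟨rfl, rfl⟩ := Prod.mk.inj he
  rw [map_sub, map_smul, cf_sMon, if_pos rfl, smul_eq_mul, mul_one, sub_self]

theorem cf_strictDomSpan {k : ℤ} {lam : Par n} {g : SLaurent F n}
    (hg : g ∈ strictDomSpan F k lam) : cf (lam.exp, k) g = 0 := by
  rw [strictDomSpan_eq] at hg
  exact cf_eq_zero_of_mem_sSpan hg (by simp)

/-- `D_s(u) - c`, multiplied by the Weyl denominator. -/
def opShift (r t : Fˣ) (u c : F) : SLaurent F n →ₗ[F] SLaurent F n :=
  opAF r t u - c • LinearMap.mulLeft F (weylDen F n)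

theorem opShift_apply (r t : Fˣ) (u c : F) (f : SLaurent F n) :
    opShift r t u c f = opA r t u f - c • (weylDen F n * f) := rfl

section Eigenfunctions

variable [CharZero F]

theorem exists_opA_of_mem (r t : Fˣ) (u : F) {Q : Set (ℤ × Par n)}
    (hQ : ∀ p ∈ Q, below p.1 p.2 ⊆ Q) {f : SLaurent F n} (hf : f ∈ sSpan F Q) :
    ∃ g ∈ sSpan F Q, opA r t u f = weylDen F n * g := by
  induction hf using Submodule.span_induction with
  | mem f h =>
    obtain ⟨p, hp, rfl⟩ := h
    obtain ⟨g, hg, he, -⟩ := exists_opA_sMon r t u p.1 p.2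
    rw [domSpan_eq] at hg
    exact ⟨g, sSpan_mono (hQ p hp) hg, he⟩
  | zero => exact ⟨0, zero_mem _, by simp⟩
  | add f g _ _ hf hg =>
    obtain ⟨f', hf', hf⟩ := hf
    obtain ⟨g', hg', hg⟩ := hg
    exact ⟨f' + g', add_mem hf' hg', by rw [map_add, hf, hg, mul_add]⟩
  | smul c f _ hf =>
    obtain ⟨f', hf', hf⟩ := hf
    exact ⟨c • f', Submodule.smul_mem _ _ hf', by rw [opA_fsmul, hf, mul_smul_comm]⟩

theorem exists_opA_domSpan (r t : Fˣ) (u : F) {k : ℤ} {lam : Par n} {f : SLaurent F n}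
    (hf : f ∈ domSpan F k lam) : ∃ g ∈ domSpan F k lam, opA r t u f = weylDen F n * g := by
  rw [domSpan_eq] at hf ⊢
  exact exists_opA_of_mem r t u (fun p hp x hx => MonLE.trans hx hp) hf

theorem exists_opA_strictDomSpan (r t : Fˣ) (u : F) {k : ℤ} {lam : Par n} {f : SLaurent F n}
    (hf : f ∈ strictDomSpan F k lam) :
    ∃ g ∈ strictDomSpan F k lam, opA r t u f = weylDen F n * g := by
  rw [strictDomSpan_eq] at hf ⊢
  exact exists_opA_of_mem r t u
    (fun p hp x hx => (⟨MonLE.trans hx hp.1, MonLE.lt_trans hx hp.1 hp.2⟩ : _ ∧ _)) hf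

theorem exists_opA_domSpan_cf (r t : Fˣ) (u : F) {k : ℤ} {lam : Par n} {f : SLaurent F n}
    (hf : f ∈ domSpan F k lam) : ∃ g ∈ domSpan F k lam, opA r t u f = weylDen F n * g ∧
      cf (lam.exp, k) g = (r : F) ^ k * eigenE r t lam u * cf (lam.exp, k) f := by
  obtain ⟨g₁, hg₁, he₁, hc⟩ := exists_opA_sMon r t u k lam
  obtain ⟨g₂, hg₂, he₂⟩ := exists_opA_strictDomSpan r t u (sub_mem_strictDomSpan hf)
  refine ⟨cf (lam.exp, k) f • g₁ + g₂,
    add_mem (Submodule.smul_mem _ _ hg₁) (strictDomSpan_le _ _ hg₂), ?_, ?_⟩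
  · rw [mul_add, mul_smul_comm, ← he₁, ← he₂, map_sub, opA_fsmul]
    abel
  · rw [map_add, map_smul, hc, cf_strictDomSpan hg₂, add_zero, smul_eq_mul, mul_comm]

/-- `u` separates the eigenvalue of `(0, lam)` from those of all strictly dominated pairs. -/
def Separates (r t : Fˣ) (lam : Par n) (u : F) : Prop :=
  ∀ p ∈ below 0 lam \ {(0, lam)}, (r : F) ^ p.1 * eigenE r t p.2 u ≠ eigenE r t lam u

/-- This says that `D_s(u) - E_λ(u)` maps the strictly dominated span `W` onto `W`, with both sides
multiplied by the Weyl denominator. By triangularity the image of `s^l m_μ` is a nonzero multiple of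
itself plus strictly dominated terms, and induction on the height handles the latter. -/
theorem strictDomSpan_le_comap {r t : Fˣ} {lam : Par n} {u : F} (hu : Separates r t lam u) :
    strictDomSpan F 0 lam ≤ ((strictDomSpan F 0 lam).map
      (opShift r t u (eigenE r t lam u))).comap (LinearMap.mulLeft F (weylDen F n)) := by
  have key : ∀ m : ℕ, ∀ p ∈ below 0 lam \ {(0, lam)}, p.2.height = m →
      sMon F p.1 p.2 ∈ ((strictDomSpan F 0 lam).map
        (opShift r t u (eigenE r t lam u))).comap (LinearMap.mulLeft F (weylDen F n)) := by
    intro m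
    induction m using Nat.strong_induction_on with
    | _ m ih =>
      rintro ⟨l, mu⟩ hp rfl
      obtain ⟨g, hg, he, hc⟩ := exists_opA_sMon r t u l mu
      have hg' := sub_mem_strictDomSpan hg
      have hsub : strictDomSpan F l mu ≤ ((strictDomSpan F 0 lam).map
          (opShift r t u (eigenE r t lam u))).comap (LinearMap.mulLeft F (weylDen F n)) := by
        rw [strictDomSpan_eq l, sSpan, Submodule.span_le]
        rintro _ ⟨p, hp', rfl⟩
        exact ih _ (MonLE.height_lt hp'.1 hp'.2) p
          ⟨MonLE.trans hp'.1 hp.1, MonLE.lt_trans hp'.1 hp.1 hp.2⟩ rfl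
      have h1 := hsub hg'
      have hne := sub_ne_zero.2 (hu _ hp)
      simp only at hne
      rw [Submodule.mem_comap, LinearMap.mulLeft_apply] at h1 ⊢
      have h2 : opShift r t u (eigenE r t lam u) (sMon F l mu) ∈
          (strictDomSpan F 0 lam).map (opShift r t u (eigenE r t lam u)) :=
        Submodule.mem_map_of_mem (domSpan_le_strict hp.1 hp.2 (by
          rw [domSpan_eq]; exact sMon_mem_sSpan (MonLE.refl l mu)))
      rw [opShift_apply, he] at h2
      -- Remove the lower terms from the image of `s^l m_μ` and divide by the difference of
      -- eigenvalues, which is nonzero by separation.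
      have h3 := Submodule.smul_mem _ ((r : F) ^ l * eigenE r t mu u - eigenE r t lam u)⁻¹
        (sub_mem h2 h1)
      rw [hc] at h3
      convert h3 using 1
      rw [eq_inv_smul_iff₀ hne, mul_sub, mul_smul_comm, sub_smul]
      abel
  rw [strictDomSpan_eq, sSpan, Submodule.span_le, ← sSpan, ← strictDomSpan_eq]
  rintro _ ⟨p, hp, rfl⟩
  exact key _ p hp rfl

/-- `D_s(u) - E_λ(u)` sends `m_λ` into the strictly dominated span, where it also equals the image
of some `w`; the eigenfunction is `m_λ - w`. -/
theorem exists_eigenfunction {r t : Fˣ} {lam : Par n} {u : F} (hu : Separates r t lam u) :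
    ∃ P : SLaurent F n, IsMonicTriangular lam P ∧
      opA r t u P = weylDen F n * (eigenE r t lam u • P) := by
  obtain ⟨g, hg, he, hc⟩ := exists_opA_sMon r t u 0 lam
  obtain ⟨w, hw, h⟩ := strictDomSpan_le_comap hu (sub_mem_strictDomSpan hg)
  rw [zpow_zero, one_mul] at hc
  rw [LinearMap.mulLeft_apply, opShift_apply, hc, mul_sub, ← he, mul_smul_comm] at h
  refine ⟨sMon F 0 lam - w, ?_, ?_⟩
  · rw [IsMonicTriangular, sub_sub_cancel_left]
    exact neg_mem hw
  · rw [map_sub, mul_smul_comm, mul_sub, smul_sub]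
    rw [sub_eq_sub_iff_sub_eq_sub]
    exact h.symm

instance (k : ℤ) (lam : Par n) : FiniteDimensional F (strictDomSpan F k lam) := by
  rw [strictDomSpan_eq, sSpan]
  exact FiniteDimensional.span_of_finite F (((finite_below k lam).subset
    Set.sdiff_subset).image _)

/-- Surjectivity onto a space of the same finite dimension gives injectivity. Multiplication by the
Weyl denominator preserves the dimension. -/
theorem opShift_injOn {r t : Fˣ} {lam : Par n} {u : F} (hu : Separates r t lam u)
    {w : SLaurent F n} (hw : w ∈ strictDomSpan F 0 lam)
    (h : opShift r t u (eigenE r t lam u) w = 0) : w = 0 := by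
  set W := strictDomSpan F 0 lam
  set M := opShift (n := n) r t u (eigenE r t lam u)
  have hinj : Function.Injective (LinearMap.mulLeft F (weylDen F n)) := fun a b hab =>
    mul_left_cancel₀ weylDen_ne_zero hab
  have h1 : Module.finrank F W ≤ Module.finrank F (M.domRestrict W).range := by
    rw [(Submodule.equivMapOfInjective _ hinj W).finrank_eq, LinearMap.range_domRestrict]
    exact Submodule.finrank_mono (Submodule.map_le_iff_le_comap.2 (strictDomSpan_le_comap hu))
  have h2 := (M.domRestrict W).finrank_range_add_finrank_ker
  have h3 : (M.domRestrict W).ker = ⊥ := Submodule.finrank_eq_zero.1 (by omega)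
  have h4 : (⟨w, hw⟩ : W) ∈ (M.domRestrict W).ker := h
  rw [h3, Submodule.mem_bot] at h4
  exact congrArg Subtype.val h4

/-- Comparing coefficients at `m_λ` forces the eigenvalue `c` to be `E_λ(u)`; the difference of the
two eigenfunctions is then strictly dominated and killed by `D_s(u) - E_λ(u)`. -/
theorem eigenfunction_unique {r t : Fˣ} {lam : Par n} {u c : F} (hu : Separates r t lam u)
    {f P : SLaurent F n} (hP : IsMonicTriangular lam P)
    (hPe : opA r t u P = weylDen F n * (eigenE r t lam u • P)) (hf : IsMonicTriangular lam f)
    (hfe : opA r t u f = weylDen F n * (c • f)) : f = P := by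
  have hf' := isMonicTriangular_iff.1 hf
  obtain ⟨g, -, he, hc⟩ := exists_opA_domSpan_cf r t u hf'.1
  rw [hfe, mul_right_inj' weylDen_ne_zero] at he
  rw [← he, map_smul, hf'.2, smul_eq_mul, mul_one, mul_one, zpow_zero, one_mul] at hc
  have hsub : f - P ∈ strictDomSpan F 0 lam := by
    have := sub_mem hf hP
    rwa [sub_sub_sub_cancel_right] at this
  refine sub_eq_zero.1 (opShift_injOn hu hsub ?_)
  rw [opShift_apply, map_sub, hfe, hPe, hc, mul_sub, smul_sub, mul_smul_comm, mul_smul_comm,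
    sub_self]

end Eigenfunctions

/-! ### Evaluation at partitions -/

/-- A nonzero constant as a unit of `F[s, 1/s]`. -/
def constU (c : Fˣ) : F[T;T⁻¹]ˣ := Units.map (LaurentPolynomial.C (R := F)).toMonoidHom c

/-- The variable `s` as a unit of `F[s, 1/s]`. -/
def sU (F : Type*) [Field F] : F[T;T⁻¹]ˣ := (LaurentPolynomial.isUnit_T (R := F) 1).unit

theorem val_constU (c : Fˣ) : (constU c : F[T;T⁻¹]) = LaurentPolynomial.C (c : F) := rfl

theorem val_sU : (sU F : F[T;T⁻¹]) = LaurentPolynomial.T 1 := rfl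

theorem constU_mul (c d : Fˣ) : constU (c * d) = constU c * constU d := map_mul _ _ _

theorem val_inv_sU : ((sU F)⁻¹ : F[T;T⁻¹]ˣ) = (LaurentPolynomial.T (-1) : F[T;T⁻¹]) := by
  rw [Units.inv_eq_of_mul_eq_one_right]
  rw [val_sU, ← LaurentPolynomial.T_add, add_neg_cancel, LaurentPolynomial.T_zero]

theorem val_sU_zpow (m : ℤ) : ((sU F ^ m : F[T;T⁻¹]ˣ) : F[T;T⁻¹]) = LaurentPolynomial.T m := by
  induction m using Int.induction_on with
  | zero => simp
  | succ i hi => rw [zpow_add_one, Units.val_mul, hi, val_sU, ← LaurentPolynomial.T_add]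
  | pred i hi => rw [zpow_sub_one, Units.val_mul, hi, val_inv_sU, ← LaurentPolynomial.T_add]; rfl

/-- The point with coordinates `q ^ (nu i) * t ^ (n - i) * s`. -/
def parPt (q t : Fˣ) (nu : Fin n → ℤ) : Fin n → F[T;T⁻¹]ˣ :=
  fun i => constU (q ^ nu i * t ^ (n - 1 - (i : ℕ))) * sU F

/-- Evaluation at `parPt`. -/
def ev (q t : Fˣ) (nu : Fin n → ℤ) : SLaurent F n →ₐ[F[T;T⁻¹]] F[T;T⁻¹] := evalAt (parPt q t nu)

theorem evalAt_single {R : Type*} [CommRing R] (z : Fin n → Rˣ) (a : Fin n → ℤ) (c : R) :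
    evalAt z (AddMonoidAlgebra.single a c) = c * ((∏ i, z i ^ a i : Rˣ) : R) := by
  rw [evalAt, AddMonoidAlgebra.lift_single, smul_eq_mul]
  rfl

theorem ev_single (q t : Fˣ) (nu a : Fin n → ℤ) (c : F[T;T⁻¹]) :
    ev q t nu (AddMonoidAlgebra.single a c) =
      c * ((∏ i, parPt q t nu i ^ a i : F[T;T⁻¹]ˣ) : F[T;T⁻¹]) := evalAt_single _ _ _

theorem ev_xPow (q t : Fˣ) (nu : Fin n → ℤ) (i : Fin n) (e : ℤ) :
    ev q t nu (xPow F i e) = ((parPt q t nu i ^ e : F[T;T⁻¹]ˣ) : F[T;T⁻¹]) := by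
  rw [xPow, ev_single, one_mul, Finset.prod_eq_single i]
  · simp
  · intro j _ hj; simp [hj]
  · simp

theorem ev_sConst (q t : Fˣ) (nu : Fin n → ℤ) (c : F[T;T⁻¹]) : ev q t nu (sConst n c) = c :=
  AlgHom.commutes _ _

theorem ev_fsmul (q t : Fˣ) (nu : Fin n → ℤ) (c : F) (f : SLaurent F n) :
    ev q t nu (c • f) = LaurentPolynomial.C c * ev q t nu f := by
  rw [← algebraMap_smul F[T;T⁻¹] c f, map_smul, smul_eq_mul, LaurentPolynomial.C_eq_algebraMap]

/-- Lower by one the coordinates with sign `-1`. -/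
def lower (σ : Fin n → ℤˣ) (nu : Fin n → ℤ) : Fin n → ℤ :=
  fun i => if σ i = 1 then nu i else nu i - 1

/-- The reason for shifting `s`: the point carries a factor `s`, so `s ↦ r s` contributes `r`. This
agrees with `r^{σ_i}` for sign `+1` and differs from it by `r² = q` for sign `-1`. -/
theorem map_scaleS_parPt {q t r : Fˣ} (hr : r ^ 2 = q) (σ : Fin n → ℤˣ) (nu : Fin n → ℤ)
    (i : Fin n) : Units.map (scaleS r : F[T;T⁻¹] →* F[T;T⁻¹]) (parPt q t (lower σ nu) i) =
      constU (r ^ (σ i : ℤ)) * parPt q t nu i := by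
  have h1 : ∀ c : Fˣ, Units.map (scaleS r : F[T;T⁻¹] →* F[T;T⁻¹]) (constU c) = constU c :=
    fun c => Units.ext (scaleS_C r c)
  have h2 : Units.map (scaleS r : F[T;T⁻¹] →* F[T;T⁻¹]) (sU F) = constU r * sU F :=
    Units.ext ((scaleS_T r 1).trans (by rw [zpow_one]; rfl))
  rw [parPt, parPt, map_mul, h1, h2, ← mul_assoc, ← mul_assoc, ← constU_mul, ← constU_mul]
  congr 2
  rcases Int.units_eq_one_or (σ i) with h | h
  · simp only [lower, h, if_pos, Units.val_one, zpow_one]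
    rw [mul_comm]
  · rw [lower, h, if_neg (by decide), ← hr]
    simp only [Units.val_neg, Units.val_one, ← zpow_natCast r, ← zpow_mul]
    rw [mul_right_comm, ← zpow_add_one, ← mul_assoc, ← zpow_add]
    congr 2
    push_cast
    ring

theorem ev_shiftXS {q t r : Fˣ} (hr : r ^ 2 = q) (σ : Fin n → ℤˣ) (nu : Fin n → ℤ)
    (f : SLaurent F n) :
    ev q t nu (shiftXS r σ f) = scaleS r (ev q t (lower σ nu) f) := by
  induction f using AddMonoidAlgebra.induction_linear with
  | zero => simp
  | add f g hf hg => simp only [map_add, hf, hg]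
  | single a c =>
    rw [shiftXS_single, ev_single, ev_single, map_mul, mul_assoc]
    congr 1
    have h : scaleS r ((∏ i, parPt q t (lower σ nu) i ^ a i : F[T;T⁻¹]ˣ) : F[T;T⁻¹]) =
        ((∏ i, (constU (r ^ (σ i : ℤ)) * parPt q t nu i) ^ a i : F[T;T⁻¹]ˣ) : F[T;T⁻¹]) := by
      simp only [← map_scaleS_parPt hr, ← map_zpow, ← map_prod]
      rfl
    rw [h, ← val_constU, ← Units.val_mul]
    congr 1
    simp only [mul_zpow, Finset.prod_mul_distrib]
    congr 1
    rw [zpow_sum_eq_prod]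
    simp only [zpow_mul, constU, map_prod, map_zpow]

theorem ev_fac (q t : Fˣ) (nu : Fin n → ℤ) (u : F) (i : Fin n) (e : ℤˣ) :
    ev q t nu (fac u i e) = (-(e : ℤ)) • (((parPt q t nu i ^ (-(e : ℤ)) : F[T;T⁻¹]ˣ) : F[T;T⁻¹]) *
      (1 - LaurentPolynomial.T 1 * ((parPt q t nu i ^ (e : ℤ) : F[T;T⁻¹]ˣ) : F[T;T⁻¹])) *
      (1 - LaurentPolynomial.C u * LaurentPolynomial.T (-1) *
        ((parPt q t nu i ^ (e : ℤ) : F[T;T⁻¹]ˣ) : F[T;T⁻¹]))) := by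
  have h1 : ((parPt q t nu i ^ (-(e : ℤ)) : F[T;T⁻¹]ˣ) : F[T;T⁻¹]) *
      ((parPt q t nu i ^ (e : ℤ) : F[T;T⁻¹]ˣ) : F[T;T⁻¹]) = 1 := by
    rw [← Units.val_mul, ← zpow_add]
    simp
  have h2 : (LaurentPolynomial.T 1 : F[T;T⁻¹]) * LaurentPolynomial.T (-1) = 1 := by
    rw [← LaurentPolynomial.T_add, add_neg_cancel, LaurentPolynomial.T_zero]
  simp only [fac, map_zsmul, map_add, map_sub, ev_fsmul, ev_xPow, ev_sConst]
  congr 1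
  linear_combination (LaurentPolynomial.T 1 + LaurentPolynomial.C u * LaurentPolynomial.T (-1)
    - LaurentPolynomial.C u * LaurentPolynomial.T 1 * LaurentPolynomial.T (-1) *
      ((parPt q t nu i ^ (e : ℤ) : F[T;T⁻¹]ˣ) : F[T;T⁻¹])) * h1 -
    LaurentPolynomial.C u * ((parPt q t nu i ^ (e : ℤ) : F[T;T⁻¹]ˣ) : F[T;T⁻¹]) * h2

theorem ev_pairFac (q t : Fˣ) (nu : Fin n → ℤ) (c : F) (σ : Fin n → ℤˣ) (i j : Fin n) :
    ev q t nu (pairFac c σ i j) = (1 - LaurentPolynomial.C c *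
      (((parPt q t nu i ^ (σ i : ℤ) : F[T;T⁻¹]ˣ) : F[T;T⁻¹]) *
        ((parPt q t nu j ^ (σ j : ℤ) : F[T;T⁻¹]ˣ) : F[T;T⁻¹]))) *
      (((parPt q t nu i ^ (-(σ i : ℤ)) : F[T;T⁻¹]ˣ) : F[T;T⁻¹]) -
        ((parPt q t nu j ^ (-(σ j : ℤ)) : F[T;T⁻¹]ˣ) : F[T;T⁻¹])) := by
  simp only [pairFac, map_mul, map_sub, map_one, ev_fsmul, ev_xPow]

/-- The last coordinate is `s`, so the factor `1 - s/x_i` is zero. This blocks lowering a last part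
equal to `0`. -/
theorem ev_fac_eq_zero (q t : Fˣ) {nu : Fin n → ℤ} (u : F) {i : Fin n} {e : ℤˣ} (he : e ≠ 1)
    (hi : (i : ℕ) = n - 1) (h0 : nu i = 0) : ev q t nu (fac u i e) = 0 := by
  have he' : e = -1 := (Int.units_eq_one_or e).resolve_left he
  have h : parPt q t nu i = sU F := by
    rw [parPt, h0, hi]
    simp [constU]
  rw [ev_fac, h, he']
  have : (1 - LaurentPolynomial.T 1 * ((sU F ^ ((-1 : ℤˣ) : ℤ) : F[T;T⁻¹]ˣ) : F[T;T⁻¹])) = 0 := by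
    rw [val_sU_zpow, ← LaurentPolynomial.T_add]
    simp
  rw [this]
  simp

/-- Here `x_i = t x_j`, so `1 - t x_j/x_i` is zero. This blocks lowering the first of two equal
consecutive parts without the second. -/
theorem ev_pairFac_eq_zero (q t : Fˣ) {nu : Fin n → ℤ} {σ : Fin n → ℤˣ} {i j : Fin n}
    (hij : (j : ℕ) = i + 1) (hi : σ i ≠ 1) (hj : σ j = 1) (hnu : nu i = nu j) :
    ev q t nu (pairFac (t : F) σ i j) = 0 := by
  have hi' : σ i = -1 := (Int.units_eq_one_or _).resolve_left hi
  have h : constU t * (parPt q t nu i ^ (σ i : ℤ) * parPt q t nu j ^ (σ j : ℤ)) = 1 := by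
    have h3 : n - 1 - (i : ℕ) = (n - 1 - (j : ℕ)) + 1 := by have := j.2; omega
    have h4 : parPt q t nu i = constU t * parPt q t nu j := by
      rw [parPt, parPt, hnu, h3, pow_succ, ← mul_assoc, constU_mul, mul_comm (constU _) (constU t),
        mul_assoc]
    rw [hi', hj, Units.val_neg, Units.val_one, zpow_neg, zpow_one, zpow_one, mul_left_comm, h4,
      inv_mul_cancel]
  rw [ev_pairFac, ← val_constU, ← Units.val_mul, ← Units.val_mul, h]
  simp

theorem antitone_of_succ {f : Fin n → ℤ}
    (h : ∀ i j : Fin n, (j : ℕ) = i + 1 → f j ≤ f i) : Antitone f := by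
  cases n with
  | zero => exact fun i => i.elim0
  | succ m => exact Fin.antitone_iff_succ_le.2 fun i => h _ _ (by simp)

theorem exists_par_lower {mu : Par n} {σ : Fin n → ℤˣ}
    (h1 : ∀ i : Fin n, (i : ℕ) = n - 1 → σ i ≠ 1 → mu.1 i ≠ 0)
    (h2 : ∀ i j : Fin n, (j : ℕ) = i + 1 → σ i ≠ 1 → σ j = 1 → mu.1 i ≠ mu.1 j) :
    ∃ nu : Par n, nu.exp = lower σ mu.exp := by
  have hmu : ∀ i j : Fin n, (j : ℕ) = i + 1 → mu.1 j ≤ mu.1 i := fun i j h =>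
    mu.2 (Fin.le_def.2 (by omega))
  have hanti : Antitone (lower σ mu.exp) := antitone_of_succ fun i j hij => by
    have := hmu i j hij
    have := h2 i j hij
    simp only [lower, Par.exp]
    split_ifs with ha hb hb
    · omega
    · have := this hb ha
      omega
    · omega
    · omega
  have hpos : ∀ i, 0 ≤ lower σ mu.exp i := fun i => by
    have hn : 0 < n := i.pos
    refine le_trans ?_ (hanti (a := i) (b := ⟨n - 1, by omega⟩) (Fin.le_def.2 (by
      have := i.2; simp only; omega)))
    have := h1 ⟨n - 1, by omega⟩ rfl
    simp only [lower, Par.exp]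
    split_ifs with hs
    · omega
    · have := this hs
      omega
  refine ⟨⟨fun i => (lower σ mu.exp i).toNat, fun i j hij => Int.toNat_le_toNat (hanti hij)⟩, ?_⟩
  ext i
  simp [Par.exp, Int.toNat_of_nonneg (hpos i)]

/-- For signs not all `+1`, either the coefficient is zero at `μ` or the shifted point belongs to a
partition strictly inside `μ`, where `f` vanishes. -/
theorem ev_opA {q t r : Fˣ} (hr : r ^ 2 = q) (u : F) {f : SLaurent F n} {mu : Par n}
    (h : ∀ nu : Par n, nu.Contained mu → nu ≠ mu → ev q t nu.exp f = 0) :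
    ev q t mu.exp (opA r t u f) = (∏ i, ev q t mu.exp (fac u i 1)) *
      (∏ i, ∏ j ∈ Finset.Ioi i, ev q t mu.exp (pairFac (t : F) 1 i j)) *
        scaleS r (ev q t mu.exp f) := by
  have hone : lower 1 mu.exp = mu.exp := by ext i; simp [lower]
  rw [opA_apply, map_sum, Finset.sum_eq_single 1]
  · rw [map_mul, map_mul, ev_shiftXS hr, hone]
    simp only [map_prod, Pi.one_apply]
  · intro σ _ hσ
    rw [map_mul, map_mul, ev_shiftXS hr]
    by_cases h1 : ∃ i : Fin n, (i : ℕ) = n - 1 ∧ σ i ≠ 1 ∧ mu.1 i = 0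
    · obtain ⟨i, hi, hs, h0⟩ := h1
      rw [map_prod, Finset.prod_eq_zero (Finset.mem_univ i)
        (ev_fac_eq_zero q t u hs hi (by simp [Par.exp, h0])), zero_mul, zero_mul]
    by_cases h2 : ∃ i j : Fin n, (j : ℕ) = i + 1 ∧ σ i ≠ 1 ∧ σ j = 1 ∧ mu.1 i = mu.1 j
    · obtain ⟨i, j, hij, hs, hs', h0⟩ := h2
      have hlt : j ∈ Finset.Ioi i := Finset.mem_Ioi.2 (Fin.lt_def.2 (by omega))
      rw [map_prod _ _ Finset.univ, map_prod _ _ Finset.univ,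
        Finset.prod_eq_zero (i := i) (f := fun i => ev q t mu.exp
          (∏ j ∈ Finset.Ioi i, pairFac (t : F) σ i j)) (Finset.mem_univ i), mul_zero, zero_mul]
      rw [map_prod]
      exact Finset.prod_eq_zero hlt (ev_pairFac_eq_zero q t hij hs hs' (by simp [Par.exp, h0]))
    push Not at h1 h2
    obtain ⟨nu, hnu⟩ := exists_par_lower h1 h2
    rw [← hnu, h nu, map_zero, mul_zero]
    · intro i
      have := congrFun hnu i
      simp only [Par.exp, lower] at this
      split_ifs at this <;> omega
    · rintro rfl
      refine hσ (funext fun i => ?_)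
      by_contra (hs : ¬ σ i = 1)
      have := congrFun hnu i
      rw [lower, if_neg hs] at this
      omega
  · simp

/-! ### Lowest terms in `s` -/

/-- The powers of `s`. -/
def sPow (F : Type*) [Field F] : Multiplicative ℤ →* F[T;T⁻¹] where
  toFun m := LaurentPolynomial.T m.toAdd
  map_one' := rfl
  map_mul' _ _ := LaurentPolynomial.T_add _ _

/-- `h = a * s ^ k + (higher powers of s)`. -/
abbrev HasLow (k : ℤ) (a : F) (h : F[T;T⁻¹]) : Prop :=
  HasLead (sPow F) (AddMonoidHom.id ℤ) Set.Ici k a h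

theorem isLeading_Ici : IsLeading (AddMonoidHom.id ℤ) (Set.Ici : ℤ → Set ℤ) where
  lead_mem b := le_refl b
  add_mem h h' := Set.mem_Ici.2 (add_le_add (Set.mem_Ici.1 h) (Set.mem_Ici.1 h'))
  unique {b b' x y} h h' he := by
    simp only [Set.mem_Ici, AddMonoidHom.id_apply] at *
    constructor <;> omega

theorem C_mul_T_mem {S : Set ℤ} {m : ℤ} (hm : m ∈ S) (c : F) :
    LaurentPolynomial.C c * LaurentPolynomial.T m ∈ monSpan F (sPow F) S := by
  rw [← LaurentPolynomial.smul_eq_C_mul]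
  exact Submodule.smul_mem _ _ (mon_mem_monSpan (sPow F) hm)

theorem HasLow.coeff_eq {k : ℤ} {a : F} {h : F[T;T⁻¹]} (hh : HasLow k a h) : h.coeff k = a := by
  have key : ∀ f ∈ monSpan F (sPow F) (Set.Ici k \ {k}), f.coeff k = 0 := by
    intro f hf
    induction hf using Submodule.span_induction with
    | mem f h =>
      obtain ⟨m, hm, rfl⟩ := h
      exact (LaurentPolynomial.T_apply _ _).trans (if_neg hm.2)
    | zero => rfl
    | add f g _ _ hf hg => simp [hf, hg]
    | smul c f _ hf => simp [hf]
  have h1 := key _ hh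
  have h2 : (sPow F (Multiplicative.ofAdd k)).coeff k = 1 :=
    (LaurentPolynomial.T_apply _ _).trans (if_pos rfl)
  rw [AddMonoidAlgebra.coeff_sub, Finsupp.sub_apply, AddMonoidAlgebra.coeff_smul,
    Finsupp.smul_apply, AddMonoidHom.id_apply, h2, smul_eq_mul, mul_one, sub_eq_zero] at h1
  exact h1

theorem hasLow_of_coeff {k : ℤ} {h : F[T;T⁻¹]} (hk : ∀ l, h.coeff l ≠ 0 → k ≤ l) :
    HasLow k (h.coeff k) h := by
  have e := laurent_eq_sum h
  by_cases h0 : h.coeff k = 0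
  · rw [HasLow, HasLead, h0, zero_smul, sub_zero, e]
    refine Submodule.sum_mem _ fun l hl => Submodule.smul_mem _ _
      (mon_mem_monSpan (S := _ \ _) (sPow F) ⟨hk l (by simpa using hl), ?_⟩)
    rintro rfl
    exact (by simpa using hl : h.coeff _ ≠ 0) h0
  · rw [← Finset.add_sum_erase _ _ (a := k) (by simpa using h0)] at e
    refine hasLead_of_eq e (Submodule.sum_mem _ fun l hl => Submodule.smul_mem _ _
      (mon_mem_monSpan (S := _ \ _) (sPow F)
        ⟨hk l (by simpa using (Finset.mem_erase.1 hl).2), (Finset.mem_erase.1 hl).1⟩))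

theorem exists_hasLow {h : F[T;T⁻¹]} (h0 : h ≠ 0) : ∃ k a, a ≠ 0 ∧ HasLow k a h := by
  have hne : h.coeff.support.Nonempty := by
    rw [Finsupp.support_nonempty_iff]
    exact fun h' => h0 (AddMonoidAlgebra.coeff_eq_zero.1 h')
  refine ⟨h.coeff.support.min' hne, _, ?_, hasLow_of_coeff fun l hl =>
    Finset.min'_le _ _ (by simpa using hl)⟩
  simpa using h.coeff.support.min'_mem hne

theorem hasLow_scaleS {k : ℤ} {h : F[T;T⁻¹]} (r : Fˣ) (hk : ∀ l, h.coeff l ≠ 0 → k ≤ l) :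
    HasLow k ((r : F) ^ k * h.coeff k) (scaleS r h) := by
  rw [← coeff_scaleS]
  exact hasLow_of_coeff fun l hl => hk l fun h0 => hl (by rw [coeff_scaleS, h0, mul_zero])

theorem hasLow_one_sub {c : F} {m : ℤ} (hm : 0 < m) :
    HasLow 0 (1 : F) (1 - LaurentPolynomial.C c * LaurentPolynomial.T m) := by
  have h0 : m ∈ Set.Ici (0 : ℤ) \ {AddMonoidHom.id ℤ 0} := ⟨hm.le, hm.ne'⟩
  refine hasLead_of_eq (g := -(LaurentPolynomial.C c * LaurentPolynomial.T m)) ?_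
    (neg_mem (C_mul_T_mem h0 c))
  have h1 : sPow F (Multiplicative.ofAdd (AddMonoidHom.id ℤ 0)) = 1 := map_one (sPow F)
  rw [one_smul, sub_eq_add_neg, h1]

theorem hasLow_const (c : F) : HasLow 0 c (LaurentPolynomial.C c) := by
  refine hasLead_of_eq (g := 0) ?_ (zero_mem _)
  have h1 : sPow F (Multiplicative.ofAdd (AddMonoidHom.id ℤ 0)) = 1 := map_one (sPow F)
  rw [LaurentPolynomial.smul_eq_C_mul, add_zero, h1, mul_one]

/-! ### Vanishing of eigenfunctions -/

/-- Multiplicative independence of two units. -/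
def MulIndep (q t : Fˣ) : Prop := ∀ a b : ℤ, q ^ a * t ^ b = 1 → a = 0 ∧ b = 0

theorem val_parPt (q t : Fˣ) (nu : Fin n → ℤ) (i : Fin n) :
    (parPt q t nu i : F[T;T⁻¹]) = LaurentPolynomial.C
      ((q ^ nu i * t ^ (n - 1 - (i : ℕ)) : Fˣ) : F) * LaurentPolynomial.T 1 := rfl

theorem parPt_mul (q t : Fˣ) (nu : Fin n → ℤ) (i j : Fin n) :
    (parPt q t nu i * parPt q t nu j : F[T;T⁻¹]) = LaurentPolynomial.C
      (((q ^ nu i * t ^ (n - 1 - (i : ℕ)) : Fˣ) : F) * ((q ^ nu j * t ^ (n - 1 - (j : ℕ)) : Fˣ) : F))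
        * LaurentPolynomial.T 2 := by
  rw [val_parPt, val_parPt, mul_mul_mul_comm, ← map_mul, ← LaurentPolynomial.T_add]
  norm_num

theorem constU_injective : Function.Injective (constU : Fˣ → F[T;T⁻¹]ˣ) := fun a b h => by
  have := congrArg (fun c : F[T;T⁻¹]ˣ => (c : F[T;T⁻¹]).coeff 0) h
  simp only [val_constU, LaurentPolynomial.C_apply, if_true] at this
  exact Units.ext this

theorem parPt_ne {q t : Fˣ} (hz : MulIndep q t) (nu : Fin n → ℤ) {i j : Fin n} (hij : i ≠ j) :
    parPt q t nu i ≠ parPt q t nu j := fun h => by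
  have h1 := constU_injective (mul_right_cancel h)
  have h2 : q ^ (nu i - nu j) * t ^ (((n - 1 - (i : ℕ) : ℕ) : ℤ) - ((n - 1 - (j : ℕ) : ℕ) : ℤ)) =
      1 := by
    rw [zpow_sub, zpow_sub, zpow_natCast, zpow_natCast, mul_mul_mul_comm, h1, ← mul_inv,
      mul_inv_cancel]
  have := (hz _ _ h2).2
  have := i.2
  have := j.2
  exact hij (Fin.ext (by omega))

/-- At `x = c s` the factor `1 - u x/s` is the constant `1 - c u`, while `1 - s x = 1 - c s²` is
invisible in lowest order. The product of these constants is the eigenvalue without its power of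
`r`. -/
theorem ev_prod_fac (q t : Fˣ) (nu : Fin n → ℤ) (u : F) :
    ∏ i, ev q t nu (fac u i 1) = (∏ i, -(((parPt q t nu i)⁻¹ : F[T;T⁻¹]ˣ) : F[T;T⁻¹])) *
      ∏ i : Fin n, ((1 - LaurentPolynomial.C ((q ^ nu i * t ^ (n - 1 - (i : ℕ)) : Fˣ) : F) *
        LaurentPolynomial.T 2) *
        LaurentPolynomial.C (1 - ((q ^ nu i * t ^ (n - 1 - (i : ℕ)) : Fˣ) : F) * u)) := by
  rw [← Finset.prod_mul_distrib]
  refine Finset.prod_congr rfl fun i _ => ?_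
  have h1 : (LaurentPolynomial.T 1 : F[T;T⁻¹]) * LaurentPolynomial.T 1 = LaurentPolynomial.T 2 := by
    rw [← LaurentPolynomial.T_add]; norm_num
  have h2 : (LaurentPolynomial.T (-1) : F[T;T⁻¹]) * LaurentPolynomial.T 1 = 1 := by
    rw [← LaurentPolynomial.T_add, neg_add_cancel, LaurentPolynomial.T_zero]
  rw [ev_fac, Units.val_one, zpow_neg, zpow_one, map_sub, map_one, map_mul, neg_smul, one_smul,
    val_parPt, ← h1]
  linear_combination (((parPt q t nu i)⁻¹ : F[T;T⁻¹]ˣ) : F[T;T⁻¹]) *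
    (1 - LaurentPolynomial.C ((q ^ nu i * t ^ (n - 1 - (i : ℕ)) : Fˣ) : F) *
        (LaurentPolynomial.T 1 * LaurentPolynomial.T 1)) * LaurentPolynomial.C u *
    LaurentPolynomial.C ((q ^ nu i * t ^ (n - 1 - (i : ℕ)) : Fˣ) : F) * h2

theorem ev_weylDen (q t : Fˣ) (nu : Fin n → ℤ) :
    ev q t nu (weylDen F n) = (∏ i, -(((parPt q t nu i)⁻¹ : F[T;T⁻¹]ˣ) : F[T;T⁻¹])) *
      (∏ i, ∏ j ∈ Finset.Ioi i, ((((parPt q t nu i)⁻¹ : F[T;T⁻¹]ˣ) : F[T;T⁻¹]) -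
        (((parPt q t nu j)⁻¹ : F[T;T⁻¹]ˣ) : F[T;T⁻¹]))) *
      ((∏ i, (1 - (parPt q t nu i * parPt q t nu i : F[T;T⁻¹]))) *
        ∏ i, ∏ j ∈ Finset.Ioi i, (1 - (parPt q t nu i * parPt q t nu j : F[T;T⁻¹]))) := by
  have h0 : ∀ i, (parPt q t nu i : F[T;T⁻¹]) * (((parPt q t nu i)⁻¹ : F[T;T⁻¹]ˣ) : F[T;T⁻¹]) = 1 :=
    fun i => Units.mul_inv _
  have h1 : ev q t nu (∏ i, (xPow F i 1 - xPow F i (-1))) =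
      ∏ i, (-(((parPt q t nu i)⁻¹ : F[T;T⁻¹]ˣ) : F[T;T⁻¹]) *
        (1 - (parPt q t nu i * parPt q t nu i : F[T;T⁻¹]))) := by
    rw [map_prod]
    refine Finset.prod_congr rfl fun i _ => ?_
    simp only [map_sub, ev_xPow, zpow_neg, zpow_one]
    linear_combination -(parPt q t nu i : F[T;T⁻¹]) * h0 i
  have h2 : ev q t nu (∏ i, ∏ j ∈ Finset.Ioi i,
      (xPow F i 1 + xPow F i (-1) - (xPow F j 1 + xPow F j (-1)))) =
      ∏ i, ∏ j ∈ Finset.Ioi i, (((((parPt q t nu i)⁻¹ : F[T;T⁻¹]ˣ) : F[T;T⁻¹]) -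
        (((parPt q t nu j)⁻¹ : F[T;T⁻¹]ˣ) : F[T;T⁻¹])) *
        (1 - (parPt q t nu i * parPt q t nu j : F[T;T⁻¹]))) := by
    simp only [map_prod]
    refine Finset.prod_congr rfl fun i _ => Finset.prod_congr rfl fun j _ => ?_
    simp only [map_sub, map_add, ev_xPow, zpow_neg, zpow_one]
    linear_combination (parPt q t nu j : F[T;T⁻¹]) * h0 i - (parPt q t nu i : F[T;T⁻¹]) * h0 j
  rw [weylDen, map_mul, h1, h2]
  simp only [Finset.prod_mul_distrib]
  exact mul_mul_mul_comm _ _ _ _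

theorem ev_prod_pairFac (q t : Fˣ) (nu : Fin n → ℤ) (c : F) :
    ∏ i, ∏ j ∈ Finset.Ioi i, ev q t nu (pairFac c 1 i j) =
      (∏ i, ∏ j ∈ Finset.Ioi i, ((((parPt q t nu i)⁻¹ : F[T;T⁻¹]ˣ) : F[T;T⁻¹]) -
        (((parPt q t nu j)⁻¹ : F[T;T⁻¹]ˣ) : F[T;T⁻¹]))) *
      ∏ i, ∏ j ∈ Finset.Ioi i, (1 - LaurentPolynomial.C c *
        (parPt q t nu i * parPt q t nu j : F[T;T⁻¹])) := by
  simp only [← Finset.prod_mul_distrib]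
  refine Finset.prod_congr rfl fun i _ => Finset.prod_congr rfl fun j _ => ?_
  rw [ev_pairFac]
  simp only [Pi.one_apply, Units.val_one, zpow_neg, zpow_one]
  ring

theorem cancel_common_factor {R : Type*} [CommRing R] [IsDomain R] {y₁ y₂ a e b₁ b₂ c : R}
    (hy : y₁ * y₂ ≠ 0) (h : y₁ * y₂ * a * e = y₁ * b₁ * (y₂ * b₂) * c) : a * e = b₁ * b₂ * c :=
  mul_left_cancel₀ hy (by linear_combination h)

/-- The surviving term of `ev_opA` shares with the Weyl denominator the factors `-1/x_i` and `1/x_i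
- 1/x_j`. They are nonzero because the coordinates involve different powers of `t`; what remains
after cancelling has constant terms that can be read off. -/
theorem ev_eigenfunction {q t r : Fˣ} (hr : r ^ 2 = q) (hz : MulIndep q t) {u E : F}
    {f : SLaurent F n} (hf : opA r t u f = weylDen F n * (E • f)) {mu : Par n}
    (h : ∀ nu : Par n, nu.Contained mu → nu ≠ mu → ev q t nu.exp f = 0) :
    ((∏ i, (1 - (parPt q t mu.exp i * parPt q t mu.exp i : F[T;T⁻¹]))) *
        ∏ i, ∏ j ∈ Finset.Ioi i, (1 - (parPt q t mu.exp i * parPt q t mu.exp j : F[T;T⁻¹]))) *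
      (LaurentPolynomial.C E * ev q t mu.exp f) =
    (∏ i : Fin n, ((1 - LaurentPolynomial.C ((q ^ mu.exp i * t ^ (n - 1 - (i : ℕ)) : Fˣ) : F) *
        LaurentPolynomial.T 2) *
        LaurentPolynomial.C (1 - ((q ^ mu.exp i * t ^ (n - 1 - (i : ℕ)) : Fˣ) : F) * u))) *
      (∏ i, ∏ j ∈ Finset.Ioi i, (1 - LaurentPolynomial.C (t : F) *
        (parPt q t mu.exp i * parPt q t mu.exp j : F[T;T⁻¹]))) * scaleS r (ev q t mu.exp f) := by
  have key := ev_opA hr u h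
  rw [hf, map_mul, ev_fsmul, ev_weylDen, ev_prod_fac, ev_prod_pairFac] at key
  refine cancel_common_factor (mul_ne_zero (Finset.prod_ne_zero_iff.2 fun i _ =>
    neg_ne_zero.2 (Units.ne_zero _)) (Finset.prod_ne_zero_iff.2 fun i _ =>
      Finset.prod_ne_zero_iff.2 fun j hj => ?_)) key
  refine sub_ne_zero.2 fun he => parPt_ne hz mu.exp (Finset.mem_Ioi.1 hj).ne ?_
  exact inv_injective (Units.ext he)

theorem HasLow.le_of_coeff_ne_zero {k : ℤ} {a : F} {h : F[T;T⁻¹]} (hk : HasLow k a h) {l : ℤ}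
    (hl : h.coeff l ≠ 0) : k ≤ l := by
  by_contra hlt
  refine hl ?_
  have key : ∀ g ∈ monSpan F (sPow F) (Set.Ici k), g.coeff l = 0 := by
    intro g hg
    induction hg using Submodule.span_induction with
    | mem f h =>
      obtain ⟨m, hm, rfl⟩ := h
      exact (LaurentPolynomial.T_apply _ _).trans
        (if_neg fun h : m = l => hlt (h ▸ Set.mem_Ici.1 hm))
    | zero => rfl
    | add f g _ _ hf hg => simp [hf, hg]
    | smul c f _ hf => simp [hf]
  exact key _ (HasLead.mem isLeading_Ici hk)

/-- If an eigenfunction vanishes at all partitions strictly contained in `mu`, it also vanishes at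
`mu`, unless the eigenvalue is that of `mu` up to a power of `r`. -/
theorem ev_eq_zero_or {q t r : Fˣ} (hr : r ^ 2 = q) (hz : MulIndep q t) {u E : F}
    {f : SLaurent F n} (hf : opA r t u f = weylDen F n * (E • f)) {mu : Par n}
    (h : ∀ nu : Par n, nu.Contained mu → nu ≠ mu → ev q t nu.exp f = 0) :
    ev q t mu.exp f = 0 ∨ ∃ k : ℤ, E = (r : F) ^ k * ∏ i : Fin n,
      (1 - ((q ^ mu.exp i * t ^ (n - 1 - (i : ℕ)) : Fˣ) : F) * u) := by
  have key := ev_eigenfunction hr hz hf h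
  refine or_iff_not_imp_left.2 fun h0 => ?_
  -- `k` is the order in `s` of the value at `μ`; scaling `s` by `r` multiplies the lowest
  -- coefficient by `r^k`, while all factors in `s²` have lowest term `1`.
  obtain ⟨k, a, ha, hk⟩ := exists_hasLow h0
  refine ⟨k, ?_⟩
  simp only [parPt_mul, ← mul_assoc, ← map_mul] at key
  have hs := hasLow_scaleS r fun l => hk.le_of_coeff_ne_zero (l := l)
  rw [hk.coeff_eq] at hs
  have h2 : ∀ c : F, HasLow 0 (1 : F) (1 - LaurentPolynomial.C c * LaurentPolynomial.T 2) :=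
    fun c => hasLow_one_sub (by norm_num)
  have hpair : ∀ c : Fin n → Fin n → F, HasLow 0 (1 : F)
      (∏ i, ∏ j ∈ Finset.Ioi i, (1 - LaurentPolynomial.C (c i j) * LaurentPolynomial.T 2)) :=
    fun c => by
      have := HasLead.prod isLeading_Ici Finset.univ fun i _ =>
        HasLead.prod isLeading_Ici (Finset.Ioi i) fun j _ => h2 (c i j)
      simpa using this
  obtain ⟨c, hc⟩ : ∃ c : Fin n → F, ∀ i : Fin n,
      ((q ^ mu.exp i * t ^ (n - 1 - (i : ℕ)) : Fˣ) : F) = c i := ⟨_, fun _ => rfl⟩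
  simp only [hc] at key ⊢
  have hlhs := (((HasLead.prod isLeading_Ici Finset.univ fun i _ => h2 (c i * c i)).mul isLeading_Ici
    (hpair fun i j => c i * c j)).mul isLeading_Ici (hasLow_const E)).mul isLeading_Ici hk
  rw [key] at hlhs
  have hrhs := ((HasLead.prod isLeading_Ici Finset.univ fun i _ => (h2 (c i)).mul isLeading_Ici
    (hasLow_const (1 - c i * u))).mul isLeading_Ici (hpair fun i j => (t : F) * c i * c j)).mul
      isLeading_Ici hs
  have e1 := HasLow.coeff_eq hlhs
  have e2 := HasLow.coeff_eq hrhs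
  simp only [Finset.sum_const_zero, add_zero, zero_add, Finset.prod_const_one, one_mul,
    mul_one] at e1 e2
  have e3 := e1.symm.trans e2
  rw [← mul_assoc, mul_left_inj' ha] at e3
  rw [e3, mul_comm]

/-- A Laurent polynomial vanishing at all partitions is zero. -/
theorem eq_zero_of_ev_eq_zero {q t : Fˣ} (hz : MulIndep q t) {f : SLaurent F n}
    (h : ∀ mu : Par n, ev q t mu.exp f = 0) : f = 0 := by
  -- Parametrising partitions by the differences of their parts turns them into the monoid `ℕ^n`, on
  -- which each monomial `x^a` becomes a fixed unit times a character.
  let par : (Fin n → ℕ) → Par n := fun c =>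
    ⟨fun i => ∑ j ∈ Finset.Ici i, c j, fun i j hij =>
      Finset.sum_le_sum_of_subset (Finset.Ici_subset_Ici.2 hij)⟩
  have hpar : ∀ c d, (par (c + d)).exp = (par c).exp + (par d).exp := fun c d => by
    ext i
    simp [par, Par.exp, Finset.sum_add_distrib]
  let χ : (Fin n → ℤ) → (Multiplicative (Fin n → ℕ) →* F[T;T⁻¹]) := fun a =>
    { toFun := fun c => constU (q ^ ∑ i, (par c.toAdd).exp i * a i)
      map_one' := by simp [par, Par.exp, constU]
      map_mul' := fun c d => by
        rw [← Units.val_mul, ← constU_mul, ← zpow_add, ← Finset.sum_add_distrib]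
        simp only [toAdd_mul, hpar, Pi.add_apply, add_mul] }
  -- On the `j`-th generator the character of `a` is `q` to the `j`-th partial sum of `a`, and `q`
  -- is not a root of unity.
  have hχ : Function.Injective χ := by
    intro a b hab
    refine eq_of_sum_Iic_eq fun j => ?_
    have h1 := DFunLike.congr_fun hab (Multiplicative.ofAdd (Pi.single j 1))
    have h2 := constU_injective (Units.ext h1)
    have hexp : ∀ i, (par (Pi.single j 1)).exp i = if i ≤ j then 1 else 0 := fun i => by
      simp [par, Par.exp, Pi.single_apply]
    have h3 : ∀ a : Fin n → ℤ, ∑ i, (par (Pi.single j 1)).exp i * a i = ∑ i ∈ Finset.Iic j, a i := by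
      intro a
      simp only [hexp, ite_mul, one_mul, zero_mul, ← Finset.sum_filter]
      congr 1
      ext
      simp
    simp only [toAdd_ofAdd, h3] at h2
    have h4 := hz (∑ i ∈ Finset.Iic j, a i - ∑ i ∈ Finset.Iic j, b i) 0 (by
      rw [zpow_zero, mul_one, zpow_sub, h2, mul_inv_cancel])
    exact sub_eq_zero.1 h4.1
  let w : (Fin n → ℤ) → F[T;T⁻¹]ˣ := fun a =>
    ∏ i : Fin n, (constU (t ^ (n - 1 - (i : ℕ))) * sU F) ^ a i
  have hli := (linearIndependent_monoidHom (Multiplicative (Fin n → ℕ)) F[T;T⁻¹]).comp χ hχ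
  have h0 := linearIndependent_iff'.1 hli f.coeff.support (fun a => f.coeff a * w a) (by
    ext1 c
    have h1 := h (par c.toAdd)
    rw [← AddMonoidAlgebra.sum_coeff_single f, Finsupp.sum, map_sum] at h1
    rw [Finset.sum_apply, Pi.zero_apply, ← h1]
    refine Finset.sum_congr rfl fun a _ => ?_
    rw [ev_single, Pi.smul_apply, smul_eq_mul, mul_assoc]
    congr 1
    show (w a : F[T;T⁻¹]) * (constU _ : F[T;T⁻¹]ˣ) = _
    rw [← Units.val_mul]
    congr 1
    rw [zpow_sum_eq_prod, constU, map_prod, ← Finset.prod_mul_distrib]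
    refine Finset.prod_congr rfl fun i _ => ?_
    rw [parPt, constU_mul, zpow_mul, mul_assoc, mul_zpow _ (_ * _), mul_comm, map_zpow]
    rfl)
  ext a : 2
  by_contra hne
  have := h0 a (by simpa using hne)
  exact hne ((mul_eq_zero.1 this).resolve_right (Units.ne_zero _))

/-! ### Consequences of algebraic independence -/

theorem mulIndep_of_algebraicIndependent [CharZero F] {q t : Fˣ}
    (h : AlgebraicIndependent ℚ ![(q : F), (t : F)]) : MulIndep q t := by
  have key : ∀ a b c d : ℕ, q ^ a * t ^ b = q ^ c * t ^ d → a = c ∧ b = d := by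
    intro a b c d he
    have e1 := congrArg Units.val he
    push_cast at e1
    have e2 : MvPolynomial.aeval ![(q : F), (t : F)]
        (MvPolynomial.X 0 ^ a * MvPolynomial.X 1 ^ b : MvPolynomial (Fin 2) ℚ) =
        MvPolynomial.aeval ![(q : F), (t : F)]
          (MvPolynomial.X 0 ^ c * MvPolynomial.X 1 ^ d : MvPolynomial (Fin 2) ℚ) := by
      simpa using e1
    have e3 := h e2
    constructor
    -- Set the second variable to `1` and compare degrees in the first; the other case is symmetric.
    · have := congrArg (fun p : MvPolynomial (Fin 2) ℚ =>
        Polynomial.natDegree (MvPolynomial.aeval ![(Polynomial.X : Polynomial ℚ), 1] p))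
        e3
      simpa using this
    · have := congrArg (fun p : MvPolynomial (Fin 2) ℚ =>
        Polynomial.natDegree (MvPolynomial.aeval ![1, (Polynomial.X : Polynomial ℚ)] p))
        e3
      simpa using this
  intro a b hab
  have h1 : q ^ a.toNat * t ^ b.toNat = q ^ (-a).toNat * t ^ (-b).toNat := by
    rw [← zpow_natCast, ← zpow_natCast, ← zpow_natCast, ← zpow_natCast]
    have ha : ((a.toNat : ℕ) : ℤ) = a + ((-a).toNat : ℕ) := by omega
    have hb : ((b.toNat : ℕ) : ℤ) = b + ((-b).toNat : ℕ) := by omega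
    rw [ha, hb, zpow_add, zpow_add, mul_mul_mul_comm, hab, one_mul]
  have := key _ _ _ _ h1
  omega

/-! ### Separation of the eigenvalues at `u = -t` -/

section GenericParameter

open Polynomial

theorem X_pow_dvd_prod_sub_one {R ι : Type*} [CommRing R] (s : Finset ι) (c : ι → R) (e : ι → ℕ)
    {m : ℕ} (he : ∀ j ∈ s, m ≤ e j) :
    (X : R[X]) ^ m ∣ ∏ j ∈ s, (1 + C (c j) * X ^ e j) - 1 := by
  classical
  induction s using Finset.induction_on with
  | empty => simp
  | insert i s hi ih =>
    rw [Finset.prod_insert hi]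
    have h1 := ih fun j hj => he j (by simp [hj])
    have h2 : (X : R[X]) ^ m ∣ C (c i) * X ^ e i :=
      Dvd.dvd.mul_left (pow_dvd_pow _ (he i (by simp))) _
    have : ∀ P a : R[X], (1 + a) * P - 1 = (P - 1) + a * P := fun P a => by ring
    rw [this]
    exact dvd_add h1 (Dvd.dvd.mul_right h2 _)

/-- The product of the `1 + q ^ (mu i) * t ^ (n - i)`, as a polynomial in `t` over `ℚ[q]`. -/
def genProd (mu : Par n) : ℚ[X][X] := ∏ i : Fin n, (1 + C (X ^ mu.1 i) * X ^ (n - (i : ℕ)))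

theorem coeff_zero_genProd (mu : Par n) : (genProd mu).coeff 0 = 1 := by
  obtain ⟨w, hw⟩ := X_pow_dvd_prod_sub_one Finset.univ (fun i : Fin n => (X : ℚ[X]) ^ mu.1 i)
    (fun i => n - (i : ℕ)) (m := 1) fun j _ => by have := j.2; omega
  rw [pow_one] at hw
  have : genProd mu = 1 + X * w := by rw [genProd, ← hw]; ring
  simp [this]

/-- Let `i` be the largest index where the partitions differ. Factors with larger index agree and
cancel, factors with smaller index are `1` modulo `t^{n-i+1}`, so the coefficient of `t^{n-i}`
recovers `q^{μ_i}`. -/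
theorem eq_of_genProd_eq {mu lam : Par n} (h : genProd mu = genProd lam) : mu = lam := by
  by_contra hne
  have hex : (Finset.univ.filter fun i => mu.1 i ≠ lam.1 i).Nonempty := by
    by_contra hemp
    rw [Finset.not_nonempty_iff_eq_empty, Finset.filter_eq_empty_iff] at hemp
    exact hne (Subtype.ext (funext fun i => not_not.1 (hemp (Finset.mem_univ i))))
  set i := (Finset.univ.filter fun i => mu.1 i ≠ lam.1 i).max' hex with hi_def
  have hi : mu.1 i ≠ lam.1 i := (Finset.mem_filter.1 (Finset.max'_mem _ hex)).2
  have hgt : ∀ j, i < j → mu.1 j = lam.1 j := fun j hj => by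
    by_contra hj'
    exact absurd (Finset.le_max' _ j (by simpa using hj')) (not_le.2 hj)
  have hsplit : ∀ nu : Par n, genProd nu = (∏ j ∈ Finset.Ioi i,
      (1 + C ((X : ℚ[X]) ^ nu.1 j) * X ^ (n - (j : ℕ)))) * ((1 + C (X ^ nu.1 i) * X ^ (n - (i : ℕ))) *
        ∏ j ∈ Finset.Iio i, (1 + C ((X : ℚ[X]) ^ nu.1 j) * X ^ (n - (j : ℕ)))) := by
    intro nu
    have hu : (Finset.univ : Finset (Fin n)) = Finset.Ioi i ∪ insert i (Finset.Iio i) := by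
      ext j
      have := lt_trichotomy i j
      simp only [Finset.mem_univ, Finset.mem_union, Finset.mem_Ioi, Finset.mem_insert,
        Finset.mem_Iio, true_iff]
      tauto
    rw [genProd, hu, Finset.prod_union, Finset.prod_insert (by simp)]
    rw [Finset.disjoint_left]
    intro j hj hj'
    rw [Finset.mem_insert, Finset.mem_Iio] at hj'
    have := Finset.mem_Ioi.1 hj
    rcases hj' with rfl | h
    · exact lt_irrefl _ this
    · exact lt_asymm this h
  have hprod0 : (∏ j ∈ Finset.Ioi i, (1 + C ((X : ℚ[X]) ^ lam.1 j) * X ^ (n - (j : ℕ)))) ≠ 0 :=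
    fun h0 => by
      have := coeff_zero_genProd lam
      rw [hsplit lam, h0, zero_mul, coeff_zero] at this
      exact zero_ne_one this
  rw [hsplit mu, hsplit lam, Finset.prod_congr rfl fun j hj => by
    rw [hgt j (Finset.mem_Ioi.1 hj)], mul_right_inj' hprod0] at h
  have hlow : ∀ nu : Par n, (X : ℚ[X][X]) ^ (n - (i : ℕ) + 1) ∣
      ∏ j ∈ Finset.Iio i, (1 + C ((X : ℚ[X]) ^ nu.1 j) * X ^ (n - (j : ℕ))) - 1 := fun nu =>
    X_pow_dvd_prod_sub_one _ _ _ fun j hj => by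
      have := Fin.lt_def.1 (Finset.mem_Iio.1 hj)
      have := i.2
      omega
  obtain ⟨w, hw⟩ := hlow mu
  obtain ⟨w', hw'⟩ := hlow lam
  rw [sub_eq_iff_eq_add] at hw hw'
  rw [hw, hw'] at h
  have hd : C ((X : ℚ[X]) ^ mu.1 i - X ^ lam.1 i) * X ^ (n - (i : ℕ)) =
      X ^ (n - (i : ℕ) + 1) * (w' - w + C (X ^ lam.1 i) * X ^ (n - (i : ℕ)) * w' -
        C (X ^ mu.1 i) * X ^ (n - (i : ℕ)) * w) := by
    rw [C_sub]
    linear_combination h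
  have hc := congrArg (fun p => p.coeff (n - (i : ℕ))) hd
  simp only [coeff_C_mul, coeff_X_pow_self, mul_one, coeff_X_pow_mul'] at hc
  rw [if_neg (by omega), sub_eq_zero] at hc
  have := congrArg natDegree hc
  rw [natDegree_X_pow, natDegree_X_pow] at this
  exact hi this

/-- Squaring replaces `r` by `q`, and algebraic independence turns the equation into a polynomial
identity. Its constant term in `t` compares the two powers of `q`, which cancel; constant term `1`
also excludes the sign `-1` when the square root is taken. -/
theorem par_eq_of_prod_eq [CharZero F] {q t r : Fˣ} (hr : r ^ 2 = q)
    (h : AlgebraicIndependent ℚ ![(q : F), (t : F)]) {a b : ℤ} {mu lam : Par n}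
    (he : (r : F) ^ a * ∏ i : Fin n, (1 + (q : F) ^ mu.1 i * (t : F) ^ (n - (i : ℕ))) =
      (r : F) ^ b * ∏ i : Fin n, (1 + (q : F) ^ lam.1 i * (t : F) ^ (n - (i : ℕ)))) :
    mu = lam := by
  have hq : ∀ m : ℤ, ((r : F) ^ m) ^ 2 = (q : F) ^ m := fun m => by
    rw [← hr, Units.val_pow_eq_pow_val, ← zpow_natCast, ← zpow_natCast, zpow_comm]
  have h1 := congrArg (· ^ 2) he
  simp only [mul_pow, hq] at h1
  -- Multiplying by `q^N` makes both exponents of `q` nonnegative.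
  set N : ℤ := |a| + |b|
  have hcast : ∀ m : ℤ, |m| ≤ N → (q : F) ^ N * (q : F) ^ m = (q : F) ^ (N + m).toNat :=
    fun m hm => by
      rw [← zpow_add₀ q.ne_zero, ← zpow_natCast, Int.toNat_of_nonneg]
      have := abs_le.1 hm
      omega
  have h2 := congrArg ((q : F) ^ N * ·) h1
  simp only [← mul_assoc] at h2
  rw [hcast a (by simp [N]), hcast b (by simp [N])] at h2
  let p : Par n → MvPolynomial (Fin 2) ℚ := fun nu =>
    ∏ i : Fin n, (1 + MvPolynomial.X 0 ^ nu.1 i * MvPolynomial.X 1 ^ (n - (i : ℕ)))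
  have h3 : MvPolynomial.X 0 ^ (N + a).toNat * p mu ^ 2 =
      MvPolynomial.X 0 ^ (N + b).toNat * p lam ^ 2 := h (by simpa [p] using h2)
  have h4 := congrArg (MvPolynomial.aeval ![(C X : ℚ[X][X]), X]) h3
  have h5 : C (X ^ (N + a).toNat) * genProd mu ^ 2 = C (X ^ (N + b).toNat) * genProd lam ^ 2 := by
    simpa [p, genProd] using h4
  have h6 := congrArg (fun P => P.coeff 0) h5
  simp only [pow_two, mul_coeff_zero, coeff_zero_genProd, mul_one, coeff_C_zero] at h6
  rw [h6, mul_right_inj' (by rw [Ne, C_eq_zero]; exact pow_ne_zero _ X_ne_zero)] at h5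
  rcases sq_eq_sq_iff_eq_or_eq_neg.1 h5 with h7 | h7
  · exact eq_of_genProd_eq h7
  · have := congrArg (fun P => P.coeff 0) h7
    simp only [coeff_neg, coeff_zero_genProd] at this
    norm_num at this

end GenericParameter

/-! ### The interpolation property -/

/-- A family of triangular elements with the extra vanishing property. -/
structure IsInterpolating (q t : Fˣ) (P : Par n → SLaurent F n) : Prop where
  monic : ∀ lam, IsMonicTriangular lam (P lam)
  vanish : ∀ lam mu : Par n, ¬ lam.Contained mu → ev q t mu.exp (P lam) = 0
  ne_zero : ∀ lam : Par n, ev q t lam.exp (P lam) ≠ 0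

/-- With `u = -t` every factor has a positive power of `t`, so the product has constant term `1` in
`t`. -/
theorem eigenE_neg {q t r : Fˣ} (hr : r ^ 2 = q) (mu : Par n) :
    eigenE r t mu (-t) = (r : F) ^ (-mu.size) *
      ∏ i : Fin n, (1 + (q : F) ^ mu.1 i * (t : F) ^ (n - (i : ℕ))) := by
  rw [eigenE, ← hr]
  congr 1
  refine Finset.prod_congr rfl fun i _ => ?_
  have h : n - (i : ℕ) = n - 1 - (i : ℕ) + 1 := by have := i.2; omega
  rw [h, pow_succ (t : F), Units.val_pow_eq_pow_val]
  ring

theorem Par.Contained.trans {lam mu nu : Par n} (h : lam.Contained mu) (h' : mu.Contained nu) :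
    lam.Contained nu := fun i => (h i).trans (h' i)

theorem Par.Contained.size_le {lam mu : Par n} (h : lam.Contained mu) : lam.size ≤ mu.size :=
  Finset.sum_le_sum fun i _ => by exact_mod_cast h i

/-! ### Existence of an interpolating family -/

section Interpolation

variable [CharZero F] {q t r : Fˣ}

theorem separates_neg (hr : r ^ 2 = q) (h : AlgebraicIndependent ℚ ![(q : F), (t : F)])
    (lam : Par n) : Separates r t lam (-t) := by
  rintro ⟨l, mu⟩ ⟨hle, hne⟩ he
  rw [eigenE_neg hr, eigenE_neg hr, ← mul_assoc, ← zpow_add₀ r.ne_zero] at he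
  obtain rfl := par_eq_of_prod_eq hr h he
  exact hne (Prod.ext (MonLE.eq_of_eq hle) rfl)

theorem ev_eq_zero_of_ne (hr : r ^ 2 = q) (h : AlgebraicIndependent ℚ ![(q : F), (t : F)])
    {lam : Par n} {f : SLaurent F n}
    (hf : opA r t (-t) f = weylDen F n * (eigenE r t lam (-t) • f)) {mu : Par n} (hne : mu ≠ lam)
    (h0 : ∀ nu : Par n, nu.Contained mu → nu ≠ mu → ev q t nu.exp f = 0) :
    ev q t mu.exp f = 0 := by
  refine (ev_eq_zero_or hr (mulIndep_of_algebraicIndependent h) hf h0).resolve_right ?_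
  rintro ⟨k, hk⟩
  refine hne (par_eq_of_prod_eq hr h (a := k) (b := -lam.size) ?_)
  rw [← eigenE_neg hr, hk]
  congr 1
  refine Finset.prod_congr rfl fun i _ => ?_
  have h : n - (i : ℕ) = n - 1 - (i : ℕ) + 1 := by have := i.2; omega
  rw [h, pow_succ (t : F), Units.val_mul, Par.exp, zpow_natCast, Units.val_pow_eq_pow_val,
    Units.val_pow_eq_pow_val]
  ring

theorem size_lt_of_contained {nu mu : Par n} (h : nu.Contained mu) (hne : nu ≠ mu) :
    nu.size.toNat < mu.size.toNat := by
  have h1 := h.size_le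
  have h2 := nu.size_nonneg
  have h3 : ¬ mu.size ≤ nu.size := fun h3 => hne (Par.eq_of_contained h h3)
  omega

/-- `P_λ` is the eigenfunction at `u = -t`. Vanishing is proved by induction on the size of `μ`,
since partitions inside one that does not contain `λ` do not contain `λ` either. A zero at `λ` would
remove the only exception, so `P_λ` would vanish at all partitions and be zero. -/
theorem exists_isInterpolating (hr : r ^ 2 = q)
    (h : AlgebraicIndependent ℚ ![(q : F), (t : F)]) :
    ∃ P : Par n → SLaurent F n, IsInterpolating q t P := by
  choose P hP hPe using fun lam : Par n => exists_eigenfunction (separates_neg hr h lam)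
  have hvan : ∀ lam mu : Par n, ¬ lam.Contained mu → ev q t mu.exp (P lam) = 0 := by
    intro lam
    have key : ∀ m : ℕ, ∀ mu : Par n, mu.size.toNat = m → ¬ lam.Contained mu →
        ev q t mu.exp (P lam) = 0 := by
      intro m
      induction m using Nat.strong_induction_on with
      | _ m ih =>
        rintro mu rfl hmu
        refine ev_eq_zero_of_ne hr h (hPe lam) ?_ fun nu hnu hne =>
          ih _ (size_lt_of_contained hnu hne) nu rfl fun h' => hmu (h'.trans hnu)
        rintro rfl
        exact hmu fun i => le_rfl
    exact fun mu => key _ mu rfl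
  refine ⟨P, hP, hvan, fun lam h0 => ?_⟩
  have key : ∀ m : ℕ, ∀ mu : Par n, mu.size.toNat = m → ev q t mu.exp (P lam) = 0 := by
    intro m
    induction m using Nat.strong_induction_on with
    | _ m ih =>
      rintro mu rfl
      by_cases hmu : mu = lam
      · rwa [hmu]
      · exact ev_eq_zero_of_ne hr h (hPe lam) hmu fun nu hnu hne =>
          ih _ (size_lt_of_contained hnu hne) nu rfl
  have h1 : P lam = 0 := eq_zero_of_ev_eq_zero (mulIndep_of_algebraicIndependent h) fun mu =>
    key _ mu rfl
  have h2 := (isMonicTriangular_iff.1 (hP lam)).2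
  rw [h1, map_zero] at h2
  exact zero_ne_one h2

end Interpolation

/-! ### Uniqueness by interpolation, and its consequences for the operators -/

section Interpolating

variable {q t : Fˣ} {P : Par n → SLaurent F n}

/-- Evaluate at an index `ν` of least size in the expansion: any other index contained in `ν` would
be smaller, so only the term of `P_ν` survives. -/
theorem IsInterpolating.eq_zero_of_mem_span (hP : IsInterpolating q t P) {S : Set (Par n)}
    {f : SLaurent F n} (hf : f ∈ Submodule.span F[T;T⁻¹] (P '' S))
    (h : ∀ nu ∈ S, ev q t nu.exp f = 0) : f = 0 := by
  obtain ⟨l, hl, rfl⟩ := (Finsupp.mem_span_image_iff_linearCombination _).1 hf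
  suffices l = 0 by rw [this, map_zero]
  by_contra hne
  obtain ⟨nu, hnu, hmin⟩ := Finset.exists_min_image l.support Par.size
    (Finsupp.support_nonempty_iff.2 hne)
  have h1 := h nu (hl hnu)
  rw [Finsupp.linearCombination_apply, Finsupp.sum, map_sum, Finset.sum_eq_single nu, map_smul,
    smul_eq_mul] at h1
  · exact (mul_ne_zero (Finsupp.mem_support_iff.1 hnu) (hP.ne_zero nu)) h1
  · intro kap hk hne
    rw [map_smul, hP.vanish kap nu fun hc => hne (Par.eq_of_contained hc (hmin kap hk)), smul_zero]
  · exact fun h => absurd hnu h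

/-- Inversion of a unitriangular system, by induction on the height; powers of `s` are absorbed into
the scalars. -/
theorem IsInterpolating.orbitSum_mem_span (hP : IsInterpolating q t P) (mu : Par n) :
    orbitSum F[T;T⁻¹] mu ∈ Submodule.span F[T;T⁻¹] (P '' {nu | nu.DomLE mu}) := by
  have key : ∀ m : ℕ, ∀ mu : Par n, mu.height = m →
      orbitSum F[T;T⁻¹] mu ∈ Submodule.span F[T;T⁻¹] (P '' {nu | nu.DomLE mu}) := by
    intro m
    induction m using Nat.strong_induction_on with
    | _ m ih =>
      rintro mu rfl
      have h1 : strictDomSpan F 0 mu ≤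
          (Submodule.span F[T;T⁻¹] (P '' {nu | nu.DomLE mu})).restrictScalars F := by
        rw [strictDomSpan_eq, sSpan, Submodule.span_le]
        rintro _ ⟨⟨l, nu⟩, ⟨hle, hne⟩, rfl⟩
        refine Submodule.smul_mem _ _ (Submodule.span_mono (Set.image_mono ?_)
          (ih _ (MonLE.height_lt hle hne) nu rfl))
        exact fun kap hk => Par.DomLE.trans hk hle.1
      have h2 := h1 (hP.monic mu)
      have h3 : P mu ∈ Submodule.span F[T;T⁻¹] (P '' {nu | nu.DomLE mu}) :=
        Submodule.subset_span ⟨mu, Par.DomLE.refl mu, rfl⟩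
      have h4 := sub_mem h3 h2
      rwa [sub_sub_cancel, sMon, LaurentPolynomial.T_zero, one_smul] at h4
  exact key _ mu rfl

/-- The expansion of `f` involves only `ν ≠ λ` with `ν ≤ λ`. Such `ν` have size at most that of `λ`
and so cannot contain it; `f` vanishes at all of them. -/
theorem IsInterpolating.eq_zero_of_mem_strictDomSpan (hP : IsInterpolating q t P) {lam : Par n}
    {f : SLaurent F n} (hf : f ∈ strictDomSpan F 0 lam)
    (h : ∀ nu : Par n, ¬ lam.Contained nu → ev q t nu.exp f = 0) : f = 0 := by
  refine hP.eq_zero_of_mem_span (S := {nu | nu.DomLE lam ∧ nu ≠ lam}) (f := f) ?_ fun nu hnu =>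
    h nu fun hc => hnu.2 (Par.eq_of_contained hc hnu.1.size_le).symm
  have h1 : strictDomSpan F 0 lam ≤ (Submodule.span F[T;T⁻¹]
      (P '' {nu | nu.DomLE lam ∧ nu ≠ lam})).restrictScalars F := by
    rw [strictDomSpan_eq, sSpan, Submodule.span_le]
    rintro _ ⟨⟨l, nu⟩, ⟨hle, hne⟩, rfl⟩
    refine Submodule.smul_mem _ _ (Submodule.span_mono (Set.image_mono ?_)
      (hP.orbitSum_mem_span nu))
    refine fun kap hk => ⟨Par.DomLE.trans hk hle.1, ?_⟩
    rintro rfl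
    exact lt_irrefl _ ((MonLE.height_lt hle hne).trans_le
      (Finset.sum_le_sum fun j _ => hk j))
  exact h1 hf

theorem IsInterpolating.eq_zero_of_degree_le (hP : IsInterpolating q t P) {d : ℤ}
    {f : SLaurent F n} (hf : IsBCSymm f) (hd : ∀ mu : Par n, f.coeff mu.exp ≠ 0 → mu.size ≤ d)
    (h : ∀ nu : Par n, nu.size ≤ d → ev q t nu.exp f = 0) : f = 0 := by
  refine hP.eq_zero_of_mem_span (S := {nu | nu.size ≤ d}) ?_ h
  rw [hf.eq_sum]
  refine Submodule.sum_mem _ fun mu hmu => Submodule.smul_mem _ _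
    (Submodule.span_mono (Set.image_mono fun nu hnu => ?_) (hP.orbitSum_mem_span mu))
  exact (Par.DomLE.size_le hnu).trans (hd mu (by simpa using hmu))

theorem IsInterpolating.mem_span (hP : IsInterpolating q t P) {f : SLaurent F n}
    (hf : IsBCSymm f) : f ∈ Submodule.span F[T;T⁻¹] (Set.range P) := by
  rw [hf.eq_sum]
  exact Submodule.sum_mem _ fun mu _ => Submodule.smul_mem _ _
    (Submodule.span_mono (Set.image_subset_range _ _) (hP.orbitSum_mem_span mu))

theorem ev_weylDen_ne_zero (hz : MulIndep q t) (nu : Fin n → ℤ) :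
    ev q t nu (weylDen F n) ≠ 0 := by
  have h1 : ∀ i j : Fin n, 1 - (parPt q t nu i * parPt q t nu j : F[T;T⁻¹]) ≠ 0 := by
    intro i j h
    rw [parPt_mul, ← LaurentPolynomial.single_eq_C_mul_T] at h
    have := congrArg (fun c : F[T;T⁻¹] => c.coeff 0) h
    simp only [AddMonoidAlgebra.one_def, AddMonoidAlgebra.coeff_sub, AddMonoidAlgebra.coeff_single,
      Finsupp.sub_apply, Finsupp.single_eq_same, AddMonoidAlgebra.coeff_zero] at this
    rw [Finsupp.single_eq_of_ne (by norm_num)] at this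
    simp at this
  rw [ev_weylDen]
  refine mul_ne_zero (mul_ne_zero ?_ ?_) (mul_ne_zero ?_ ?_)
  · exact Finset.prod_ne_zero_iff.2 fun i _ => neg_ne_zero.2 (Units.ne_zero _)
  · refine Finset.prod_ne_zero_iff.2 fun i _ => Finset.prod_ne_zero_iff.2 fun j hj =>
      sub_ne_zero.2 fun he => parPt_ne hz nu (Finset.mem_Ioi.1 hj).ne ?_
    exact inv_injective (Units.ext he)
  · exact Finset.prod_ne_zero_iff.2 fun i _ => h1 i i
  · exact Finset.prod_ne_zero_iff.2 fun i _ => Finset.prod_ne_zero_iff.2 fun j _ => h1 i j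

/-- The passage from the single value `u = -t` to all `u`. By `ev_opA`, `D_s(u) P_λ` inherits the
vanishing at every `ν` not containing `λ`, and `D_s(u) P_λ - E_λ(u) P_λ` is strictly dominated,
hence zero. -/
theorem IsInterpolating.opA_eq [CharZero F] {r : Fˣ} (hr : r ^ 2 = q) (hz : MulIndep q t)
    (hP : IsInterpolating q t P) (u : F) (lam : Par n) :
    opA r t u (P lam) = weylDen F n * (eigenE r t lam u • P lam) := by
  obtain ⟨hd, hc⟩ := isMonicTriangular_iff.1 (hP.monic lam)
  obtain ⟨g, hg, he, hcg⟩ := exists_opA_domSpan_cf r t u hd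
  rw [hc, zpow_zero, one_mul, mul_one] at hcg
  have h1 : g - eigenE r t lam u • P lam ∈ strictDomSpan F 0 lam := by
    have := sub_mem_strictDomSpan (sub_mem hg (Submodule.smul_mem _ (eigenE r t lam u) hd))
    rwa [map_sub, map_smul, hcg, hc, smul_eq_mul, mul_one, sub_self, zero_smul, sub_zero] at this
  have h2 := hP.eq_zero_of_mem_strictDomSpan h1 fun nu hnu => by
    have h3 := ev_opA (q := q) (t := t) hr u (f := P lam) (mu := nu) fun kap hk _ =>
      hP.vanish lam kap fun h => hnu (h.trans hk)
    rw [he, map_mul, hP.vanish lam nu hnu, map_zero, mul_zero] at h3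
    rw [map_sub, (mul_eq_zero.1 h3).resolve_left (ev_weylDen_ne_zero hz _), ev_fsmul,
      hP.vanish lam nu hnu, mul_zero, sub_zero]
  rw [he, sub_eq_zero.1 h2]

/-- The `P_λ` are common eigenvectors spanning the symmetric elements over `F[s, 1/s]`. Both
operators are semilinear for the same automorphism `s ↦ r s`, so both orders of composition twist
scalars alike. -/
theorem IsInterpolating.opA_comm [CharZero F] {r : Fˣ} (hr : r ^ 2 = q) (hz : MulIndep q t)
    (hP : IsInterpolating q t P) (u v : F) {f : SLaurent F n} (hf : IsBCSymm f) :
    ∃ g₁ g₂ h : SLaurent F n, opA r t v f = weylDen F n * g₁ ∧ opA r t u f = weylDen F n * g₂ ∧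
      opA r t u g₁ = weylDen F n * h ∧ opA r t v g₂ = weylDen F n * h := by
  have hmem := hP.mem_span hf
  clear hf
  induction hmem using Submodule.span_induction with
  | mem f h =>
    obtain ⟨lam, rfl⟩ := h
    refine ⟨_, _, (eigenE r t lam v * eigenE r t lam u) • P lam, hP.opA_eq hr hz v lam,
      hP.opA_eq hr hz u lam, ?_, ?_⟩
    · rw [opA_fsmul, hP.opA_eq hr hz, mul_smul, mul_smul_comm,
        mul_smul_comm, mul_smul_comm]
    · rw [opA_fsmul, hP.opA_eq hr hz, mul_comm (eigenE r t lam v), mul_smul, mul_smul_comm,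
        mul_smul_comm, mul_smul_comm]
  | zero => exact ⟨0, 0, 0, by simp⟩
  | add f f' _ _ h1 h2 =>
    obtain ⟨g₁, g₂, h, e1, e2, e3, e4⟩ := h1
    obtain ⟨g₁', g₂', h', e1', e2', e3', e4'⟩ := h2
    exact ⟨g₁ + g₁', g₂ + g₂', h + h', by rw [map_add, e1, e1', mul_add],
      by rw [map_add, e2, e2', mul_add], by rw [map_add, e3, e3', mul_add],
      by rw [map_add, e4, e4', mul_add]⟩
  | smul c f _ h1 =>
    obtain ⟨g₁, g₂, h, e1, e2, e3, e4⟩ := h1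
    exact ⟨scaleS r c • g₁, scaleS r c • g₂, scaleS r (scaleS r c) • h,
      by rw [opA_smul, e1, mul_smul_comm], by rw [opA_smul, e2, mul_smul_comm],
      by rw [opA_smul, e3, mul_smul_comm], by rw [opA_smul, e4, mul_smul_comm]⟩

end Interpolating

/-! ### Rationality of the coefficients -/

/-- Apply an additive map to the coefficients of a Laurent polynomial in `s`. -/
def coeffMap (ψ : F →+ F) : F[T;T⁻¹] →+ F[T;T⁻¹] :=
  AddMonoidHom.mk' (AddMonoidAlgebra.map ψ) fun _ _ => AddMonoidAlgebra.map_add _ _ _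

/-- Apply an additive map to the coefficients of an element of `F[s, 1/s][x^{±1}]`. -/
def coeffMapS (n : ℕ) (ψ : F →+ F) : SLaurent F n →+ SLaurent F n :=
  AddMonoidHom.mk' (AddMonoidAlgebra.map (coeffMap ψ)) fun _ _ => AddMonoidAlgebra.map_add _ _ _

theorem coeffMap_single (ψ : F →+ F) (l : ℤ) (c : F) :
    coeffMap ψ (AddMonoidAlgebra.single l c) = AddMonoidAlgebra.single l (ψ c) :=
  AddMonoidAlgebra.map_single _ _ _

theorem coeffMapS_single (ψ : F →+ F) (a : Fin n → ℤ) (c : F[T;T⁻¹]) :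
    coeffMapS n ψ (AddMonoidAlgebra.single a c) = AddMonoidAlgebra.single a (coeffMap ψ c) :=
  AddMonoidAlgebra.map_single _ _ _

theorem coeff_coeffMapS (ψ : F →+ F) (f : SLaurent F n) (a : Fin n → ℤ) :
    (coeffMapS n ψ f).coeff a = coeffMap ψ (f.coeff a) := rfl

theorem cf_coeffMapS (ψ : F →+ F) (f : SLaurent F n) (x : (Fin n → ℤ) × ℤ) :
    cf x (coeffMapS n ψ f) = ψ (cf x f) := rfl

theorem prod_parPt_zpow (q t : Fˣ) (nu a : Fin n → ℤ) :
    ((∏ i, parPt q t nu i ^ a i : F[T;T⁻¹]ˣ) : F[T;T⁻¹]) = AddMonoidAlgebra.single (∑ i, a i)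
      ((∏ i : Fin n, (q ^ nu i * t ^ (n - 1 - (i : ℕ))) ^ a i : Fˣ) : F) := by
  rw [LaurentPolynomial.single_eq_C_mul_T, ← val_constU, ← val_sU_zpow, ← Units.val_mul,
    zpow_sum_eq_prod, constU, map_prod, ← Finset.prod_mul_distrib]
  congr 1
  refine Finset.prod_congr rfl fun i _ => ?_
  rw [parPt, mul_zpow, map_zpow]
  rfl

/-- At these points a monomial in `x` takes as value an element of `k` times a power of `s`, and `ψ`
is `k`-linear. -/
theorem ev_coeffMapS {q t : Fˣ} {k : Subfield F} (hq : (q : F) ∈ k) (ht : (t : F) ∈ k)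
    {ψ : F →+ F} (hψ : ∀ c ∈ k, ∀ x, ψ (c * x) = c * ψ x) (nu : Fin n → ℤ) (f : SLaurent F n) :
    ev q t nu (coeffMapS n ψ f) = coeffMap ψ (ev q t nu f) := by
  induction f using AddMonoidAlgebra.induction_linear with
  | zero => simp
  | add f g hf hg => simp only [map_add, hf, hg]
  | single a p =>
    rw [coeffMapS_single, ev_single, ev_single, prod_parPt_zpow]
    have hmem : ((∏ i : Fin n, (q ^ nu i * t ^ (n - 1 - (i : ℕ))) ^ a i : Fˣ) : F) ∈ k := by
      rw [Units.coe_prod]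
      refine prod_mem fun i _ => ?_
      rw [Units.val_zpow_eq_zpow_val, Units.val_mul, Units.val_zpow_eq_zpow_val,
        Units.val_pow_eq_pow_val]
      exact zpow_mem (mul_mem (zpow_mem hq _) (pow_mem ht _)) _
    induction p using AddMonoidAlgebra.induction_linear with
    | zero => simp
    | add f g hf hg => simp only [map_add, add_mul, hf, hg]
    | single l c =>
      rw [coeffMap_single, AddMonoidAlgebra.single_mul_single, AddMonoidAlgebra.single_mul_single,
        coeffMap_single, mul_comm c, hψ _ hmem, mul_comm]

theorem isMonicTriangular_coeffMapS {ψ : F →+ F} (h1 : ψ 1 = 1) {lam : Par n} {f : SLaurent F n}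
    (hf : IsMonicTriangular lam f) : IsMonicTriangular lam (coeffMapS n ψ f) := by
  rw [isMonicTriangular_iff, domSpan_eq, mem_sSpan_iff] at hf ⊢
  obtain ⟨⟨hs, hc⟩, hl⟩ := hf
  refine ⟨⟨fun π σ a => ?_, fun l mu h => hc l mu fun h0 => h ?_⟩, ?_⟩
  · rw [coeff_coeffMapS, coeff_coeffMapS, hs]
  · rw [cf_coeffMapS, h0, map_zero]
  · rw [cf_coeffMapS, hl, h1]

theorem exists_subfield_projection (k : Subfield F) : ∃ ψ : F →+ F, (∀ x, ψ x ∈ k) ∧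
    (∀ c ∈ k, ∀ x, ψ (c * x) = c * ψ x) ∧ ψ 1 = 1 := by
  obtain ⟨φ, hφ⟩ := LinearMap.exists_leftInverse_of_injective (Algebra.linearMap k F)
    (LinearMap.ker_eq_bot.2 (algebraMap k F).injective)
  refine ⟨(k.subtype : k →+ F).comp φ.toAddMonoidHom, fun x => (φ x).2, fun c hc x => ?_, ?_⟩
  · exact congrArg Subtype.val (φ.map_smul ⟨c, hc⟩ x)
  · have := LinearMap.congr_fun hφ 1
    rw [LinearMap.comp_apply, Algebra.linearMap_apply, map_one] at this
    exact congrArg Subtype.val this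

/-- A `ℚ(q,t)`-linear projection of `F` onto `ℚ(q,t)`, applied to the coefficients, preserves the
triangular form and the vanishing conditions, hence fixes `P_λ` by uniqueness. -/
theorem IsInterpolating.coeff_mem {q t : Fˣ} {P : Par n → SLaurent F n}
    (hP : IsInterpolating q t P) (lam : Par n) (a : Fin n → ℤ) (l : ℤ) :
    ((P lam).coeff a).coeff l ∈ Subfield.closure {(q : F), (t : F)} := by
  obtain ⟨ψ, hmem, hψ, h1⟩ := exists_subfield_projection (Subfield.closure {(q : F), (t : F)})
  have hsub : coeffMapS n ψ (P lam) - P lam ∈ strictDomSpan F 0 lam := by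
    have := sub_mem (isMonicTriangular_coeffMapS h1 (hP.monic lam)) (hP.monic lam)
    rwa [sub_sub_sub_cancel_right] at this
  have h0 := hP.eq_zero_of_mem_strictDomSpan hsub fun nu hnu => by
    rw [map_sub, ev_coeffMapS (Subfield.subset_closure (by simp))
      (Subfield.subset_closure (by simp)) hψ, hP.vanish lam nu hnu, map_zero, sub_zero]
  rw [← sub_eq_zero.1 h0]
  exact hmem _

/-! ### Eigenvalues and eigenfunctions of the operators on rational functions -/

/-- Each difference of eigenvalues is a polynomial in `u`, nonzero because it does not vanish at
`-t`. Finitely many dominated pairs give finitely many roots. -/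
theorem finite_not_separates [CharZero F] {q t r : Fˣ} (hr : r ^ 2 = q)
    (h : AlgebraicIndependent ℚ ![(q : F), (t : F)]) (lam : Par n) :
    {u : F | ¬ Separates r t lam u}.Finite := by
  let e : Par n → Polynomial F := fun mu => Polynomial.C ((r : F) ^ (-mu.size)) * ∏ i : Fin n,
    (1 - Polynomial.C (((r : F) ^ 2) ^ mu.1 i * (t : F) ^ (n - 1 - (i : ℕ))) * Polynomial.X)
  have he : ∀ mu u, (e mu).eval u = eigenE r t mu u := fun mu u => by
    simp [e, eigenE, Polynomial.eval_prod]
  let d : ℤ × Par n → Polynomial F := fun p => Polynomial.C ((r : F) ^ p.1) * e p.2 - e lam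
  have hd : ∀ p u, (d p).eval u = (r : F) ^ p.1 * eigenE r t p.2 u - eigenE r t lam u :=
    fun p u => by simp only [d, Polynomial.eval_sub, Polynomial.eval_mul, Polynomial.eval_C, he]
  refine (((finite_below 0 lam).subset (Set.sdiff_subset (t := {(0, lam)}))).biUnion
    fun p hp => Polynomial.finite_setOfPred_isRoot (p := d p) fun h0 => ?_).subset fun u hu => ?_
  · have := hd p (-t)
    rw [h0, Polynomial.eval_zero] at this
    exact separates_neg hr h lam p hp (sub_eq_zero.1 this.symm)
  · simp only [Separates, not_forall, not_not, Set.mem_ofPred_eq] at hu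
    obtain ⟨p, hp, hu⟩ := hu
    refine Set.mem_biUnion hp ?_
    show (d p).eval u = 0
    rw [hd, hu, sub_self]

theorem diffOpS_toRat_eq_smul_iff {r t : Fˣ} {u c : F} {f : SLaurent F n} :
    diffOpS r t u (toRat f) = constR n c * toRat f ↔ opA r t u f = weylDen F n * (c • f) := by
  rw [← diffOpS_toRat_iff, toRat_eq (c • f), toRatHom_smul]
  rfl

theorem opA_T_smul {r t : Fˣ} {u E : F} {f : SLaurent F n}
    (hf : opA r t u f = weylDen F n * (E • f)) (k : ℤ) :
    opA r t u ((LaurentPolynomial.T k : F[T;T⁻¹]) • f) =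
      weylDen F n * (((r : F) ^ k * E) • (LaurentPolynomial.T k : F[T;T⁻¹]) • f) := by
  rw [opA_smul, hf, scaleS_T, mul_smul, mul_smul, LaurentPolynomial.C_eq_algebraMap,
    algebraMap_smul, Units.val_zpow_eq_zpow_val]
  simp only [mul_smul_comm]
  rw [smul_comm (LaurentPolynomial.T k : F[T;T⁻¹]) E]

/-! ### Comparison with Okounkov's polynomials -/

theorem toSField_single (a : Fin n → ℤ) (c : F[T;T⁻¹]) :
    toSField (AddMonoidAlgebra.single a c) =
      AddMonoidAlgebra.single a (algebraMap F[T;T⁻¹] (SField F) c) :=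
  AddMonoidAlgebra.map_single _ _ _

theorem coeff_toSField (f : SLaurent F n) (a : Fin n → ℤ) :
    (toSField f).coeff a = algebraMap F[T;T⁻¹] (SField F) (f.coeff a) := rfl

theorem evalPar_toSField (q t : Fˣ) (f : SLaurent F n) (mu : Par n) :
    evalPar q t (toSField f) mu = algebraMap F[T;T⁻¹] (SField F) (ev q t mu.exp f) := by
  induction f using AddMonoidAlgebra.induction_linear with
  | zero => simp [evalPar, toSField]
  | add f g hf hg =>
    simp only [evalPar, toSField, map_add] at hf hg ⊢
    rw [hf, hg]
  | single a c =>
    rw [toSField_single, evalPar, evalAt_single, ev_single, map_mul]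
    congr 1
    have h : ∀ i : Fin n, constS (q ^ mu.1 i * t ^ (n - 1 - (i : ℕ))) * sS F =
        Units.map (algebraMap F[T;T⁻¹] (SField F)).toMonoidHom (parPt q t mu.exp i) := fun i => by
      rw [parPt, map_mul, Par.exp, zpow_natCast]
      rfl
    simp only [h, ← map_zpow, ← map_prod]
    rfl

theorem coeff_rescale {R : Type*} [CommRing R] (z : Fin n → Rˣ) (f : Laurent R n)
    (a : Fin n → ℤ) : (rescale z f).coeff a = f.coeff a * ((∏ i, z i ^ a i : Rˣ) : R) := by
  induction f using AddMonoidAlgebra.induction_linear with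
  | zero => simp
  | add f g hf hg => simp only [map_add, AddMonoidAlgebra.coeff_add, Finsupp.add_apply, hf, hg,
      add_mul]
  | single b c =>
    have h : rescale z (AddMonoidAlgebra.single b c) =
      AddMonoidAlgebra.single b (c * ((∏ i, z i ^ b i : Rˣ) : R)) := twistHom_single _ _ _
    rw [h, AddMonoidAlgebra.coeff_single, AddMonoidAlgebra.coeff_single, Finsupp.single_apply,
      Finsupp.single_apply]
    split_ifs with hb
    · rw [hb]
    · rw [zero_mul]

theorem evalAt_rescale {R : Type*} [CommRing R] (z w : Fin n → Rˣ) (f : Laurent R n) :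
    evalAt w (rescale z f) = evalAt (fun i => w i * z i) f := by
  induction f using AddMonoidAlgebra.induction_linear with
  | zero => simp
  | add f g hf hg => simp only [map_add, hf, hg]
  | single b c =>
    have h : rescale z (AddMonoidAlgebra.single b c) =
      AddMonoidAlgebra.single b (c * ((∏ i, z i ^ b i : Rˣ) : R)) := twistHom_single _ _ _
    rw [h, evalAt_single, evalAt_single, mul_assoc, ← Units.val_mul, ← Finset.prod_mul_distrib]
    simp only [mul_zpow, mul_comm]

theorem evalAt_okShift (q t : Fˣ) (f : Laurent (SField F) n) (mu : Par n) :
    evalAt (fun i => constS (q ^ mu.1 i)) (okShift t f) = evalPar q t f mu := by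
  rw [okShift, evalAt_rescale, evalPar]
  simp only [← mul_assoc, constS, ← map_mul]

theorem coeff_okShift_ne_zero {t : Fˣ} {f : Laurent (SField F) n} {a : Fin n → ℤ} :
    (okShift t f).coeff a ≠ 0 ↔ f.coeff a ≠ 0 := by
  rw [okShift, coeff_rescale, Ne, Units.mul_left_eq_zero]

theorem okShift_smul (t : Fˣ) (c : SField F) (f : Laurent (SField F) n) :
    okShift t (c • f) = c • okShift t f := map_smul (rescale _) c f

theorem evalPar_smul (q t : Fˣ) (c : SField F) (f : Laurent (SField F) n) (mu : Par n) :
    evalPar q t (c • f) mu = c * evalPar q t f mu := map_smul (evalAt _) c f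

theorem evalPar_sub (q t : Fˣ) (f g : Laurent (SField F) n) (mu : Par n) :
    evalPar q t (f - g) mu = evalPar q t f mu - evalPar q t g mu := map_sub (evalAt _) f g

theorem isBCSymm_toSField {f : SLaurent F n} : IsBCSymm (toSField f) ↔ IsBCSymm f := by
  simp only [IsBCSymm, coeff_toSField,
    (IsFractionRing.injective F[T;T⁻¹] (SField F)).eq_iff]

theorem exists_toSField_eq_smul (h : Laurent (SField F) n) :
    ∃ b : F[T;T⁻¹], b ≠ 0 ∧ ∃ p : SLaurent F n,
      toSField p = algebraMap F[T;T⁻¹] (SField F) b • h := by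
  obtain ⟨b, hb⟩ := IsLocalization.exist_integer_multiples (nonZeroDivisors F[T;T⁻¹])
    h.coeff.support fun a => h.coeff a
  choose! c hc using hb
  refine ⟨b, nonZeroDivisors.coe_ne_zero b,
    ∑ a ∈ h.coeff.support, AddMonoidAlgebra.single a (c a), ?_⟩
  have h1 : h = ∑ a ∈ h.coeff.support, AddMonoidAlgebra.single a (h.coeff a) :=
    (AddMonoidAlgebra.sum_coeff_single h).symm
  conv_rhs => rw [h1]
  rw [toSField, map_sum, Finset.smul_sum]
  refine Finset.sum_congr rfl fun a ha => ?_
  rw [← toSField, toSField_single, hc a ha, AddMonoidAlgebra.smul_single]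
  rw [Algebra.smul_def, smul_eq_mul]

section Okounkov

variable {q t : Fˣ} {P : Par n → SLaurent F n}

/-- Clearing the denominators in `s` reduces this to `IsInterpolating.eq_zero_of_degree_le`. -/
theorem IsInterpolating.eq_zero_of_evalPar (hP : IsInterpolating q t P) {d : ℤ}
    {h : Laurent (SField F) n} (hs : IsBCSymm h) (hd : ∀ a, h.coeff a ≠ 0 → ∑ i, |a i| ≤ d)
    (h0 : ∀ nu : Par n, nu.size ≤ d → evalPar q t h nu = 0) : h = 0 := by
  have hinj := IsFractionRing.injective F[T;T⁻¹] (SField F)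
  obtain ⟨b, hb, p, hp⟩ := exists_toSField_eq_smul h
  have hb' : algebraMap F[T;T⁻¹] (SField F) b ≠ 0 := fun h => hb (hinj (h.trans (map_zero _).symm))
  have hp0 : p = 0 := by
    refine hP.eq_zero_of_degree_le (d := d) (isBCSymm_toSField.1 (hp ▸ Submodule.smul_mem
      (symSub _ n) _ hs)) (fun mu hmu => ?_) fun nu hnu => hinj ?_
    · have h1 := hd mu.exp fun h2 => hmu (hinj ?_)
      · simpa [Par.exp, Par.size] using h1
      · rw [← coeff_toSField, hp, AddMonoidAlgebra.coeff_smul, Finsupp.smul_apply, h2, smul_zero,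
          map_zero]
    · rw [← evalPar_toSField, hp, evalPar_smul, h0 nu hnu, mul_zero, map_zero]
  rw [hp0, toSField, map_zero] at hp
  exact (smul_eq_zero.1 hp.symm).resolve_left hb'

theorem sum_abs_le_of_coeff_ne_zero {lam : Par n} {f : SLaurent F n} (hf : f ∈ domSpan F 0 lam)
    {a : Fin n → ℤ} (ha : f.coeff a ≠ 0) : ∑ i, |a i| ≤ lam.size := by
  obtain ⟨l, hl⟩ : ∃ l, cf (a, l) f ≠ 0 := by
    by_contra! h
    refine ha ?_
    ext l
    exact h l
  by_contra hlt
  refine hl (cf_eq_zero_of_mem (domSpan_le_monSpan 0 lam hf) fun hx => hlt ?_)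
  have := (abs_nonneg _).trans hx.2
  exact sub_nonneg.1 this

theorem IsInterpolating.evalPar_vanish (hP : IsInterpolating q t P) {lam mu : Par n}
    (h : ¬ lam.Contained mu) : evalPar q t (toSField (P lam)) mu = 0 := by
  rw [evalPar_toSField, hP.vanish lam mu h, map_zero]

theorem IsInterpolating.evalPar_ne_zero (hP : IsInterpolating q t P) (lam : Par n) :
    evalPar q t (toSField (P lam)) lam ≠ 0 := by
  rw [evalPar_toSField]
  exact fun h => hP.ne_zero lam
    (IsFractionRing.injective F[T;T⁻¹] (SField F) (h.trans (map_zero _).symm))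

theorem IsInterpolating.isBCSymm (hP : IsInterpolating q t P) (lam : Par n) :
    IsBCSymm (P lam) := by
  have := (isMonicTriangular_iff.1 (hP.monic lam)).1
  rw [domSpan_eq] at this
  exact isBCSymm_of_mem_sSpan this

theorem IsInterpolating.isOkounkov_iff (hP : IsInterpolating q t P) {lam : Par n}
    {g : Laurent (SField F) n} :
    IsOkounkov q t lam g ↔ ∃ c : SField F, c ≠ 0 ∧ g = c • okShift t (toSField (P lam)) := by
  have hsym := isBCSymm_toSField.2 (hP.isBCSymm lam)
  have hdeg : ∀ a, (toSField (P lam)).coeff a ≠ 0 → ∑ i, |a i| ≤ lam.size := fun a ha =>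
    sum_abs_le_of_coeff_ne_zero (isMonicTriangular_iff.1 (hP.monic lam)).1 fun h0 => ha (by
      rw [coeff_toSField, h0, map_zero])
  have hvan : ∀ mu : Par n, mu.size ≤ lam.size → mu ≠ lam →
      evalPar q t (toSField (P lam)) mu = 0 := fun mu hmu hne =>
    hP.evalPar_vanish fun hc => hne (Par.eq_of_contained hc hmu).symm
  have hne := hP.evalPar_ne_zero lam
  constructor
  · rintro ⟨⟨f, hf, rfl⟩, hd, hv, h0⟩
    simp only [evalAt_okShift, coeff_okShift_ne_zero] at hd hv h0
    -- This scalar matches the values at `λ`; at the other partitions of size at most `|λ|` both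
    -- sides vanish, so the difference is zero by its degree.
    set c := evalPar q t f lam / evalPar q t (toSField (P lam)) lam with hc
    have key : f - c • toSField (P lam) = 0 := by
      refine hP.eq_zero_of_evalPar (d := lam.size)
        (Submodule.sub_mem (symSub _ n) hf (Submodule.smul_mem (symSub _ n) _ hsym))
        (fun a ha => ?_) fun nu hnu => ?_
      · by_contra hlt
        refine ha ?_
        rw [AddMonoidAlgebra.coeff_sub, AddMonoidAlgebra.coeff_smul, Finsupp.sub_apply,
          Finsupp.smul_apply, not_not.1 (mt (hd a) hlt), not_not.1 (mt (hdeg a) hlt), smul_zero,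
          sub_zero]
      · rw [evalPar_sub, evalPar_smul]
        by_cases h : nu = lam
        · rw [h, hc, div_mul_cancel₀ _ hne, sub_self]
        · rw [hv nu hnu h, hvan nu hnu h, mul_zero, sub_zero]
    exact ⟨c, div_ne_zero h0 hne, by rw [← okShift_smul, ← sub_eq_zero.1 key]⟩
  · rintro ⟨c, hc, rfl⟩
    rw [← okShift_smul]
    refine ⟨⟨_, Submodule.smul_mem (symSub _ n) _ hsym, rfl⟩, fun a ha => ?_, fun mu hmu hne => ?_,
      ?_⟩
    · rw [coeff_okShift_ne_zero, AddMonoidAlgebra.coeff_smul, Finsupp.smul_apply, smul_eq_mul] at ha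
      exact hdeg a (right_ne_zero_of_mul ha)
    · rw [evalAt_okShift, evalPar_smul, hvan mu hmu hne, mul_zero]
    · rw [evalAt_okShift, evalPar_smul]
      exact mul_ne_zero hc hne

end Okounkov

end BCInterp

end

/-! ### The main theorem -/

theorem mainTheorem1 {F : Type*} [Field F] [CharZero F] (n : ℕ) (q t r : Fˣ) (hr : r ^ 2 = q)
    (hqt : AlgebraicIndependent ℚ ![(q : F), (t : F)]) :
    -- the operators preserve the span of the monomials dominated by any `s ^ k * m_lam`
    (∀ (u : F) (k : ℤ) (lam : Par n), ∀ f ∈ domSpan F k lam,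
      ∃ g ∈ domSpan F k lam, diffOpS r t u (toRat f) = toRat g) ∧
    -- they commute on the `BC_n`-symmetric elements
    (∀ (u v : F) (f : SLaurent F n), IsBCSymm f →
      diffOpS r t u (diffOpS r t v (toRat f)) = diffOpS r t v (diffOpS r t u (toRat f))) ∧
    ∃ P : Par n → SLaurent F n, ∀ lam : Par n,
      -- coefficients in `ℚ(q, t)[s, 1/s]`, symmetry and triangularity
      (∀ (a : Fin n → ℤ) (k : ℤ),
        ((P lam).coeff a).coeff k ∈ Subfield.closure {(q : F), (t : F)}) ∧
      IsBCSymm (P lam) ∧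
      IsMonicTriangular lam (P lam) ∧
      -- `s ^ k * P lam` is a common eigenfunction of all the operators
      (∀ (u : F) (k : ℤ),
        diffOpS r t u (toRat ((LaurentPolynomial.T k : LaurentPolynomial F) • P lam)) =
          constR n ((r : F) ^ k * eigenE r t lam u) *
            toRat ((LaurentPolynomial.T k : LaurentPolynomial F) • P lam)) ∧
      -- it is already determined as an eigenfunction for any one generic `u`
      (∃ B : Set F, B.Finite ∧ ∀ u ∉ B, ∀ f : SLaurent F n, IsMonicTriangular lam f →
        (∃ c : F, diffOpS r t u (toRat f) = constR n c * toRat f) → f = P lam) ∧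
      -- extra vanishing
      (∀ mu : Par n, ¬ lam.Contained mu → evalPar q t (toSField (P lam)) mu = 0) ∧
      evalPar q t (toSField (P lam)) lam ≠ 0 ∧
      -- agreement with Okounkov's polynomials up to normalization
      (∀ g : Laurent (SField F) n, IsOkounkov q t lam g ↔
        ∃ c : SField F, c ≠ 0 ∧ g = c • okShift t (toSField (P lam))) := by 
  have hz := mulIndep_of_algebraicIndependent hqt
  obtain ⟨P, hP⟩ := exists_isInterpolating (n := n) hr hqt
  refine ⟨fun u k lam f hf => ?_, fun u v f hf => ?_, P, fun lam => ⟨hP.coeff_mem lam,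
    hP.isBCSymm lam, hP.monic lam, fun u k => ?_, ⟨_, finite_not_separates hr hqt lam, ?_⟩,
    fun mu hmu => hP.evalPar_vanish hmu, hP.evalPar_ne_zero lam, fun g => hP.isOkounkov_iff⟩⟩
  · obtain ⟨g, hg, he⟩ := exists_opA_domSpan r t u hf
    exact ⟨g, hg, diffOpS_toRat_iff.2 he⟩
  · obtain ⟨g₁, g₂, h, e1, e2, e3, e4⟩ := hP.opA_comm hr hz u v hf
    rw [diffOpS_toRat_iff.2 e1, diffOpS_toRat_iff.2 e2, diffOpS_toRat_iff.2 e3,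
      diffOpS_toRat_iff.2 e4]
  · exact diffOpS_toRat_eq_smul_iff.2 (opA_T_smul (hP.opA_eq hr hz u lam) k)
  · rintro u hu f hf ⟨c, hc⟩
    exact eigenfunction_unique (not_not.1 hu) (hP.monic lam) (hP.opA_eq hr hz u lam) hf
      (diffOpS_toRat_eq_smul_iff.1 hc)
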